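/- Let $d\ge 2$ be an integer, let $\mathbb S_{d-1}$ be the unit sphere of $\mathbb R^d$ with its rotation invariant surface measure $d\mathrm n$, of total mass $\omega_d=2\pi^{d/2}/\Gamma(d/2)$, and for $a_1,a_2,a_3\in\mathbb C$ put $a=a_1+a_2+a_3$ and $$J(a_1,a_2,a_3)=\frac1{\omega_d^3}\int_{\mathbb S_{d-1}^3}(|\mathrm n_1-\mathrm n_2|^2)^{a_3}(|\mathrm n_2-\mathrm n_3|^2)^{a_1}(|\mathrm n_3-\mathrm n_1|^2)^{a_2}\,d\mathrm n_1\,d\mathrm n_2\,d\mathrm n_3 .$$ (1) If $\operatorname{Re}a_j>-\frac{d-1}2$ for $j=1,2,3$ and $\operatorname{Re}a>-(d-1)$, then the integral converges absolutely and $$J(a_1,a_2,a_3)=2^{\frac{3d-5}2+2a}(2\pi)^{\frac{d-1}2}\,\frac{\omega_{d-1}}{\omega_d^2}\;\frac{\Gamma(a+d-1)\,\Gamma(\frac{d-1}2+a_1)\,\Gamma(\frac{d-1}2+a_2)\,\Gamma(\frac{d-1}2+a_3)}{\Gamma(d-1+a_2+a_3)\,\Gamma(d-1+a_3+a_1)\,\Gamma(d-1+a_1+a_2)}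 .$$ (2) Let $\kappa,\nu,\lambda\in\mathbb R$, $$a_1=-\tfrac{d-1}4-\tfrac i2(\nu+\lambda-\kappa),\quad a_2=-\tfrac{d-1}4-\tfrac i2(\lambda+\kappa-\nu),\quad a_3=-\tfrac{d-1}4-\tfrac i2(\kappa+\nu-\lambda),\quad a=a_1+a_2+a_3 ,$$ and let $$h_d(\kappa,\nu,\lambda)=\int_1^\infty P^{-\frac{d-2}2}_{-\frac12+i\kappa}(u)\,P^{-\frac{d-2}2}_{-\frac12+i\nu}(u)\,P^{-\frac{d-2}2}_{-\frac12+i\lambda}(u)\,(u^2-1)^{-\frac{d-2}4}\,du ,$$ where $P^\mu_\alpha$ is the associated Legendre function of the first kind on $(1,\infty)$. This integral converges absolutely. Let $x\cdot y=x^0y^0-x^1y^1-\dots-x^dy^d$, let $C^+=\{\xi\in\mathbb R^{d+1}:\xi\cdot\xi=0,\ \xi^0>0\}$, and let $\mathcal M=\{y\in\mathbb R^{d+1}:y\cdot y=1,\ y^0>0\}$ carry the measure $dy=(u^2-1)^{\frac{d-2}2}\,du\,d\mathrm n$ in the coordinates $y=(u,\sqrt{u^2-1}\,\mathrm n)$,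 $u>1$, $\mathrm n\in\mathbb S_{d-1}$. There is a constant $c=c(a_1,a_2,a_3)$ such that, for all $\xi_1,\xi_2,\xi_3\in C^+$ no two of which are proportional, $$\int_{\mathcal M}(y\cdot\xi_1)^{a_2+a_3}(y\cdot\xi_2)^{a_3+a_1}(y\cdot\xi_3)^{a_1+a_2}\,dy=c\,(\xi_1\cdot\xi_2)^{a_3}(\xi_2\cdot\xi_3)^{a_1}(\xi_3\cdot\xi_1)^{a_2}$$ with an absolutely convergent integral; it is $$c=2^{-a-1}\pi^{\frac{d-1}2}\,\Gamma\!\left(-a-\tfrac{d-1}2\right)\frac{\Gamma(-a_1)\Gamma(-a_2)\Gamma(-a_3)}{\Gamma(-a_2-a_3)\Gamma(-a_3-a_1)\Gamma(-a_1-a_2)} ,$$ and $$h_d(\kappa,\nu,\lambda)=\frac{2^{-a}\,\omega_d^2}{(2\pi)^{3d/2}}\;c(a_1,a_2,a_3)\,J(a_1,a_2,a_3) =\frac{2^{d/2}\,\Gamma(-a-\frac{d-1}2)\,\Gamma(a+d-1)}{(4\pi)^{3/2}\,\Gamma(\frac{d-1}2)}\prod_{j=1}^3\frac{\Gamma(\frac{d-1}2+a_j)\,\Gamma(-a_j)}{\Gamma(d-1+a-a_j)\,\Gamma(a_j-a)}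 ,$$ that is, $$h_d(\kappa,\nu,\lambda)=\frac{2^{d/2}}{(4\pi)^{3/2}\,\Gamma(\frac{d-1}2)}\;\frac{\prod_{\epsilon,\epsilon',\epsilon''=\pm1}\Gamma\!\left(\frac{d-1}4+\frac{i(\epsilon\kappa+\epsilon'\nu+\epsilon''\lambda)}2\right)}{\prod_{\epsilon=\pm1}\Gamma(\frac{d-1}2+i\epsilon\kappa)\,\Gamma(\frac{d-1}2+i\epsilon\nu)\,\Gamma(\frac{d-1}2+i\epsilon\lambda)} .$$ -/

import Mathlib

open MeasureTheory Real

noncomputable section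

/-- The unit sphere `S^{d-1}` of `ℝ^d`. -/
abbrev USphere (d : ℕ) : Type := Metric.sphere (0 : EuclideanSpace ℝ (Fin d)) 1

/-- The rotation invariant (surface) measure on `S^{d-1}`, of total mass `ω_d`. -/
def sphereMeasure (d : ℕ) : Measure (USphere d) :=
  (volume : Measure (EuclideanSpace ℝ (Fin d))).toSphere

/-- The area `ω_d = 2 π^{d/2} / Γ(d/2)` of `S^{d-1}`. -/
def sphereArea (d : ℕ) : ℝ := 2 * π ^ ((d : ℝ) / 2) / Real.Gamma ((d : ℝ) / 2)

/-- `(Δn₁₂²)^{a₃} (Δn₂₃²)^{a₁} (Δn₃₁²)^{a₂}` as a function of three points of the sphere. -/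
def triangleFun (d : ℕ) (a₁ a₂ a₃ : ℂ) (n : USphere d × USphere d × USphere d) : ℂ :=
  ((dist n.1 n.2.1 ^ 2 : ℝ) : ℂ) ^ a₃ * ((dist n.2.1 n.2.2 ^ 2 : ℝ) : ℂ) ^ a₁ *
    ((dist n.2.2 n.1 ^ 2 : ℝ) : ℂ) ^ a₂

/-- The product of three copies of the surface measure. -/
def sphereMeasure₃ (d : ℕ) : Measure (USphere d × USphere d × USphere d) :=
  (sphereMeasure d).prod ((sphereMeasure d).prod (sphereMeasure d))

/-- The triangular invariant: the average of `triangleFun` over three points of `S^{d-1}`. -/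
def triangularJ (d : ℕ) (a₁ a₂ a₃ : ℂ) : ℂ :=
  ⨍ n, triangleFun d a₁ a₂ a₃ n ∂(sphereMeasure₃ d)

/-- Minkowski space of dimension `d + 1`: a time coordinate and `d` space coordinates. -/
abbrev Minkowski (d : ℕ) : Type := ℝ × EuclideanSpace ℝ (Fin d)

/-- The Lorentz product `x⁰ y⁰ - x¹ y¹ - ⋯ - x^d y^d`. -/
def lorentz {d : ℕ} (x y : Minkowski d) : ℝ := x.1 * y.1 - inner ℝ x.2 y.2

/-- The forward light-cone `C⁺`. -/
def forwardCone (d : ℕ) : Set (Minkowski d) := {ξ | lorentz ξ ξ = 0 ∧ 0 < ξ.1}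

/-- The point `(u, √(u² - 1) n)` of the hyperboloid `y · y = 1`, `y⁰ > 0`. -/
def hyperboloidPoint (d : ℕ) (p : ℝ × USphere d) : Minkowski d :=
  (p.1, √(p.1 ^ 2 - 1) • (p.2 : EuclideanSpace ℝ (Fin d)))

/-- The Lorentz invariant measure `dy = (u² - 1)^{(d-2)/2} du dn` carried by the upper sheet of
the hyperboloid `y · y = 1` (Lobachevski space), as a measure on the ambient space. -/
def hyperboloidMeasure (d : ℕ) : Measure (Minkowski d) :=
  Measure.map (hyperboloidPoint d)
    (((volume.restrict (Set.Ioi (1 : ℝ))).withDensity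
      (fun u => ENNReal.ofReal ((u ^ 2 - 1) ^ (((d : ℝ) - 2) / 2)))).prod (sphereMeasure d))

/-- The integrand `(y·ξ₁)^{a₂+a₃} (y·ξ₂)^{a₃+a₁} (y·ξ₃)^{a₁+a₂}` of the star integral. -/
def starFun {d : ℕ} (a₁ a₂ a₃ : ℂ) (ξ₁ ξ₂ ξ₃ y : Minkowski d) : ℂ :=
  (lorentz y ξ₁ : ℂ) ^ (a₂ + a₃) * (lorentz y ξ₂ : ℂ) ^ (a₃ + a₁) *
    (lorentz y ξ₃ : ℂ) ^ (a₁ + a₂)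

/-- `c` is the constant of the star-triangle relation
`∫ (y·ξ₁)^{a₂+a₃} (y·ξ₂)^{a₃+a₁} (y·ξ₃)^{a₁+a₂} dy = c (ξ₁·ξ₂)^{a₃} (ξ₂·ξ₃)^{a₁} (ξ₃·ξ₁)^{a₂}`,
valid for all `ξ₁, ξ₂, ξ₃` on the forward light-cone no two of which are proportional (that is,
with nonzero Lorentz products); the integral, over Lobachevski space, converges absolutely. -/
def IsStarTriangleConst (d : ℕ) (a₁ a₂ a₃ c : ℂ) : Prop :=
  ∀ ξ₁ ∈ forwardCone d, ∀ ξ₂ ∈ forwardCone d, ∀ ξ₃ ∈ forwardCone d,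
    lorentz ξ₁ ξ₂ ≠ 0 → lorentz ξ₂ ξ₃ ≠ 0 → lorentz ξ₃ ξ₁ ≠ 0 →
      Integrable (starFun a₁ a₂ a₃ ξ₁ ξ₂ ξ₃) (hyperboloidMeasure d) ∧
      ∫ y, starFun a₁ a₂ a₃ ξ₁ ξ₂ ξ₃ y ∂(hyperboloidMeasure d) =
        c * ((lorentz ξ₁ ξ₂ : ℂ) ^ a₃ * (lorentz ξ₂ ξ₃ : ℂ) ^ a₁ * (lorentz ξ₃ ξ₁ : ℂ) ^ a₂)

/-- The Legendre function of the first kind `P^μ_ν(u)` for real `u > 1`, that is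
`((u+1)/(u-1))^{μ/2} F(-ν, ν+1; 1-μ; (1-u)/2) / Γ(1-μ)`. Here Gauss' function `F(a, b; c; x)`, for
`x = (1-u)/2 < 0`, is `(1-x)^{-a} F(a, c-b; c; x/(x-1))` (its continuation from `|x| < 1` to
all of `x < 0`), where `x/(x-1) = (u-1)/(u+1)` lies in the unit disc, in which the series of
`F(a, b; c; ·) / Γ(c)` (`Complex.regularizedGaussHGFun`) converges. -/
def legendreP (μ ν : ℂ) (u : ℝ) : ℂ :=
  (((u + 1) / (u - 1) : ℝ) : ℂ) ^ (μ / 2) * (((u + 1) / 2 : ℝ) : ℂ) ^ ν *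
    Complex.regularizedGaussHGFun (-ν) (-μ - ν) (1 - μ) (((u - 1) / (u + 1) : ℝ) : ℂ)

/-- The integrand of `h_d(κ, ν, l)`, a product of three Legendre functions of the first kind. -/
def legendreTriple (d : ℕ) (κ ν l : ℝ) (u : ℝ) : ℂ :=
  legendreP (-(((d : ℂ) - 2) / 2)) (-1 / 2 + Complex.I * κ) u *
    legendreP (-(((d : ℂ) - 2) / 2)) (-1 / 2 + Complex.I * ν) u *
    legendreP (-(((d : ℂ) - 2) / 2)) (-1 / 2 + Complex.I * l) u *
    (((u ^ 2 - 1) ^ (-(((d : ℝ) - 2) / 4)) : ℝ) : ℂ)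

/-- `h_d(κ, ν, l)`, the integral over `(1, ∞)` of the product of three Legendre functions. -/
def hIntegral (d : ℕ) (κ ν l : ℝ) : ℂ := ∫ u in Set.Ioi (1 : ℝ), legendreTriple d κ ν l u

/-- `Γ((d-1)/4 + i t/2)`, a factor of the closed form of `h_d`. -/
def quarterGamma (d : ℕ) (t : ℝ) : ℂ := Complex.Gamma (((d : ℂ) - 1) / 4 + Complex.I * t / 2)

/-- `Γ((d-1)/2 + i t) Γ((d-1)/2 - i t)`. -/
def halfGammaPair (d : ℕ) (t : ℝ) : ℂ :=
  Complex.Gamma (((d : ℂ) - 1) / 2 + Complex.I * t) *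
    Complex.Gamma (((d : ℂ) - 1) / 2 - Complex.I * t)

end

/-! Both closed forms come from identities between measures. The measure `logGammaMeasure k`
satisfies `∫ e^{bx} = Γ(b + k)`. If an unknown quantity, joined with independent log-Gamma
variables, has up to a constant the same law as a linear image of independent log-Gamma variables,
then testing on an exponential gives its Mellin-type integral as a quotient of Gamma functions. The
identities are proved for all nonnegative measurable test functions, where Tonelli needs no
convergence hypothesis. Integrability and the complex value are then obtained together from
`integrable_comp_of_lintegral_eq` and `integrable_left_of_mul_prod`.

Star-triangle relation (`lintegral_star_eq`): each power of `y·ξⱼ` is written as a Gamma integral.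
The integral over `y` becomes the Laplace transform of the hyperboloid measure at `T = Σ e^{xⱼ} ξⱼ`,
which depends only on `T·T` (`lintegral_exp_neg_lorentz`). As the `ξⱼ` are lightlike, `T·T` contains
only the products `e^{xᵢ+xⱼ} ξᵢ·ξⱼ`, so the pairwise sums `xᵢ + xⱼ` decouple the integral.

Triangle integral (`lintegral_triangle_eq`), with `n = d - 1`: one point is moved to a pole and the
other two are projected stereographically to `ℝ^n`. Two log-Gamma variables linearize the factors `1
+ ‖x‖²` and a Gaussian integral remains. It leaves a term `log (e^t + e^{t'})`, which the symmetry
`lintegral_logGammaMeasure_swap` and a third auxiliary variable eliminate.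

Legendre functions: the integral of a power of `y·(1, n)` over the sphere is a Legendre function
times a power of `u² - 1` (`integral_sphereMeasure_eq_legendreP`), by the binomial series, the
moments of the sphere and a quadratic transformation of Gauss' function. Integrating the
star-triangle relation over `ξⱼ = (1, nⱼ)` and applying Fubini expresses `h_d` through `c J`. The
eight Gamma factors of the result are four from `c` and four from `J`. -/

/-! ### Polar coordinates and the surface measure of the sphere. -/

theorem lintegral_polar {E : Type*} [NormedAddCommGroup E] [NormedSpace ℝ E] [MeasurableSpace E]
    [BorelSpace E] [FiniteDimensional ℝ E] [Nontrivial E] (μ : Measure E) [μ.IsAddHaarMeasure]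
    {f : E → ENNReal} (hf : Measurable f) :
    ∫⁻ x, f x ∂μ = ∫⁻ n, (∫⁻ r in Set.Ioi (0 : ℝ),
      ENNReal.ofReal (r ^ (Module.finrank ℝ E - 1)) * f (r • (n : E))) ∂μ.toSphere := by
  have hmp := μ.measurePreserving_homeomorphUnitSphereProd
  have hg : Measurable fun p : Metric.sphere (0 : E) 1 × Set.Ioi (0 : ℝ) =>
      f ((p.2 : ℝ) • (p.1 : E)) := by fun_prop
  calc ∫⁻ x, f x ∂μ = ∫⁻ x in ({0}ᶜ : Set E), f x ∂μ := by
        rw [restrict_compl_singleton]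
    _ = ∫⁻ x : ({0}ᶜ : Set E), f x ∂(μ.comap (↑)) := by
        rw [lintegral_subtype_comap (measurableSet_singleton _).compl]
    _ = ∫⁻ p, f ((p.2 : ℝ) • (p.1 : E)) ∂(μ.toSphere.prod
          (Measure.volumeIoiPow (Module.finrank ℝ E - 1))) := by
        rw [← hmp.lintegral_comp hg]
        refine lintegral_congr fun x => ?_
        congr 1
        have := (homeomorphUnitSphereProd E).symm_apply_apply x
        exact (congrArg Subtype.val this).symm
    _ = _ := by
        rw [lintegral_prod _ hg.aemeasurable]
        refine lintegral_congr fun n => ?_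
        rw [Measure.volumeIoiPow, lintegral_withDensity_eq_lintegral_mul _ (by fun_prop)
          (by fun_prop)]
        exact lintegral_subtype_comap measurableSet_Ioi
          (fun r : ℝ => ENNReal.ofReal (r ^ (Module.finrank ℝ E - 1)) * f (r • (n : E)))

theorem lintegral_direction_mul_norm {E : Type*} [NormedAddCommGroup E] [NormedSpace ℝ E]
    [MeasurableSpace E] [BorelSpace E] [FiniteDimensional ℝ E] [Nontrivial E] (μ : Measure E)
    [μ.IsAddHaarMeasure] {f : E → ENNReal} (hf : Measurable f) {g : ℝ → ENNReal}
    (hg : Measurable g) :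
    ∫⁻ x, f (‖x‖⁻¹ • x) * g ‖x‖ ∂μ = (∫⁻ n, f (n : E) ∂μ.toSphere) *
      ∫⁻ r in Set.Ioi (0 : ℝ), ENNReal.ofReal (r ^ (Module.finrank ℝ E - 1)) * g r := by
  rw [lintegral_polar μ (by fun_prop), ← lintegral_mul_const _ (by fun_prop)]
  refine lintegral_congr fun n => ?_
  rw [← lintegral_const_mul _ (by fun_prop)]
  refine setLIntegral_congr_fun measurableSet_Ioi fun r (hr : 0 < r) => ?_
  have hn : ‖(n : E)‖ = 1 := by simp
  have h : ‖r • (n : E)‖ = r := by rw [norm_smul, hn, Real.norm_eq_abs, abs_of_pos hr, mul_one]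
  simp only [h]
  rw [smul_smul, inv_mul_cancel₀ hr.ne', one_smul]
  ring

theorem lintegral_pow_mul_exp_neg (n : ℕ) :
    ∫⁻ r in Set.Ioi (0 : ℝ), ENNReal.ofReal (r ^ n) * ENNReal.ofReal (exp (-r)) =
      ENNReal.ofReal (n.factorial) := by
  have h := Real.GammaIntegral_convergent (s := n + 1) (by positivity)
  rw [← Real.Gamma_nat_eq_factorial, Real.Gamma_eq_integral (by positivity),
    ofReal_integral_eq_lintegral_ofReal h]
  · refine setLIntegral_congr_fun measurableSet_Ioi fun r (hr : 0 < r) => ?_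
    rw [← ENNReal.ofReal_mul (by positivity), mul_comm, add_sub_cancel_right, rpow_natCast]
  · filter_upwards [ae_restrict_mem measurableSet_Ioi] with r (hr : 0 < r)
    positivity

/-- A criterion for the value of a surface integral in terms of a Lebesgue integral. -/
theorem lintegral_toSphere_eq_of_exp {E : Type*} [NormedAddCommGroup E] [NormedSpace ℝ E]
    [MeasurableSpace E] [BorelSpace E] [FiniteDimensional ℝ E] [Nontrivial E] (μ : Measure E)
    [μ.IsAddHaarMeasure] {f : E → ENNReal} (hf : Measurable f) {I : ENNReal}
    (h : ∫⁻ x, f (‖x‖⁻¹ • x) * ENNReal.ofReal (exp (-‖x‖)) ∂μ =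
      I * ENNReal.ofReal ((Module.finrank ℝ E - 1).factorial)) :
    ∫⁻ n, f (n : E) ∂μ.toSphere = I := by
  rw [lintegral_direction_mul_norm μ hf (g := fun r => ENNReal.ofReal (exp (-r))) (by fun_prop),
    lintegral_pow_mul_exp_neg] at h
  refine (ENNReal.mul_left_inj ?_ ENNReal.ofReal_ne_top).1 h
  simp [Nat.factorial_ne_zero]

/-- Rotation invariance is inherited from Lebesgue measure, since the weight `exp (-‖x‖)` is itself
invariant. -/
theorem lintegral_sphereMeasure_isometry {d : ℕ} (hd : 1 ≤ d)
    (R : EuclideanSpace ℝ (Fin d) ≃ₗᵢ[ℝ] EuclideanSpace ℝ (Fin d))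
    {f : EuclideanSpace ℝ (Fin d) → ENNReal} (hf : Measurable f) :
    ∫⁻ n, f (R n) ∂sphereMeasure d = ∫⁻ n, f n ∂sphereMeasure d := by
  have : Nonempty (Fin d) := ⟨⟨0, hd⟩⟩
  have hR : Measurable R := R.continuous.measurable
  refine lintegral_toSphere_eq_of_exp volume (f := fun x => f (R x)) (by fun_prop) ?_
  rw [← lintegral_pow_mul_exp_neg, sphereMeasure, ← lintegral_direction_mul_norm _ hf
    (g := fun r => ENNReal.ofReal (exp (-r))) (by fun_prop)]
  have h := R.measurePreserving.lintegral_comp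
    (f := fun x => f (‖x‖⁻¹ • x) * ENNReal.ofReal (exp (-‖x‖))) (by fun_prop)
  simpa using h

theorem sphereMeasure_univ {d : ℕ} (hd : 1 ≤ d) :
    sphereMeasure d Set.univ = ENNReal.ofReal (sphereArea d) := by
  have : Nonempty (Fin d) := ⟨⟨0, hd⟩⟩
  have hd' : (0 : ℝ) < d := by exact_mod_cast hd
  rw [sphereMeasure, Measure.toSphere_apply_univ, EuclideanSpace.volume_ball, sphereArea]
  simp only [ENNReal.ofReal_one, one_pow, one_mul, finrank_euclideanSpace, Fintype.card_fin]
  rw [← ENNReal.ofReal_natCast, ← ENNReal.ofReal_mul (by positivity)]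
  congr 1
  rw [Real.Gamma_add_one (by positivity), Real.sqrt_eq_rpow, ← Real.rpow_natCast, ← Real.rpow_mul
    pi_pos.le]
  have := (Real.Gamma_pos_of_pos (s := (d : ℝ) / 2) (by positivity)).ne'
  field_simp

theorem sphereArea_pos {d : ℕ} (hd : 1 ≤ d) : 0 < sphereArea d := by
  have hd' : (0 : ℝ) < d := by exact_mod_cast hd
  have := Real.Gamma_pos_of_pos (s := (d : ℝ) / 2) (by positivity)
  unfold sphereArea
  positivity

/-! ### Integrals and substitutions on the half-line. -/

theorem lintegral_rpow_mul_exp_neg_mul {a r : ℝ} (ha : 0 < a) (hr : 0 < r) :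
    ∫⁻ t in Set.Ioi (0 : ℝ), ENNReal.ofReal (t ^ (a - 1) * exp (-(r * t))) =
      ENNReal.ofReal ((1 / r) ^ a * Real.Gamma a) := by
  have h := Real.integral_rpow_mul_exp_neg_mul_Ioi ha hr
  have hpos : 0 < (1 / r) ^ a * Real.Gamma a :=
    mul_pos (by positivity) (Real.Gamma_pos_of_pos ha)
  rw [← h, ofReal_integral_eq_lintegral_ofReal]
  · exact Integrable.of_integral_ne_zero (by rw [h]; exact hpos.ne')
  · filter_upwards [ae_restrict_mem measurableSet_Ioi] with t (ht : 0 < t)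
    positivity

theorem lintegral_pow_mul_exp_neg_mul (n : ℕ) {k : ℝ} (hk : 0 < k) :
    ∫⁻ r in Set.Ioi (0 : ℝ), ENNReal.ofReal (r ^ n * exp (-(k * r))) =
      ENNReal.ofReal ((1 / k) ^ (n + 1) * n.factorial) := by
  have h := lintegral_rpow_mul_exp_neg_mul (a := n + 1) (by positivity) hk
  rw [Real.Gamma_nat_eq_factorial] at h
  simp only [add_sub_cancel_right, rpow_natCast] at h
  exact_mod_cast h

theorem lintegral_comp_smul_of_pos {E : Type*} [NormedAddCommGroup E] [NormedSpace ℝ E]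
    [MeasurableSpace E] [BorelSpace E] [FiniteDimensional ℝ E] (μ : Measure E)
    [μ.IsAddHaarMeasure] {f : E → ENNReal} (hf : Measurable f) {q : ℝ} (hq : 0 < q) :
    ∫⁻ x, f x ∂μ = ENNReal.ofReal (q ^ Module.finrank ℝ E) * ∫⁻ x, f (q • x) ∂μ := by
  rw [← lintegral_map (g := fun x => q • x) hf (by fun_prop), Measure.map_addHaar_smul μ hq.ne', lintegral_smul_measure,
    smul_eq_mul, ← mul_assoc, ← ENNReal.ofReal_mul (by positivity), abs_of_pos (by positivity),
    mul_inv_cancel₀ (by positivity), ENNReal.ofReal_one, one_mul]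

/-- The substitution `z = A q - B / q` on the half-line. -/
theorem lintegral_eq_lintegral_mul_sub_div {A B : ℝ} (hA : 0 < A) (hB : 0 < B)
    (f : ℝ → ENNReal) :
    ∫⁻ z, f z = ∫⁻ q in Set.Ioi (0 : ℝ), ENNReal.ofReal (A + B / q ^ 2) * f (A * q - B / q) := by
  have himg : (fun q : ℝ => A * q - B / q) '' Set.Ioi 0 = Set.univ := by
    refine Set.eq_univ_of_forall fun z => ?_
    have h0 : 0 ≤ z ^ 2 + 4 * A * B := by positivity
    have hs := Real.sq_sqrt h0
    have hlt : |z| < √(z ^ 2 + 4 * A * B) := by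
      rw [← Real.sqrt_sq_eq_abs]
      exact Real.sqrt_lt_sqrt (sq_nonneg z) (by nlinarith [mul_pos hA hB])
    have hpos : 0 < z + √(z ^ 2 + 4 * A * B) := by linarith [neg_abs_le z]
    -- The positive root of `A q² - z q - B = 0`.
    refine ⟨(z + √(z ^ 2 + 4 * A * B)) / (2 * A), Set.mem_Ioi.2 (by positivity), ?_⟩
    have := hpos.ne'
    set w := √(z ^ 2 + 4 * A * B)
    have h1 : A * ((z + w) / (2 * A)) = (z + w) / 2 := by field_simp
    have h2 : B / ((z + w) / (2 * A)) = (w - z) / 2 := by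
      rw [div_div_eq_mul_div, div_eq_iff this]
      nlinarith
    simp only [h1, h2]
    ring
  rw [← lintegral_image_eq_lintegral_deriv_mul_of_monotoneOn measurableSet_Ioi (f := fun q : ℝ =>
    A * q - B / q), himg, setLIntegral_univ]
  · intro q (hq : 0 < q)
    have h := (((hasDerivAt_id q).const_mul A).sub ((hasDerivAt_inv hq.ne').const_mul B))
    simp only [id] at h
    refine (h.congr_deriv ?_).hasDerivWithinAt
    ring
  · intro p (hp : 0 < p) q (hq : 0 < q) hpq
    have h1 : A * p ≤ A * q := by gcongr
    have h2 : B / q ≤ B / p := by gcongr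
    simp only
    linarith

/-! ### Stereographic coordinates on the sphere. -/

/-- The point `(t, x)` of `ℝ × ℝ^n = ℝ^{n+1}`. -/
def euclideanCons {n : ℕ} (t : ℝ) (x : EuclideanSpace ℝ (Fin n)) : EuclideanSpace ℝ (Fin (n + 1)) :=
  WithLp.toLp 2 (Fin.cons t x.ofLp)

theorem inner_euclideanCons {n : ℕ} (t s : ℝ) (x y : EuclideanSpace ℝ (Fin n)) :
    inner ℝ (euclideanCons t x) (euclideanCons s y) = t * s + inner ℝ x y := by
  simp [euclideanCons, PiLp.inner_apply, Fin.sum_univ_succ, mul_comm]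

theorem norm_euclideanCons_sq {n : ℕ} (t : ℝ) (x : EuclideanSpace ℝ (Fin n)) :
    ‖euclideanCons t x‖ ^ 2 = t ^ 2 + ‖x‖ ^ 2 := by
  rw [← real_inner_self_eq_norm_sq, inner_euclideanCons, real_inner_self_eq_norm_sq, sq t]

theorem smul_euclideanCons {n : ℕ} (c t : ℝ) (x : EuclideanSpace ℝ (Fin n)) :
    c • euclideanCons t x = euclideanCons (c * t) (c • x) := by
  ext i
  refine Fin.cases ?_ (fun j => ?_) i <;> simp [euclideanCons]

theorem measurable_euclideanCons {n : ℕ} :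
    Measurable fun p : ℝ × EuclideanSpace ℝ (Fin n) => euclideanCons p.1 p.2 := by
  refine (WithLp.measurable_toLp 2 _).comp (measurable_pi_lambda _ fun i => ?_)
  refine Fin.cases ?_ (fun j => ?_) i
  · exact measurable_fst
  · simp only [Fin.cons_succ]
    fun_prop

theorem lintegral_euclideanCons {n : ℕ} {f : EuclideanSpace ℝ (Fin (n + 1)) → ENNReal}
    (hf : Measurable f) :
    ∫⁻ z, f z = ∫⁻ x : EuclideanSpace ℝ (Fin n), ∫⁻ t : ℝ, f (euclideanCons t x) := by
  have h1 := (PiLp.volume_preserving_toLp (Fin (n + 1))).lintegral_comp hf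
  have h2 := (volume_preserving_piFinSuccAbove (fun _ : Fin (n + 1) => ℝ) 0).symm
  have h3 := h2.lintegral_comp (f := fun v => f (WithLp.toLp 2 v)) (by fun_prop)
  rw [← h1, ← h3, Measure.volume_eq_prod, lintegral_prod_symm']
  · rw [← (PiLp.volume_preserving_toLp (Fin n)).lintegral_comp]
    · refine lintegral_congr fun v => lintegral_congr fun t => ?_
      simp [euclideanCons, MeasurableEquiv.piFinSuccAbove, Fin.insertNthEquiv]
    · refine Measurable.lintegral_prod_left' (f := fun p : ℝ × EuclideanSpace ℝ (Fin n) => f (euclideanCons p.1 p.2)) ?_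
      exact hf.comp measurable_euclideanCons
  · exact (hf.comp (WithLp.measurable_toLp 2 _)).comp h2.measurable

/-- Inverse stereographic projection from the south pole. -/
noncomputable def stereoPoint {n : ℕ} (x : EuclideanSpace ℝ (Fin n)) : EuclideanSpace ℝ (Fin (n + 1)) :=
  (1 + ‖x‖ ^ 2)⁻¹ • euclideanCons (1 - ‖x‖ ^ 2) ((2 : ℝ) • x)

theorem measurable_stereoPoint {n : ℕ} : Measurable (stereoPoint (n := n)) := by
  have h : Measurable fun x : EuclideanSpace ℝ (Fin n) =>
      euclideanCons (1 - ‖x‖ ^ 2) ((2 : ℝ) • x) :=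
    measurable_euclideanCons.comp (f := fun x : EuclideanSpace ℝ (Fin n) =>
      (1 - ‖x‖ ^ 2, (2 : ℝ) • x)) (by fun_prop)
  have h' : Measurable fun x : EuclideanSpace ℝ (Fin n) => (1 + ‖x‖ ^ 2)⁻¹ := by fun_prop
  exact h'.smul h

theorem inner_stereoPoint {n : ℕ} (x y : EuclideanSpace ℝ (Fin n)) :
    inner ℝ (stereoPoint x) (stereoPoint y) =
      1 - 2 * ‖x - y‖ ^ 2 / ((1 + ‖x‖ ^ 2) * (1 + ‖y‖ ^ 2)) := by
  have hx : 1 + ‖x‖ ^ 2 ≠ 0 := by positivity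
  have hy : 1 + ‖y‖ ^ 2 ≠ 0 := by positivity
  rw [stereoPoint, stereoPoint, real_inner_smul_left, real_inner_smul_right, inner_euclideanCons,
    real_inner_smul_left, real_inner_smul_right, norm_sub_sq_real]
  field_simp
  ring

theorem norm_stereoPoint {n : ℕ} (x : EuclideanSpace ℝ (Fin n)) : ‖stereoPoint x‖ = 1 := by
  have h := inner_stereoPoint x x
  rw [real_inner_self_eq_norm_sq] at h
  simp only [sub_self, norm_zero] at h
  have : ‖stereoPoint x‖ ^ 2 = 1 ^ 2 := by rw [h]; simp
  exact (pow_left_inj₀ (norm_nonneg _) zero_le_one two_ne_zero).1 this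

theorem norm_stereoPoint_sub_sq {n : ℕ} (x y : EuclideanSpace ℝ (Fin n)) :
    ‖stereoPoint x - stereoPoint y‖ ^ 2 =
      4 * ‖x - y‖ ^ 2 / ((1 + ‖x‖ ^ 2) * (1 + ‖y‖ ^ 2)) := by
  rw [norm_sub_sq_real, inner_stereoPoint, norm_stereoPoint, norm_stereoPoint]
  ring

/-- The south pole, from which `stereoPoint` projects. -/
noncomputable def southPole (n : ℕ) : EuclideanSpace ℝ (Fin (n + 1)) := euclideanCons (-1) 0

theorem norm_southPole (n : ℕ) : ‖southPole n‖ = 1 := by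
  have : ‖southPole n‖ ^ 2 = 1 ^ 2 := by rw [southPole, norm_euclideanCons_sq]; simp
  exact (pow_left_inj₀ (norm_nonneg _) zero_le_one two_ne_zero).1 this

theorem norm_southPole_sub_stereoPoint_sq {n : ℕ} (x : EuclideanSpace ℝ (Fin n)) :
    ‖southPole n - stereoPoint x‖ ^ 2 = 4 / (1 + ‖x‖ ^ 2) := by
  have hx : 1 + ‖x‖ ^ 2 ≠ 0 := by positivity
  rw [norm_sub_sq_real, norm_stereoPoint, norm_southPole, stereoPoint, real_inner_smul_right,
    southPole, inner_euclideanCons]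
  simp only [inner_zero_left]
  field_simp
  ring

/-- For `q > 0` this is the point `z = (t, q x)` with `q = t + ‖z‖`: its direction depends on `x`
alone, and `q` only scales it. -/
theorem euclideanCons_eq_smul_stereoPoint {n : ℕ} (q : ℝ) (x : EuclideanSpace ℝ (Fin n)) :
    euclideanCons (q * ((1 - ‖x‖ ^ 2) / 2)) (q • x) =
      (q * ((1 + ‖x‖ ^ 2) / 2)) • stereoPoint x := by
  have hx : 1 + ‖x‖ ^ 2 ≠ 0 := by positivity
  rw [stereoPoint, smul_smul, smul_euclideanCons, smul_smul]
  congr 1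
  · field_simp
  · congr 1
    field_simp

theorem ae_ne_zero_euclidean {n : ℕ} (hn : 1 ≤ n) : ∀ᵐ x : EuclideanSpace ℝ (Fin n), x ≠ 0 := by
  have : Nonempty (Fin n) := ⟨⟨0, hn⟩⟩
  simp [ae_iff]

/-- The criterion `lintegral_toSphere_eq_of_exp` turns the claim into an integral over `ℝ × ℝ^n`.
There `q = t + ‖z‖` replaces `t` and `x` is rescaled by `q`. The remaining Gamma integral in `q`
produces `n!` and the conformal weight. -/
theorem lintegral_sphereMeasure_eq_stereoPoint {n : ℕ} (hn : 1 ≤ n)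
    {f : EuclideanSpace ℝ (Fin (n + 1)) → ENNReal} (hf : Measurable f) :
    ∫⁻ p, f p ∂sphereMeasure (n + 1) = ∫⁻ x : EuclideanSpace ℝ (Fin n),
      ENNReal.ofReal ((2 / (1 + ‖x‖ ^ 2)) ^ n) * f (stereoPoint x) := by
  refine lintegral_toSphere_eq_of_exp volume hf ?_
  set F : EuclideanSpace ℝ (Fin (n + 1)) → ENNReal :=
    fun z => f (‖z‖⁻¹ • z) * ENNReal.ofReal (exp (-‖z‖)) with hF
  have hFm : Measurable F := by fun_prop
  have hst := measurable_stereoPoint (n := n)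
  have hcm : Measurable fun p : EuclideanSpace ℝ (Fin n) × ℝ =>
      ENNReal.ofReal (1 / 2 + ‖p.1‖ ^ 2 / 2 / p.2 ^ 2) *
        F (euclideanCons (1 / 2 * p.2 - ‖p.1‖ ^ 2 / 2 / p.2) p.1) := by
    refine Measurable.mul (by fun_prop) (hFm.comp ?_)
    exact measurable_euclideanCons.comp (f := fun p : EuclideanSpace ℝ (Fin n) × ℝ =>
      (1 / 2 * p.2 - ‖p.1‖ ^ 2 / 2 / p.2, p.1)) (by fun_prop)
  rw [lintegral_euclideanCons hFm]
  calc ∫⁻ x : EuclideanSpace ℝ (Fin n), ∫⁻ t, F (euclideanCons t x)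
      = ∫⁻ x : EuclideanSpace ℝ (Fin n), ∫⁻ q in Set.Ioi (0 : ℝ),
          ENNReal.ofReal (1 / 2 + ‖x‖ ^ 2 / 2 / q ^ 2) *
            F (euclideanCons (1 / 2 * q - ‖x‖ ^ 2 / 2 / q) x) := by
        refine lintegral_congr_ae ?_
        -- The substitution has `B = ‖x‖² / 2`, which must be positive.
        filter_upwards [ae_ne_zero_euclidean hn] with x hx
        have := norm_pos_iff.2 hx
        exact lintegral_eq_lintegral_mul_sub_div (by norm_num) (by positivity)
          (fun t => F (euclideanCons t x))
    _ = ∫⁻ q in Set.Ioi (0 : ℝ), ∫⁻ x : EuclideanSpace ℝ (Fin n),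
          ENNReal.ofReal (1 / 2 + ‖x‖ ^ 2 / 2 / q ^ 2) *
            F (euclideanCons (1 / 2 * q - ‖x‖ ^ 2 / 2 / q) x) :=
        lintegral_lintegral_swap hcm.aemeasurable
    _ = ∫⁻ q in Set.Ioi (0 : ℝ), ∫⁻ x : EuclideanSpace ℝ (Fin n),
          ENNReal.ofReal (q ^ n * exp (-((1 + ‖x‖ ^ 2) / 2 * q))) *
            (ENNReal.ofReal ((1 + ‖x‖ ^ 2) / 2) * f (stereoPoint x)) := by
        refine setLIntegral_congr_fun measurableSet_Ioi fun q (hq : 0 < q) => ?_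
        refine (lintegral_comp_smul_of_pos volume (hcm.comp (by fun_prop :
          Measurable fun x : EuclideanSpace ℝ (Fin n) => (x, q))) hq).trans ?_
        rw [← lintegral_const_mul' _ _ ENNReal.ofReal_ne_top]
        refine lintegral_congr fun x => ?_
        have hk : 0 < q * ((1 + ‖x‖ ^ 2) / 2) := by positivity
        have hx : ‖q • x‖ = q * ‖x‖ := by rw [norm_smul, Real.norm_of_nonneg hq.le]
        have h1 : 1 / 2 * q - ‖q • x‖ ^ 2 / 2 / q = q * ((1 - ‖x‖ ^ 2) / 2) := by
          rw [hx]; field_simp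
        have h2 : 1 / 2 + ‖q • x‖ ^ 2 / 2 / q ^ 2 = (1 + ‖x‖ ^ 2) / 2 := by
          rw [hx]; field_simp
        simp only [Function.comp, h1, h2, euclideanCons_eq_smul_stereoPoint, hF]
        rw [norm_smul, norm_stereoPoint, Real.norm_of_nonneg hk.le, mul_one, smul_smul,
          inv_mul_cancel₀ hk.ne', one_smul, finrank_euclideanSpace, Fintype.card_fin,
          ENNReal.ofReal_mul (by positivity)]
        ring_nf
    _ = ∫⁻ x : EuclideanSpace ℝ (Fin n), ∫⁻ q in Set.Ioi (0 : ℝ),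
          ENNReal.ofReal (q ^ n * exp (-((1 + ‖x‖ ^ 2) / 2 * q))) *
            (ENNReal.ofReal ((1 + ‖x‖ ^ 2) / 2) * f (stereoPoint x)) :=
        lintegral_lintegral_swap (by fun_prop)
    _ = _ := by
        rw [← lintegral_mul_const _ (by fun_prop)]
        refine lintegral_congr fun x => ?_
        rw [lintegral_mul_const _ (by fun_prop), lintegral_pow_mul_exp_neg_mul _ (by positivity),
          ← mul_assoc, ← ENNReal.ofReal_mul (by positivity), mul_right_comm (ENNReal.ofReal _),
          ← ENNReal.ofReal_mul (by positivity), finrank_euclideanSpace, Fintype.card_fin,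
          Nat.add_sub_cancel]
        congr 2
        have hx : 1 + ‖x‖ ^ 2 ≠ 0 := by positivity
        rw [one_div_div, pow_succ]
        field_simp

/-- Stereographic projection is injective, so at most one point of `ℝ^n` lies over `p`, and points
are null for `n ≥ 1`. -/
theorem sphereMeasure_singleton {n : ℕ} (hn : 1 ≤ n) (p : USphere (n + 1)) :
    sphereMeasure (n + 1) {p} = 0 := by
  have : Nonempty (Fin n) := ⟨⟨0, hn⟩⟩
  have h := lintegral_sphereMeasure_eq_stereoPoint hn
    (f := Set.indicator {(p : EuclideanSpace ℝ (Fin (n + 1)))} 1)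
    (measurable_one.indicator (measurableSet_singleton _))
  have h1 : (fun q : USphere (n + 1) =>
      Set.indicator {(p : EuclideanSpace ℝ (Fin (n + 1)))} (1 : EuclideanSpace ℝ (Fin (n + 1)) → ENNReal) q) =
      Set.indicator {p} 1 := by
    ext q
    simp [Set.indicator_apply, Subtype.ext_iff]
  rw [h1, lintegral_indicator_one (measurableSet_singleton _)] at h
  rw [h, lintegral_eq_zero_iff' (by
    have := measurable_stereoPoint (n := n)
    exact (Measurable.mul (by fun_prop) ((measurable_one.indicator
      (measurableSet_singleton _)).comp this)).aemeasurable)]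
  by_cases hp : ∃ y : EuclideanSpace ℝ (Fin n), stereoPoint y = p
  · obtain ⟨y, hy⟩ := hp
    have hae : ∀ᵐ x : EuclideanSpace ℝ (Fin n), x ≠ y := by simp [ae_iff]
    filter_upwards [hae] with x hx
    have hne : stereoPoint x ≠ p := by
      intro h
      have h2 := norm_stereoPoint_sub_sq x y
      rw [h, hy, sub_self, norm_zero] at h2
      have hx' : 0 < ‖x - y‖ := norm_pos_iff.2 (sub_ne_zero.2 hx)
      have : 0 < 4 * ‖x - y‖ ^ 2 / ((1 + ‖x‖ ^ 2) * (1 + ‖y‖ ^ 2)) := by positivity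
      simp [← h2] at this
    simp [hne]
  · refine Filter.Eventually.of_forall fun x => ?_
    have hne : stereoPoint x ≠ p := fun h => hp ⟨x, h⟩
    simp [hne]

/-! ### The hyperboloid measure in flat coordinates. -/

theorem measurable_hyperboloidPoint (d : ℕ) : Measurable (hyperboloidPoint d) := by
  unfold hyperboloidPoint
  fun_prop

theorem lintegral_hyperboloidMeasure_eq_prod (d : ℕ) {f : Minkowski d → ENNReal}
    (hf : Measurable f) :
    ∫⁻ y, f y ∂hyperboloidMeasure d = ∫⁻ n, (∫⁻ u in Set.Ioi (1 : ℝ),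
      ENNReal.ofReal ((u ^ 2 - 1) ^ (((d : ℝ) - 2) / 2)) * f (hyperboloidPoint d (u, n)))
        ∂sphereMeasure d := by
  have hm := measurable_hyperboloidPoint d
  have hmf : Measurable fun p => f (hyperboloidPoint d p) := hf.comp hm
  have : SFinite (sphereMeasure d) := by unfold sphereMeasure; infer_instance
  rw [hyperboloidMeasure, lintegral_map hf hm, lintegral_prod_symm' _ hmf]
  refine lintegral_congr fun n => ?_
  rw [lintegral_withDensity_eq_lintegral_mul _ (by fun_prop) (by fun_prop)]
  rfl

theorem lintegral_Ioi_one_eq (f : ℝ → ENNReal) :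
    ∫⁻ u in Set.Ioi (1 : ℝ), f u = ∫⁻ r in Set.Ioi (0 : ℝ),
      ENNReal.ofReal (r / √(1 + r ^ 2)) * f √(1 + r ^ 2) := by
  have himg : (fun r : ℝ => √(1 + r ^ 2)) '' Set.Ioi 0 = Set.Ioi 1 := by
    ext u
    constructor
    · rintro ⟨r, hr : 0 < r, rfl⟩
      exact Real.lt_sqrt_of_sq_lt (by nlinarith)
    · intro (hu : 1 < u)
      refine ⟨√(u ^ 2 - 1), Real.sqrt_pos.2 (by nlinarith), ?_⟩
      simp only
      rw [Real.sq_sqrt (by nlinarith), add_sub_cancel, Real.sqrt_sq (by linarith)]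
  rw [← himg, lintegral_image_eq_lintegral_deriv_mul_of_monotoneOn measurableSet_Ioi
    (f' := fun r => r / √(1 + r ^ 2))]
  · intro r _
    have h := ((hasDerivAt_pow 2 r).const_add 1).sqrt (by positivity)
    refine (h.congr_deriv ?_).hasDerivWithinAt
    simp
    field_simp
  · intro p (hp : 0 < p) q (hq : 0 < q) hpq
    exact Real.sqrt_le_sqrt (by gcongr)

/-- With `u = √(1 + r²)` the radial density `(u² - 1)^{(d-2)/2} du` becomes `r^{d-1} dr / √(1 +
r²)`, that is, polar coordinates with one extra factor. -/
theorem lintegral_hyperboloidMeasure {d : ℕ} (hd : 1 ≤ d) {f : Minkowski d → ENNReal}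
    (hf : Measurable f) :
    ∫⁻ y, f y ∂hyperboloidMeasure d = ∫⁻ x : EuclideanSpace ℝ (Fin d),
      ENNReal.ofReal (1 / √(1 + ‖x‖ ^ 2)) * f (√(1 + ‖x‖ ^ 2), x) := by
  have : Nonempty (Fin d) := ⟨⟨0, hd⟩⟩
  rw [lintegral_hyperboloidMeasure_eq_prod d hf, lintegral_polar volume (by fun_prop),
    sphereMeasure]
  refine lintegral_congr fun n => ?_
  rw [lintegral_Ioi_one_eq]
  refine setLIntegral_congr_fun measurableSet_Ioi fun r (hr : 0 < r) => ?_
  have hn : ‖(n : EuclideanSpace ℝ (Fin d))‖ = 1 := by simp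
  have h : ‖r • (n : EuclideanSpace ℝ (Fin d))‖ = r := by
    rw [norm_smul, hn, Real.norm_eq_abs, abs_of_pos hr, mul_one]
  have h1 : √(1 + r ^ 2) ^ 2 - 1 = r ^ 2 := by rw [Real.sq_sqrt (by positivity)]; ring
  simp only [h, hyperboloidPoint, h1, Real.sqrt_sq hr.le, finrank_euclideanSpace, Fintype.card_fin]
  rw [← mul_assoc, ← mul_assoc, ← ENNReal.ofReal_mul (by positivity),
    ← ENNReal.ofReal_mul (by positivity)]
  congr 2
  have h2 : (r ^ 2) ^ (((d : ℝ) - 2) / 2) * r = r ^ (d - 1) := by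
    rw [← Real.rpow_natCast, ← Real.rpow_mul hr.le, ← Real.rpow_add_one hr.ne',
      ← Real.rpow_natCast]
    congr 1
    push_cast [hd]
    ring
  rw [← h2]
  ring

/-! ### Laplace and Gaussian integrals, log-Gamma measures. -/

theorem lintegral_Ioi_zero_eq (f : ℝ → ENNReal) :
    ∫⁻ q in Set.Ioi (0 : ℝ), f q = ∫⁻ y, ENNReal.ofReal (exp y) * f (exp y) := by
  rw [← Real.range_exp, ← Set.image_univ,
    lintegral_image_eq_lintegral_deriv_mul_of_monotoneOn MeasurableSet.univ
      (fun x _ => (Real.hasDerivAt_exp x).hasDerivWithinAt) (Real.exp_monotone.monotoneOn _),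
    setLIntegral_univ]

theorem lintegral_exp_neg_sq :
    ∫⁻ z : ℝ, ENNReal.ofReal (exp (-z ^ 2)) = ENNReal.ofReal √π := by
  have h := integral_gaussian 1
  simp only [neg_one_mul, div_one] at h
  rw [← h, ofReal_integral_eq_lintegral_ofReal _ (Filter.Eventually.of_forall fun z => by positivity)]
  simpa using integrable_exp_neg_mul_sq (b := 1) one_pos

/-- The Laplace-type integral `∫ s^{1/2} exp(-A² s - B² / (4 s)) ds / s = √π / A exp(-A B)`, in
the variable `log s`. -/
theorem lintegral_exp_half_sub_exp {A B : ℝ} (hA : 0 < A) (hB : 0 < B) :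
    ∫⁻ s : ℝ, ENNReal.ofReal (exp (s / 2 - A ^ 2 * exp s - B ^ 2 / 4 * exp (-s))) =
      ENNReal.ofReal (√π / A * exp (-(A * B))) := by
  set G : ℝ → ℝ := fun y => exp (-(A * exp y - B / 2 * exp (-y)) ^ 2)
  -- The Gaussian integral in `z = A e^y - (B/2) e^{-y}`, whose derivative has two terms.
  have h1 : ENNReal.ofReal √π = ∫⁻ y, ENNReal.ofReal (A * exp y * G y) +
      ENNReal.ofReal (B / 2 * exp (-y) * G y) := by
    rw [← lintegral_exp_neg_sq, lintegral_eq_lintegral_mul_sub_div hA (half_pos hB),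
      lintegral_Ioi_zero_eq]
    refine lintegral_congr fun y => ?_
    rw [← ENNReal.ofReal_mul (by positivity), ← ENNReal.ofReal_mul (by positivity),
      ← ENNReal.ofReal_add (by positivity) (by positivity)]
    congr 1
    have : B / 2 / exp y = B / 2 * exp (-y) := by rw [Real.exp_neg]; rfl
    simp only [G, this, Real.exp_neg y]
    field_simp
  -- The reflection `y ↦ log (B / (2A)) - y` preserves `G` and exchanges the two terms, so each
  -- contributes `√π / 2`.
  have h2 : ∫⁻ y, ENNReal.ofReal (B / 2 * exp (-y) * G y) =
      ∫⁻ y, ENNReal.ofReal (A * exp y * G y) := by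
    rw [← lintegral_sub_left_eq_self _ (log (B / (2 * A)))]
    refine lintegral_congr fun y => ?_
    congr 1
    have e1 : exp (log (B / (2 * A)) - y) = B / (2 * A) * exp (-y) := by
      rw [sub_eq_add_neg, Real.exp_add, Real.exp_log (by positivity)]
    have e2 : exp (-(log (B / (2 * A)) - y)) = 2 * A / B * exp y := by
      rw [neg_sub, sub_eq_add_neg, add_comm, Real.exp_add, Real.exp_neg,
        Real.exp_log (by positivity), inv_div]
    simp only [G, e1, e2]
    rw [show A * (B / (2 * A) * exp (-y)) = B / 2 * exp (-y) by field_simp,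
      show B / 2 * (2 * A / B * exp y) = A * exp y by field_simp]
    congr 2
    ring
  rw [lintegral_add_left (by fun_prop), h2, ← two_mul] at h1
  have h3 : ∫⁻ y, ENNReal.ofReal (A * exp y * G y) = ENNReal.ofReal (√π / 2) := by
    rw [ENNReal.ofReal_div_of_pos two_pos, ENNReal.ofReal_ofNat,
      ENNReal.eq_div_iff (by simp) (by simp), h1]
  -- With `s = 2y` the exponent is that of `G` shifted by the cross term `A B` of the square.
  rw [lintegral_comp_smul_of_pos volume (by fun_prop) (two_pos : (0 : ℝ) < 2)]
  have h4 : ∀ y : ℝ, ENNReal.ofReal (exp ((2 : ℝ) • y / 2 - A ^ 2 * exp ((2 : ℝ) • y) -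
      B ^ 2 / 4 * exp (-((2 : ℝ) • y)))) =
      ENNReal.ofReal (1 / A * exp (-(A * B))) * ENNReal.ofReal (A * exp y * G y) := by
    intro y
    rw [← ENNReal.ofReal_mul (by positivity)]
    congr 1
    have e1 : exp (2 * y) = exp y ^ 2 := by rw [two_mul, Real.exp_add, sq]
    have e2 : exp (-(2 * y)) = exp (-y) ^ 2 := by rw [two_mul, neg_add, Real.exp_add, sq]
    have e3 : exp y * exp (-y) = 1 := by rw [← Real.exp_add]; simp
    rw [show 1 / A * exp (-(A * B)) * (A * exp y * G y) = exp y * (exp (-(A * B)) * G y) by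
      field_simp]
    simp only [G, smul_eq_mul]
    rw [← Real.exp_add, ← Real.exp_add, e1, e2]
    congr 1
    linear_combination (-A * B) * e3
  simp only [h4]
  rw [lintegral_const_mul _ (by fun_prop), h3, ← ENNReal.ofReal_mul (by positivity),
    ← ENNReal.ofReal_mul (by positivity)]
  congr 1
  simp
  ring

theorem lintegral_exp_neg_mul_norm_sq_add_inner {n : ℕ} {s : ℝ} (hs : 0 < s)
    (T : EuclideanSpace ℝ (Fin n)) :
    ∫⁻ x : EuclideanSpace ℝ (Fin n), ENNReal.ofReal (exp (-s * ‖x‖ ^ 2 + inner ℝ T x)) =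
      ENNReal.ofReal ((π / s) ^ ((n : ℝ) / 2) * exp (‖T‖ ^ 2 / (4 * s))) := by
  have h : ∫ x : EuclideanSpace ℝ (Fin n), exp (-s * ‖x‖ ^ 2 + inner ℝ T x) =
      (π / s) ^ ((n : ℝ) / 2) * exp (‖T‖ ^ 2 / (4 * s)) := by
    have h := GaussianFourier.integral_cexp_neg_mul_sq_norm_add (b := (s : ℂ)) (by simpa) 1 T
    rw [← Complex.ofReal_inj, ← integral_complex_ofReal]
    push_cast
    simp only [one_mul, finrank_euclideanSpace, Fintype.card_fin, one_pow] at h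
    rw [h, Complex.ofReal_cpow (by positivity)]
    push_cast
    rfl
  have hpos : 0 < (π / s) ^ ((n : ℝ) / 2) * exp (‖T‖ ^ 2 / (4 * s)) := by positivity
  rw [← h, ofReal_integral_eq_lintegral_ofReal _ (Filter.Eventually.of_forall fun z => by positivity)]
  exact Integrable.of_integral_ne_zero (by rw [h]; exact hpos.ne')

/-- The law of the logarithm of a Gamma variable, up to normalization. -/
noncomputable def logGammaMeasure (k : ℝ) : Measure ℝ :=
  volume.withDensity fun x => ENNReal.ofReal (exp (k * x - exp x))

instance (k : ℝ) : SigmaFinite (logGammaMeasure k) := by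
  unfold logGammaMeasure
  infer_instance

theorem lintegral_logGammaMeasure (k : ℝ) {f : ℝ → ENNReal} (hf : Measurable f) :
    ∫⁻ x, f x ∂logGammaMeasure k = ∫⁻ x, ENNReal.ofReal (exp (k * x - exp x)) * f x := by
  rw [logGammaMeasure, lintegral_withDensity_eq_lintegral_mul _ (by fun_prop) hf]
  rfl

/-- The Laplace integral `lintegral_exp_half_sub_exp` with `A = √(1 + ‖x‖²)` and `B = T.1` replaces
the square root in the exponent by its square and absorbs the density `1 / √(1 + ‖x‖²)`. The
integral over `x` is then Gaussian, and `T` survives only through `T·T`. The parameter is `1/2` from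
the Laplace integral minus `d/2` from the Gaussian. -/
theorem lintegral_exp_neg_lorentz {d : ℕ} (hd : 1 ≤ d) (T : Minkowski d) (hT : 0 < T.1) :
    ∫⁻ y, ENNReal.ofReal (exp (-lorentz y T)) ∂hyperboloidMeasure d =
      ENNReal.ofReal (π ^ (((d : ℝ) - 1) / 2)) *
        ∫⁻ s, ENNReal.ofReal (exp (-(lorentz T T / 4 * exp (-s))))
          ∂logGammaMeasure (-(((d : ℝ) - 1) / 2)) := by
  have hm : Measurable fun p : EuclideanSpace ℝ (Fin d) × ℝ => ENNReal.ofReal (exp (p.2 / 2 -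
      √(1 + ‖p.1‖ ^ 2) ^ 2 * exp p.2 - T.1 ^ 2 / 4 * exp (-p.2))) *
        ENNReal.ofReal (exp (inner ℝ T.2 p.1)) := by fun_prop
  rw [lintegral_hyperboloidMeasure hd (by unfold lorentz; fun_prop)]
  calc _ = ∫⁻ x : EuclideanSpace ℝ (Fin d), ENNReal.ofReal (1 / √π) * ∫⁻ s : ℝ,
          ENNReal.ofReal (exp (s / 2 - √(1 + ‖x‖ ^ 2) ^ 2 * exp s - T.1 ^ 2 / 4 * exp (-s))) *
            ENNReal.ofReal (exp (inner ℝ T.2 x)) := by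
        refine lintegral_congr fun x => ?_
        have hx : 0 < √(1 + ‖x‖ ^ 2) := by positivity
        rw [lintegral_mul_const _ (by fun_prop), lintegral_exp_half_sub_exp hx hT,
          ← ENNReal.ofReal_mul (by positivity), ← ENNReal.ofReal_mul (by positivity),
          ← ENNReal.ofReal_mul (by positivity)]
        congr 1
        have hpi : 0 < √π := by positivity
        rw [lorentz, show -(√(1 + ‖x‖ ^ 2) * T.1 - inner ℝ x T.2) =
          -(√(1 + ‖x‖ ^ 2) * T.1) + inner ℝ T.2 x by rw [real_inner_comm]; ring, Real.exp_add]
        field_simp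
    _ = ENNReal.ofReal (1 / √π) * ∫⁻ s : ℝ, ∫⁻ x : EuclideanSpace ℝ (Fin d),
          ENNReal.ofReal (exp (s / 2 - √(1 + ‖x‖ ^ 2) ^ 2 * exp s - T.1 ^ 2 / 4 * exp (-s))) *
            ENNReal.ofReal (exp (inner ℝ T.2 x)) := by
        rw [lintegral_const_mul' _ _ ENNReal.ofReal_ne_top,
          lintegral_lintegral_swap hm.aemeasurable]
    _ = _ := by
        rw [lintegral_logGammaMeasure _ (by fun_prop), ← lintegral_const_mul _ (by fun_prop),
          ← lintegral_const_mul _ (by fun_prop)]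
        refine lintegral_congr fun s => ?_
        have h1 : ∀ x : EuclideanSpace ℝ (Fin d), ENNReal.ofReal (exp (s / 2 -
            √(1 + ‖x‖ ^ 2) ^ 2 * exp s - T.1 ^ 2 / 4 * exp (-s))) *
              ENNReal.ofReal (exp (inner ℝ T.2 x)) =
            ENNReal.ofReal (exp (s / 2 - exp s - T.1 ^ 2 / 4 * exp (-s))) *
              ENNReal.ofReal (exp (-exp s * ‖x‖ ^ 2 + inner ℝ T.2 x)) := by
          intro x
          rw [← ENNReal.ofReal_mul (by positivity), ← ENNReal.ofReal_mul (by positivity),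
            ← Real.exp_add, ← Real.exp_add, Real.sq_sqrt (by positivity)]
          congr 2
          ring
        simp only [h1]
        rw [lintegral_const_mul _ (by fun_prop),
          lintegral_exp_neg_mul_norm_sq_add_inner (exp_pos s),
          ← ENNReal.ofReal_mul (by positivity), ← ENNReal.ofReal_mul (by positivity),
          ← ENNReal.ofReal_mul (by positivity), ← ENNReal.ofReal_mul (by positivity)]
        congr 1
        have h2 : (π / exp s) ^ ((d : ℝ) / 2) = π ^ ((d : ℝ) / 2) * exp (-(d / 2 * s)) := by
          rw [Real.div_rpow pi_pos.le (exp_pos s).le, ← Real.exp_mul, Real.exp_neg, mul_comm s]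
          rfl
        have h3 : π ^ ((d : ℝ) / 2) = π ^ (((d : ℝ) - 1) / 2) * √π := by
          rw [Real.sqrt_eq_rpow, ← Real.rpow_add pi_pos]
          ring_nf
        have h4 : ‖T.2‖ ^ 2 / (4 * exp s) = ‖T.2‖ ^ 2 / 4 * exp (-s) := by
          rw [Real.exp_neg]; field_simp
        rw [h2, h3, h4]
        have hpi : 0 < √π := by positivity
        have h5 : exp (s / 2 - exp s - T.1 ^ 2 / 4 * exp (-s)) * (exp (-(d / 2 * s)) *
            exp (‖T.2‖ ^ 2 / 4 * exp (-s))) = exp (-(((d : ℝ) - 1) / 2) * s - exp s) *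
              exp (-(lorentz T T / 4 * exp (-s))) := by
          rw [← Real.exp_add, ← Real.exp_add, ← Real.exp_add, lorentz, real_inner_self_eq_norm_sq]
          congr 1
          ring
        rw [← h5]
        field_simp

/-- Euler's integral in the logarithmic variable. Only `b + k` matters, so `k ≤ 0`, where the
measure has infinite mass, is allowed. -/
theorem integrable_cexp_logGammaMeasure {k : ℝ} {b : ℂ} (hb : 0 < (b + k).re) :
    Integrable (fun x : ℝ => Complex.exp (b * x)) (logGammaMeasure k) ∧
      ∫ x : ℝ, Complex.exp (b * x) ∂logGammaMeasure k = Complex.Gamma (b + k) := by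
  have hden : ∀ x : ℝ, exp x • (((exp (-exp x) : ℝ) : ℂ) * ((exp x : ℝ) : ℂ) ^ (b + k - 1)) =
      (ENNReal.ofReal (exp (k * x - exp x))).toReal • Complex.exp (b * x) := by
    intro x
    have hx : ((exp x : ℝ) : ℂ) ≠ 0 := by exact_mod_cast (exp_pos x).ne'
    rw [ENNReal.toReal_ofReal (exp_pos _).le, Complex.cpow_def_of_ne_zero hx, ← Complex.ofReal_log
      (exp_pos x).le, Real.log_exp, Complex.real_smul, Complex.real_smul, Complex.ofReal_exp,
      Complex.ofReal_exp, Complex.ofReal_exp, ← Complex.exp_add, ← Complex.exp_add,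
      ← Complex.exp_add]
    congr 1
    push_cast
    ring
  have himg : Real.exp '' Set.univ = Set.Ioi 0 := by rw [Set.image_univ, Real.range_exp]
  have hderiv : ∀ x ∈ Set.univ, HasDerivWithinAt Real.exp (Real.exp x) Set.univ x :=
    fun x _ => (Real.hasDerivAt_exp x).hasDerivWithinAt
  have hmono : MonotoneOn Real.exp Set.univ := Real.exp_monotone.monotoneOn _
  have hI := integrableOn_image_iff_integrableOn_deriv_smul_of_monotoneOn MeasurableSet.univ
    hderiv hmono (fun x : ℝ => ((exp (-x) : ℝ) : ℂ) * (x : ℂ) ^ (b + k - 1))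
  have hE := integral_image_eq_integral_deriv_smul_of_monotoneOn MeasurableSet.univ
    hderiv hmono (fun x : ℝ => ((exp (-x) : ℝ) : ℂ) * (x : ℂ) ^ (b + k - 1))
  rw [himg] at hI hE
  simp only [hden, integrableOn_univ, setIntegral_univ] at hI hE
  constructor
  · rw [logGammaMeasure, integrable_withDensity_iff_integrable_smul' (by fun_prop) (by simp)]
    exact hI.1 (Complex.GammaIntegral_convergent hb)
  · rw [logGammaMeasure, integral_withDensity_eq_integral_toReal_smul (by fun_prop) (by simp),
      Complex.Gamma_eq_integral hb, Complex.GammaIntegral, hE]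

theorem lintegral_logGammaMeasure_prod (k₁ k₂ k₃ : ℝ) {f : ℝ × ℝ × ℝ → ENNReal}
    (hf : Measurable f) :
    ∫⁻ x, f x ∂(logGammaMeasure k₁).prod ((logGammaMeasure k₂).prod (logGammaMeasure k₃)) =
      ∫⁻ x : ℝ × ℝ × ℝ, ENNReal.ofReal (exp ((k₁ * x.1 - exp x.1) + ((k₂ * x.2.1 - exp x.2.1) +
        (k₃ * x.2.2 - exp x.2.2)))) * f x := by
  rw [logGammaMeasure, logGammaMeasure, logGammaMeasure, prod_withDensity (by fun_prop)
    (by fun_prop), prod_withDensity (by fun_prop) (by fun_prop),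
    lintegral_withDensity_eq_lintegral_mul _ (by fun_prop) hf]
  refine lintegral_congr fun x => ?_
  rw [Real.exp_add, Real.exp_add, ENNReal.ofReal_mul (by positivity),
    ENNReal.ofReal_mul (by positivity)]
  rfl

/-- The coordinates `x₁ + x₂`, `x₁ + x₃`, `x₂ + x₃` have Jacobian 2. They are reached by
translations, a reflection and one dilation by a half. -/
theorem lintegral_pairwise_sums {f : ℝ × ℝ × ℝ → ENNReal} (hf : Measurable f) :
    ∫⁻ x, f x = ENNReal.ofReal (1 / 2) * ∫⁻ w : ℝ × ℝ × ℝ, f ((w.1 + w.2.1 - w.2.2) / 2,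
      (w.1 + w.2.2 - w.2.1) / 2, (w.2.1 + w.2.2 - w.1) / 2) := by
  have h1 : ∫⁻ x, f x = ∫⁻ x₁, ∫⁻ x : ℝ × ℝ, f (x₁, x.1 - x₁, x.2 - x₁) := by
    rw [Measure.volume_eq_prod, lintegral_prod _ hf.aemeasurable]
    refine lintegral_congr fun x₁ => ?_
    rw [← lintegral_sub_right_eq_self _ ((x₁, x₁) : ℝ × ℝ)]
    rfl
  have hm : Measurable fun w : ℝ × ℝ × ℝ => f ((w.1 + w.2.1 - w.2.2) / 2,
      (w.1 + w.2.2 - w.2.1) / 2, (w.2.1 + w.2.2 - w.1) / 2) := hf.comp (by fun_prop)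
  rw [h1, lintegral_lintegral_swap (by exact (hf.comp (by fun_prop)).aemeasurable),
    Measure.volume_eq_prod, lintegral_prod _ (by
      exact (Measurable.lintegral_prod_right' (f := fun p : (ℝ × ℝ) × ℝ =>
        f (p.2, p.1.1 - p.2, p.1.2 - p.2)) (hf.comp (by fun_prop))).aemeasurable),
    Measure.volume_eq_prod, lintegral_prod _ hm.aemeasurable,
    ← lintegral_const_mul _ (Measurable.lintegral_prod_right' hm)]
  refine lintegral_congr fun p => ?_
  rw [Measure.volume_eq_prod, lintegral_prod _ (by exact (hm.comp (by fun_prop)).aemeasurable),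
    ← lintegral_const_mul _ (Measurable.lintegral_prod_right' (f := fun w : ℝ × ℝ =>
      f ((p + w.1 - w.2) / 2, (p + w.2 - w.1) / 2, (w.1 + w.2 - p) / 2)) (hf.comp (by fun_prop)))]
  refine lintegral_congr fun q => ?_
  simp only
  rw [lintegral_comp_smul_of_pos volume (by exact hf.comp (by fun_prop)) (half_pos one_pos),
    ← lintegral_sub_left_eq_self _ (p + q)]
  simp only [Module.finrank_self, pow_one, smul_eq_mul]
  congr 1
  refine lintegral_congr fun r => ?_
  congr 2
  · ring
  · congr 1 <;> ring

/-- Dividing a Gamma variable by `X` puts `X` into the exponential: this trades powers of `X` for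
`exp (-X e^x)`. -/
theorem lintegral_logGammaMeasure_sub_log (k : ℝ) {X : ℝ} (hX : 0 < X) {g : ℝ → ENNReal}
    (hg : Measurable g) :
    ∫⁻ τ, g (τ - log X) ∂logGammaMeasure k =
      ENNReal.ofReal (X ^ k) * ∫⁻ x, ENNReal.ofReal (exp (k * x - X * exp x)) * g x := by
  rw [lintegral_logGammaMeasure k (by fun_prop), ← lintegral_add_right_eq_self _ (log X),
    ← lintegral_const_mul _ (by fun_prop)]
  refine lintegral_congr fun x => ?_
  rw [← mul_assoc, ← ENNReal.ofReal_mul (by positivity), Real.rpow_def_of_pos hX, ← Real.exp_add,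
    Real.exp_add x, Real.exp_log hX, add_sub_cancel_right]
  ring_nf

/-! ### From nonnegative test functions to complex integrands. -/

/-- The hypothesis says that the two image measures are proportional, so integrability and complex
integrals transfer. -/
theorem integrable_comp_of_lintegral_eq {X Y Z : Type*} [MeasurableSpace X] [MeasurableSpace Y]
    [MeasurableSpace Z] {μ : Measure X} {ν : Measure Y} {φ : X → Z} {ψ : Y → Z} {C : ENNReal}
    (hφ : Measurable φ) (hψ : Measurable ψ) (hC : C ≠ ⊤)
    (h : ∀ f : Z → ENNReal, Measurable f → ∫⁻ x, f (φ x) ∂μ = C * ∫⁻ y, f (ψ y) ∂ν)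
    {g : Z → ℂ} (hg : Measurable g) (hi : Integrable (fun y => g (ψ y)) ν) :
    Integrable (fun x => g (φ x)) μ ∧ ∫ x, g (φ x) ∂μ = C.toReal * ∫ y, g (ψ y) ∂ν := by
  have hmap : μ.map φ = C • ν.map ψ := by
    refine Measure.ext_of_lintegral _ fun f hf => ?_
    rw [lintegral_map hf hφ, lintegral_smul_measure, lintegral_map hf hψ, h f hf, smul_eq_mul]
  have hi' : Integrable g (ν.map ψ) :=
    (integrable_map_measure hg.aestronglyMeasurable hψ.aemeasurable).2 hi
  constructor
  · refine (integrable_map_measure hg.aestronglyMeasurable hφ.aemeasurable).1 ?_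
    rw [hmap]
    exact hi'.smul_measure hC
  · rw [← integral_map hφ.aemeasurable hg.aestronglyMeasurable, hmap, integral_smul_measure,
      integral_map hψ.aemeasurable hg.aestronglyMeasurable, Complex.real_smul]

/-- Almost every slice in `y` is integrable, and on one slice `g y` is a nonzero constant. This
strips the auxiliary independent variables. -/
theorem integrable_left_of_mul_prod {X Y : Type*} [MeasurableSpace X] [MeasurableSpace Y]
    {μ : Measure X} {ν : Measure Y} [SFinite μ] [SFinite ν] (hν : ν ≠ 0) {f : X → ℂ} {g : Y → ℂ}
    (hg : ∀ y, g y ≠ 0) (h : Integrable (fun p : X × Y => f p.1 * g p.2) (μ.prod ν)) :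
    Integrable f μ := by
  have : (ae ν).NeBot := ae_neBot.2 hν
  obtain ⟨y, hy⟩ := h.prod_left_ae.exists
  have := hy.mul_const (g y)⁻¹
  simpa [mul_assoc, hg y] using this

theorem logGammaMeasure_ne_zero (k : ℝ) : logGammaMeasure k ≠ 0 := by
  intro h
  rw [logGammaMeasure, withDensity_eq_zero_iff (by fun_prop)] at h
  have : ∀ᵐ x : ℝ, False := by
    filter_upwards [h] with x hx
    simp at hx
    exact absurd hx (not_le.2 (exp_pos _))
  exact this.exists.elim fun _ h => h

instance (d : ℕ) : IsFiniteMeasure (sphereMeasure d) := by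
  unfold sphereMeasure
  infer_instance

instance (d : ℕ) : SFinite (hyperboloidMeasure d) := by
  unfold hyperboloidMeasure
  infer_instance

/-! ### Lorentz geometry and the star-triangle relation. -/

theorem lorentz_add_right {d : ℕ} (x y z : Minkowski d) :
    lorentz x (y + z) = lorentz x y + lorentz x z := by
  simp only [lorentz, Prod.fst_add, Prod.snd_add, inner_add_right]
  ring

theorem lorentz_smul_right {d : ℕ} (c : ℝ) (x y : Minkowski d) :
    lorentz x (c • y) = c * lorentz x y := by
  simp only [lorentz, Prod.smul_fst, Prod.smul_snd, real_inner_smul_right, smul_eq_mul]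
  ring

theorem lorentz_comm {d : ℕ} (x y : Minkowski d) : lorentz x y = lorentz y x := by
  rw [lorentz, lorentz, real_inner_comm, mul_comm]

@[fun_prop]
theorem measurable_lorentz {d : ℕ} {α : Type*} [MeasurableSpace α] {f g : α → Minkowski d}
    (hf : Measurable f) (hg : Measurable g) : Measurable fun a => lorentz (f a) (g a) := by
  unfold lorentz
  fun_prop

theorem norm_snd_of_mem_forwardCone {d : ℕ} {ξ : Minkowski d} (h : ξ ∈ forwardCone d) :
    ‖ξ.2‖ = ξ.1 := by
  have h1 := h.1
  rw [lorentz, real_inner_self_eq_norm_sq, ← sq, sub_eq_zero] at h1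
  exact ((pow_left_inj₀ h.2.le (norm_nonneg _) two_ne_zero).1 h1).symm

theorem lorentz_nonneg_of_mem_forwardCone {d : ℕ} {ξ η : Minkowski d} (h : ξ ∈ forwardCone d)
    (h' : η ∈ forwardCone d) : 0 ≤ lorentz ξ η := by
  have := real_inner_le_norm ξ.2 η.2
  rw [norm_snd_of_mem_forwardCone h, norm_snd_of_mem_forwardCone h'] at this
  exact sub_nonneg.2 this

theorem lorentz_hyperboloid_pos {d : ℕ} {ξ : Minkowski d} (h : ξ ∈ forwardCone d)
    (x : EuclideanSpace ℝ (Fin d)) : 0 < lorentz ((√(1 + ‖x‖ ^ 2), x) : Minkowski d) ξ := by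
  have h1 := real_inner_le_norm x ξ.2
  rw [norm_snd_of_mem_forwardCone h] at h1
  have h2 : ‖x‖ < √(1 + ‖x‖ ^ 2) := Real.lt_sqrt_of_sq_lt (by linarith)
  have h3 := mul_lt_mul_of_pos_right h2 h.2
  simp only [lorentz]
  linarith

theorem ae_lorentz_pos {d : ℕ} (hd : 1 ≤ d) {ξ : Minkowski d} (h : ξ ∈ forwardCone d) :
    ∀ᵐ y ∂hyperboloidMeasure d, 0 < lorentz y ξ := by
  have hm : MeasurableSet {y : Minkowski d | ¬ 0 < lorentz y ξ} :=
    (measurableSet_lt measurable_const (measurable_lorentz measurable_id measurable_const)).compl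
  rw [ae_iff, ← lintegral_indicator_one hm,
    lintegral_hyperboloidMeasure hd (measurable_one.indicator hm)]
  simp [lorentz_hyperboloid_pos h]

theorem lintegral_add_right_prod (f : ℝ × ℝ × ℝ → ENNReal) (c : ℝ × ℝ × ℝ) :
    ∫⁻ x, f (x + c) = ∫⁻ x, f x := by
  have : (volume : Measure (ℝ × ℝ × ℝ)).IsAddLeftInvariant :=
    Measure.prod.instIsAddLeftInvariant
  simp only [add_comm _ c]
  exact lintegral_add_left_eq_self f c

theorem lintegral_logGammaMeasure_zero_sub_log {X₁ X₂ X₃ : ℝ} (h₁ : 0 < X₁) (h₂ : 0 < X₂)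
    (h₃ : 0 < X₃) {f : ℝ × ℝ × ℝ → ENNReal} (hf : Measurable f) :
    ∫⁻ τ, f (τ.1 - log X₁, τ.2.1 - log X₂, τ.2.2 - log X₃)
        ∂(logGammaMeasure 0).prod ((logGammaMeasure 0).prod (logGammaMeasure 0)) =
      ∫⁻ x : ℝ × ℝ × ℝ, ENNReal.ofReal (exp (-(exp x.1 * X₁ + exp x.2.1 * X₂ + exp x.2.2 * X₃))) *
        f x := by
  rw [lintegral_logGammaMeasure_prod _ _ _ (f := fun τ => f (τ.1 - log X₁, τ.2.1 - log X₂,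
    τ.2.2 - log X₃)) (hf.comp (by fun_prop)), ← lintegral_add_right_prod _ ((log X₁, log X₂, log X₃) : ℝ × ℝ × ℝ)]
  refine lintegral_congr fun x => ?_
  simp only [Prod.fst_add, Prod.snd_add, add_sub_cancel_right, Real.exp_add, Real.exp_log h₁,
    Real.exp_log h₂, Real.exp_log h₃]
  rw [neg_add, neg_add, Real.exp_add, Real.exp_add]
  congr 2
  ring_nf

/-- The star-triangle identity for laws of logarithms. -/
theorem lintegral_star_eq {d : ℕ} (hd : 1 ≤ d) {ξ₁ ξ₂ ξ₃ : Minkowski d}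
    (h₁ : ξ₁ ∈ forwardCone d) (h₂ : ξ₂ ∈ forwardCone d) (h₃ : ξ₃ ∈ forwardCone d)
    (h₁₂ : lorentz ξ₁ ξ₂ ≠ 0) (h₂₃ : lorentz ξ₂ ξ₃ ≠ 0) (h₃₁ : lorentz ξ₃ ξ₁ ≠ 0)
    {f : ℝ × ℝ × ℝ → ENNReal} (hf : Measurable f) :
    ∫⁻ p, f (p.2.1 - log (lorentz p.1 ξ₁), p.2.2.1 - log (lorentz p.1 ξ₂),
        p.2.2.2 - log (lorentz p.1 ξ₃)) ∂(hyperboloidMeasure d).prod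
          ((logGammaMeasure 0).prod ((logGammaMeasure 0).prod (logGammaMeasure 0))) =
      ENNReal.ofReal (π ^ (((d : ℝ) - 1) / 2) / 2) *
      ∫⁻ p, f ((p.2.1 + p.2.2.1 - p.2.2.2 + p.1 - log (lorentz ξ₁ ξ₂ / 2) -
            log (lorentz ξ₃ ξ₁ / 2) + log (lorentz ξ₂ ξ₃ / 2)) / 2,
          (p.2.1 + p.2.2.2 - p.2.2.1 + p.1 - log (lorentz ξ₁ ξ₂ / 2) -
            log (lorentz ξ₂ ξ₃ / 2) + log (lorentz ξ₃ ξ₁ / 2)) / 2,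
          (p.2.2.1 + p.2.2.2 - p.2.1 + p.1 - log (lorentz ξ₃ ξ₁ / 2) -
            log (lorentz ξ₂ ξ₃ / 2) + log (lorentz ξ₁ ξ₂ / 2)) / 2)
          ∂(logGammaMeasure (-(((d : ℝ) - 1) / 2))).prod
          ((logGammaMeasure 0).prod ((logGammaMeasure 0).prod (logGammaMeasure 0))) := by
  have p₁₂ := (lorentz_nonneg_of_mem_forwardCone h₁ h₂).lt_of_ne' h₁₂
  have p₂₃ := (lorentz_nonneg_of_mem_forwardCone h₂ h₃).lt_of_ne' h₂₃
  have p₃₁ := (lorentz_nonneg_of_mem_forwardCone h₃ h₁).lt_of_ne' h₃₁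
  set T : ℝ × ℝ × ℝ → Minkowski d := fun x =>
    exp x.1 • ξ₁ + exp x.2.1 • ξ₂ + exp x.2.2 • ξ₃ with hT
  have hTm : Measurable T := by fun_prop
  have hT0 : ∀ x, 0 < (T x).1 := fun x => by
    have := h₁.2
    have := h₂.2
    have := h₃.2
    simp only [hT, Prod.fst_add, Prod.smul_fst, smul_eq_mul]
    positivity
  have hTl : ∀ y x, lorentz y (T x) =
      exp x.1 * lorentz y ξ₁ + exp x.2.1 * lorentz y ξ₂ + exp x.2.2 * lorentz y ξ₃ := by
    intro y x
    simp only [hT, lorentz_add_right, lorentz_smul_right]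
  -- The `ξⱼ` are lightlike, so only the cross terms survive.
  have hTT : ∀ x, lorentz (T x) (T x) = 2 * (exp (x.1 + x.2.1) * lorentz ξ₁ ξ₂ +
      exp (x.1 + x.2.2) * lorentz ξ₃ ξ₁ + exp (x.2.1 + x.2.2) * lorentz ξ₂ ξ₃) := by
    intro x
    rw [hTl, lorentz_comm _ ξ₁, lorentz_comm _ ξ₂, lorentz_comm _ ξ₃, hTl, hTl, hTl, h₁.1, h₂.1,
      h₃.1, lorentz_comm ξ₂ ξ₁, lorentz_comm ξ₁ ξ₃, lorentz_comm ξ₃ ξ₂, Real.exp_add, Real.exp_add,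
      Real.exp_add]
    ring
  set γ := logGammaMeasure (-(((d : ℝ) - 1) / 2))
  -- For fixed `y`, the shifts by `log (y·ξⱼ)` turn the three log-Gamma densities into the single
  -- weight `exp (-y·T)`.
  calc _ = ∫⁻ y, (∫⁻ x, ENNReal.ofReal (exp (-lorentz y (T x))) * f x) ∂hyperboloidMeasure d := by
        rw [lintegral_prod _ (by exact (hf.comp (by fun_prop)).aemeasurable)]
        refine lintegral_congr_ae ?_
        filter_upwards [ae_lorentz_pos hd h₁, ae_lorentz_pos hd h₂, ae_lorentz_pos hd h₃] with
          y hy₁ hy₂ hy₃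
        simp only [hTl]
        exact lintegral_logGammaMeasure_zero_sub_log hy₁ hy₂ hy₃ hf
    _ = ∫⁻ x, (∫⁻ y, ENNReal.ofReal (exp (-lorentz y (T x))) * f x ∂hyperboloidMeasure d) :=
        lintegral_lintegral_swap (by fun_prop)
    _ = ∫⁻ x, ENNReal.ofReal (π ^ (((d : ℝ) - 1) / 2)) * ∫⁻ s, ENNReal.ofReal
          (exp (-(lorentz (T x) (T x) / 4 * exp (-s)))) * f x ∂γ := by
        refine lintegral_congr fun x => ?_
        rw [lintegral_mul_const _ (by fun_prop), lintegral_exp_neg_lorentz hd _ (hT0 x),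
          lintegral_mul_const _ (by fun_prop), mul_assoc]
    _ = ENNReal.ofReal (π ^ (((d : ℝ) - 1) / 2)) * ∫⁻ s, (∫⁻ x, ENNReal.ofReal
          (exp (-(lorentz (T x) (T x) / 4 * exp (-s)))) * f x) ∂γ := by
        rw [lintegral_const_mul' _ _ ENNReal.ofReal_ne_top, lintegral_lintegral_swap]
        exact Measurable.aemeasurable (by fun_prop)
    _ = _ := by
        have hc : ENNReal.ofReal (π ^ (((d : ℝ) - 1) / 2) / 2) =
            ENNReal.ofReal (π ^ (((d : ℝ) - 1) / 2)) * ENNReal.ofReal (1 / 2) := by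
          rw [← ENNReal.ofReal_mul (by positivity), mul_one_div]
        rw [lintegral_prod _ (by exact (hf.comp (by fun_prop)).aemeasurable), hc, mul_assoc, ← lintegral_const_mul' (ENNReal.ofReal (1 / 2))
          _ ENNReal.ofReal_ne_top]
        congr 1
        refine lintegral_congr fun s => ?_
        -- In the pairwise sums `T·T e^{-s}` is a sum of one-variable exponentials. The translation
        -- by `s - log (ξᵢ·ξⱼ / 2)` below removes their coefficients, and the three variables become
        -- independent of each other and of `s`.
        rw [lintegral_pairwise_sums (by fun_prop)]
        refine Eq.trans ?_ (congrArg (ENNReal.ofReal (1 / 2) * ·)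
          (lintegral_logGammaMeasure_prod 0 0 0 (by exact hf.comp (by fun_prop))).symm)
        rw [← lintegral_add_right_prod _ ((s - log (lorentz ξ₁ ξ₂ / 2),
            s - log (lorentz ξ₃ ξ₁ / 2), s - log (lorentz ξ₂ ξ₃ / 2)) : ℝ × ℝ × ℝ)]
        congr 1
        refine lintegral_congr fun w => ?_
        have key : ∀ a z : ℝ, 0 < z → exp (a + (s - log (z / 2))) * z = 2 * exp a * exp s := by
          intro a z hz
          rw [Real.exp_add, Real.exp_sub, Real.exp_log (half_pos hz)]
          field_simp
        congr 2
        · congr 1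
          simp only [hTT, Prod.fst_add, Prod.snd_add]
          have e₁ : ∀ a b c : ℝ, (a + b - c) / 2 + (a + c - b) / 2 = a := fun a b c => by ring
          have e₂ : ∀ a b c : ℝ, (a + b - c) / 2 + (b + c - a) / 2 = b := fun a b c => by ring
          have e₃ : ∀ a b c : ℝ, (a + c - b) / 2 + (b + c - a) / 2 = c := fun a b c => by ring
          rw [e₁, e₂, e₃, key _ _ p₁₂, key _ _ p₂₃, key _ _ p₃₁]
          have : exp s * exp (-s) = 1 := by rw [← Real.exp_add]; simp
          linear_combination (-(exp w.1 + exp w.2.1 + exp w.2.2)) * this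
        · simp only [Prod.fst_add, Prod.snd_add]
          congr 1
          · ring
          · congr 1 <;> ring

theorem ofReal_cpow_eq_cexp {x : ℝ} (hx : 0 < x) (a : ℂ) :
    (x : ℂ) ^ a = Complex.exp (a * (log x : ℝ)) := by
  rw [Complex.cpow_def_of_ne_zero (by exact_mod_cast hx.ne'), ← Complex.ofReal_log hx.le, mul_comm]

theorem integrable_cexp_logGammaMeasure_prod {k₁ k₂ k₃ : ℝ} {b₁ b₂ b₃ : ℂ}
    (h₁ : 0 < (b₁ + k₁).re) (h₂ : 0 < (b₂ + k₂).re) (h₃ : 0 < (b₃ + k₃).re) :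
    Integrable (fun x : ℝ × ℝ × ℝ =>
        Complex.exp (b₁ * x.1) * (Complex.exp (b₂ * x.2.1) * Complex.exp (b₃ * x.2.2)))
      ((logGammaMeasure k₁).prod ((logGammaMeasure k₂).prod (logGammaMeasure k₃))) ∧
    ∫ x : ℝ × ℝ × ℝ,
        Complex.exp (b₁ * x.1) * (Complex.exp (b₂ * x.2.1) * Complex.exp (b₃ * x.2.2))
      ∂(logGammaMeasure k₁).prod ((logGammaMeasure k₂).prod (logGammaMeasure k₃)) =
    Complex.Gamma (b₁ + k₁) * (Complex.Gamma (b₂ + k₂) * Complex.Gamma (b₃ + k₃)) := by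
  obtain ⟨i₁, e₁⟩ := integrable_cexp_logGammaMeasure h₁
  obtain ⟨i₂, e₂⟩ := integrable_cexp_logGammaMeasure h₂
  obtain ⟨i₃, e₃⟩ := integrable_cexp_logGammaMeasure h₃
  refine ⟨i₁.mul_prod (i₂.mul_prod i₃), ?_⟩
  rw [integral_prod_mul (fun x : ℝ => Complex.exp (b₁ * x)) (fun x : ℝ × ℝ =>
    Complex.exp (b₂ * x.1) * Complex.exp (b₃ * x.2)), integral_prod_mul (fun x : ℝ =>
    Complex.exp (b₂ * x)) (fun x : ℝ => Complex.exp (b₃ * x)), e₁, e₂, e₃]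

theorem measure_prod_ne_zero {X Y : Type*} [MeasurableSpace X] [MeasurableSpace Y]
    {μ : Measure X} {ν : Measure Y} [SFinite ν] (hμ : μ ≠ 0) (hν : ν ≠ 0) : μ.prod ν ≠ 0 := by
  rw [← Measure.measure_univ_ne_zero, ← Set.univ_prod_univ, Measure.prod_prod]
  exact mul_ne_zero (Measure.measure_univ_ne_zero.2 hμ) (Measure.measure_univ_ne_zero.2 hν)

/-- `lintegral_star_eq` is tested on `exp (b₁ x₁ + b₂ x₂ + b₃ x₃)` with `b₁ = -a₂ - a₃` and
cyclically. One side is the star integral times `Γ(b₁) Γ(b₂) Γ(b₃)`. The other is a product of four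
Gamma integrals times powers of `ξᵢ·ξⱼ / 2`, and the hypotheses on the exponents are exactly the
convergence of those four. -/
theorem isStarTriangleConst {d : ℕ} (hd : 1 ≤ d) {a₁ a₂ a₃ : ℂ} (h₁ : a₁.re < 0) (h₂ : a₂.re < 0)
    (h₃ : a₃.re < 0) (h : (a₁ + a₂ + a₃).re < -(((d : ℝ) - 1) / 2)) :
    IsStarTriangleConst d a₁ a₂ a₃ ((2 : ℂ) ^ (-(a₁ + a₂ + a₃) - 1) *
      (π : ℂ) ^ (((d : ℂ) - 1) / 2) * Complex.Gamma (-(a₁ + a₂ + a₃) - ((d : ℂ) - 1) / 2) *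
      (Complex.Gamma (-a₁) * Complex.Gamma (-a₂) * Complex.Gamma (-a₃) /
        (Complex.Gamma (-a₂ - a₃) * Complex.Gamma (-a₃ - a₁) * Complex.Gamma (-a₁ - a₂)))) := by
  intro ξ₁ m₁ ξ₂ m₂ ξ₃ m₃ h₁₂ h₂₃ h₃₁
  have p₁₂ := (lorentz_nonneg_of_mem_forwardCone m₁ m₂).lt_of_ne' h₁₂
  have p₂₃ := (lorentz_nonneg_of_mem_forwardCone m₂ m₃).lt_of_ne' h₂₃
  have p₃₁ := (lorentz_nonneg_of_mem_forwardCone m₃ m₁).lt_of_ne' h₃₁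
  set D : ℝ := ((d : ℝ) - 1) / 2 with hD
  set b₁ := -a₂ - a₃ with hb₁
  set b₂ := -a₃ - a₁ with hb₂
  set b₃ := -a₁ - a₂ with hb₃
  set a := a₁ + a₂ + a₃ with ha
  have r₁ : 0 < (b₁ + (0 : ℝ)).re := by simp [hb₁]; linarith
  have r₂ : 0 < (b₂ + (0 : ℝ)).re := by simp [hb₂]; linarith
  have r₃ : 0 < (b₃ + (0 : ℝ)).re := by simp [hb₃]; linarith
  set K := Complex.exp (a₃ * (log (lorentz ξ₁ ξ₂ / 2) : ℝ) + a₂ * (log (lorentz ξ₃ ξ₁ / 2) : ℝ) +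
    a₁ * (log (lorentz ξ₂ ξ₃ / 2) : ℝ)) with hK
  have hr : 0 < (-a + ((-D : ℝ) : ℂ)).re := by
    rw [Complex.add_re, Complex.neg_re, Complex.ofReal_re]
    linarith
  obtain ⟨i₀, e₀⟩ := integrable_cexp_logGammaMeasure hr
  obtain ⟨iw, ew⟩ := integrable_cexp_logGammaMeasure_prod (k₁ := 0) (k₂ := 0) (k₃ := 0)
    (b₁ := -a₃) (b₂ := -a₂) (b₃ := -a₁) (by simpa using h₃) (by simpa using h₂) (by simpa using h₁)
  obtain ⟨iτ, eτ⟩ := integrable_cexp_logGammaMeasure_prod r₁ r₂ r₃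
  have hψ := (i₀.mul_prod iw).mul_const K
  set g : ℝ × ℝ × ℝ → ℂ := fun x => Complex.exp (b₁ * x.1 + b₂ * x.2.1 + b₃ * x.2.2) with hg
  have hgm : Measurable g := by fun_prop
  obtain ⟨iφ, eφ⟩ := integrable_comp_of_lintegral_eq (g := g) (by fun_prop) (by fun_prop)
    ENNReal.ofReal_ne_top (fun f hf => lintegral_star_eq hd m₁ m₂ m₃ h₁₂ h₂₃ h₃₁ hf) hgm (by
      refine hψ.congr (Filter.Eventually.of_forall fun p => ?_)
      simp only [hg, hK, ← Complex.exp_add]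
      congr 1
      simp only [hb₁, hb₂, hb₃, ha]
      push_cast
      ring)
  set F : Minkowski d → ℂ := fun y => Complex.exp (-(b₁ * (log (lorentz y ξ₁) : ℝ) +
    b₂ * (log (lorentz y ξ₂) : ℝ) + b₃ * (log (lorentz y ξ₃) : ℝ))) with hF
  have hFs : F =ᵐ[hyperboloidMeasure d] starFun a₁ a₂ a₃ ξ₁ ξ₂ ξ₃ := by
    filter_upwards [ae_lorentz_pos hd m₁, ae_lorentz_pos hd m₂, ae_lorentz_pos hd m₃] with
      y hy₁ hy₂ hy₃
    rw [starFun, ofReal_cpow_eq_cexp hy₁, ofReal_cpow_eq_cexp hy₂, ofReal_cpow_eq_cexp hy₃,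
      ← Complex.exp_add, ← Complex.exp_add]
    simp only [hF, hb₁, hb₂, hb₃]
    congr 1
    ring
  have hφ : ∀ p : Minkowski d × ℝ × ℝ × ℝ, g (p.2.1 - log (lorentz p.1 ξ₁),
      p.2.2.1 - log (lorentz p.1 ξ₂), p.2.2.2 - log (lorentz p.1 ξ₃)) = F p.1 *
        (Complex.exp (b₁ * p.2.1) * (Complex.exp (b₂ * p.2.2.1) * Complex.exp (b₃ * p.2.2.2))) := by
    intro p
    simp only [hg, hF, ← Complex.exp_add]
    congr 1
    push_cast
    ring
  have hψ' : ∀ p : ℝ × ℝ × ℝ × ℝ,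
      g ((p.2.1 + p.2.2.1 - p.2.2.2 + p.1 - log (lorentz ξ₁ ξ₂ / 2) -
            log (lorentz ξ₃ ξ₁ / 2) + log (lorentz ξ₂ ξ₃ / 2)) / 2,
          (p.2.1 + p.2.2.2 - p.2.2.1 + p.1 - log (lorentz ξ₁ ξ₂ / 2) -
            log (lorentz ξ₂ ξ₃ / 2) + log (lorentz ξ₃ ξ₁ / 2)) / 2,
          (p.2.2.1 + p.2.2.2 - p.2.1 + p.1 - log (lorentz ξ₃ ξ₁ / 2) -
            log (lorentz ξ₂ ξ₃ / 2) + log (lorentz ξ₁ ξ₂ / 2)) / 2) =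
      Complex.exp (-a * p.1) * (Complex.exp (-a₃ * p.2.1) * (Complex.exp (-a₂ * p.2.2.1) *
        Complex.exp (-a₁ * p.2.2.2))) * K := by
    intro p
    simp only [hg, hK, ← Complex.exp_add]
    congr 1
    simp only [hb₁, hb₂, hb₃, ha]
    push_cast
    ring
  simp only [hφ] at iφ eφ
  simp only [hψ'] at eφ
  have hγ : (logGammaMeasure 0).prod ((logGammaMeasure 0).prod (logGammaMeasure 0)) ≠ 0 :=
    measure_prod_ne_zero (logGammaMeasure_ne_zero 0)
      (measure_prod_ne_zero (logGammaMeasure_ne_zero 0) (logGammaMeasure_ne_zero 0))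
  have hint : Integrable F (hyperboloidMeasure d) :=
    integrable_left_of_mul_prod hγ (g := fun x : ℝ × ℝ × ℝ =>
      Complex.exp (b₁ * x.1) * (Complex.exp (b₂ * x.2.1) * Complex.exp (b₃ * x.2.2)))
      (fun _ => by simp [Complex.exp_ne_zero]) iφ
  refine ⟨hint.congr hFs, ?_⟩
  rw [← integral_congr_ae hFs]
  rw [integral_prod_mul F (fun x : ℝ × ℝ × ℝ =>
      Complex.exp (b₁ * x.1) * (Complex.exp (b₂ * x.2.1) * Complex.exp (b₃ * x.2.2))), eτ,
    integral_mul_const, integral_prod_mul (fun x : ℝ => Complex.exp (-a * x)) (fun x : ℝ × ℝ × ℝ =>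
      Complex.exp (-a₃ * x.1) * (Complex.exp (-a₂ * x.2.1) * Complex.exp (-a₁ * x.2.2))), ew, e₀,
    ENNReal.toReal_ofReal (by positivity)] at eφ
  simp only [Complex.ofReal_zero, add_zero] at eφ r₁ r₂ r₃
  have g₁ := Complex.Gamma_ne_zero_of_re_pos r₁
  have g₂ := Complex.Gamma_ne_zero_of_re_pos r₂
  have g₃ := Complex.Gamma_ne_zero_of_re_pos r₃
  have hK' : K = (2 : ℂ) ^ (-a) * ((lorentz ξ₁ ξ₂ : ℂ) ^ a₃ * (lorentz ξ₂ ξ₃ : ℂ) ^ a₁ *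
      (lorentz ξ₃ ξ₁ : ℂ) ^ a₂) := by
    have h2 : (2 : ℂ) ^ (-a) = ((2 : ℝ) : ℂ) ^ (-a) := by norm_cast
    rw [h2, ofReal_cpow_eq_cexp two_pos, ofReal_cpow_eq_cexp p₁₂, ofReal_cpow_eq_cexp p₂₃,
      ofReal_cpow_eq_cexp p₃₁, ← Complex.exp_add, ← Complex.exp_add, ← Complex.exp_add, hK,
      Real.log_div p₁₂.ne' two_ne_zero, Real.log_div p₂₃.ne' two_ne_zero,
      Real.log_div p₃₁.ne' two_ne_zero, ha]
    congr 1
    push_cast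
    ring
  have hpi : ((π ^ D / 2 : ℝ) : ℂ) = (π : ℂ) ^ (((d : ℂ) - 1) / 2) / 2 := by
    rw [hD]
    push_cast [Complex.ofReal_cpow pi_pos.le]
    rfl
  have hG : -a + ((-D : ℝ) : ℂ) = -a - ((d : ℂ) - 1) / 2 := by
    rw [hD]
    push_cast
    ring
  have h21 : (2 : ℂ) ^ (-a - 1) = (2 : ℂ) ^ (-a) / 2 := by
    rw [Complex.cpow_sub _ _ two_ne_zero, Complex.cpow_one]
  rw [hpi, hK', hG] at eφ
  rw [h21]
  generalize Complex.Gamma (-a - ((d : ℂ) - 1) / 2) = G at eφ ⊢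
  field_simp
  linear_combination 2 * eφ

/-! ### The triangle integral over three points of the sphere. -/

/-- A reflection carries `p` to the pole of projection. The stereographic coordinates of the other
two points then make all three chords explicit. -/
theorem lintegral_sphereMeasure_pair {n : ℕ} (hn : 1 ≤ n) {G : ℝ × ℝ × ℝ → ENNReal}
    (hG : Measurable G) {p : EuclideanSpace ℝ (Fin (n + 1))} (hp : ‖p‖ = 1) :
    ∫⁻ u, ∫⁻ v, G (‖(u - v : EuclideanSpace ℝ (Fin (n + 1)))‖ ^ 2,
        ‖(p - u : EuclideanSpace ℝ (Fin (n + 1)))‖ ^ 2,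
        ‖(v - p : EuclideanSpace ℝ (Fin (n + 1)))‖ ^ 2) ∂sphereMeasure (n + 1)
          ∂sphereMeasure (n + 1) =
      ∫⁻ x : EuclideanSpace ℝ (Fin n), ∫⁻ y : EuclideanSpace ℝ (Fin n),
        ENNReal.ofReal ((2 / (1 + ‖x‖ ^ 2)) ^ n) * (ENNReal.ofReal ((2 / (1 + ‖y‖ ^ 2)) ^ n) *
          G (4 * ‖x - y‖ ^ 2 / ((1 + ‖x‖ ^ 2) * (1 + ‖y‖ ^ 2)), 4 / (1 + ‖x‖ ^ 2),
            4 / (1 + ‖y‖ ^ 2))) := by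
  obtain ⟨R, hR⟩ : ∃ R : EuclideanSpace ℝ (Fin (n + 1)) ≃ₗᵢ[ℝ] EuclideanSpace ℝ (Fin (n + 1)), R (southPole n) = p :=
    ⟨(ℝ ∙ (southPole n - p))ᗮ.reflection, Submodule.reflection_sub (by rw [hp, norm_southPole])⟩
  have hRm : Measurable R := R.continuous.measurable
  have hsub : ∀ a b : EuclideanSpace ℝ (Fin (n + 1)), ‖R a - R b‖ = ‖a - b‖ := fun a b => by rw [← map_sub, R.norm_map]
  have hmG : Measurable fun q : EuclideanSpace ℝ (Fin (n + 1)) × EuclideanSpace ℝ (Fin (n + 1)) => G (‖q.1 - q.2‖ ^ 2, ‖p - q.1‖ ^ 2, ‖q.2 - p‖ ^ 2) :=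
    hG.comp (by fun_prop)
  have hmG' : Measurable fun q : EuclideanSpace ℝ (Fin (n + 1)) × EuclideanSpace ℝ (Fin (n + 1)) => G (‖q.1 - q.2‖ ^ 2, ‖southPole n - q.1‖ ^ 2,
      ‖q.2 - southPole n‖ ^ 2) := hG.comp (by fun_prop)
  have hst := measurable_stereoPoint (n := n)
  have h1 : ∀ u : EuclideanSpace ℝ (Fin (n + 1)), ∫⁻ v, G (‖R u - (v : EuclideanSpace ℝ (Fin (n + 1)))‖ ^ 2, ‖p - R u‖ ^ 2, ‖(v : EuclideanSpace ℝ (Fin (n + 1))) - p‖ ^ 2)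
      ∂sphereMeasure (n + 1) = ∫⁻ v, G (‖u - (v : EuclideanSpace ℝ (Fin (n + 1)))‖ ^ 2, ‖southPole n - u‖ ^ 2,
        ‖(v : EuclideanSpace ℝ (Fin (n + 1))) - southPole n‖ ^ 2) ∂sphereMeasure (n + 1) := by
    intro u
    rw [← lintegral_sphereMeasure_isometry (by omega) R (f := fun v => G (‖R u - (v : EuclideanSpace ℝ (Fin (n + 1)))‖ ^ 2,
      ‖p - R u‖ ^ 2, ‖(v : EuclideanSpace ℝ (Fin (n + 1))) - p‖ ^ 2)) (hG.comp (by fun_prop))]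
    simp only [← hR, hsub]
  rw [← lintegral_sphereMeasure_isometry (by omega) R (f := fun u => ∫⁻ v, G (‖u - (v : EuclideanSpace ℝ (Fin (n + 1)))‖ ^ 2,
      ‖p - u‖ ^ 2, ‖(v : EuclideanSpace ℝ (Fin (n + 1))) - p‖ ^ 2) ∂sphereMeasure (n + 1))
      (Measurable.lintegral_prod_right' (f := fun q : EuclideanSpace ℝ (Fin (n + 1)) × USphere (n + 1) =>
        G (‖q.1 - q.2‖ ^ 2, ‖p - q.1‖ ^ 2, ‖(q.2 : EuclideanSpace ℝ (Fin (n + 1))) - p‖ ^ 2)) (hG.comp (by fun_prop)))]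
  simp only [h1]
  rw [lintegral_sphereMeasure_eq_stereoPoint hn (f := fun u => ∫⁻ v, G (‖u - (v : EuclideanSpace ℝ (Fin (n + 1)))‖ ^ 2,
      ‖southPole n - u‖ ^ 2, ‖(v : EuclideanSpace ℝ (Fin (n + 1))) - southPole n‖ ^ 2) ∂sphereMeasure (n + 1))
      (Measurable.lintegral_prod_right' (f := fun q : EuclideanSpace ℝ (Fin (n + 1)) × USphere (n + 1) =>
        G (‖q.1 - q.2‖ ^ 2, ‖southPole n - q.1‖ ^ 2, ‖(q.2 : EuclideanSpace ℝ (Fin (n + 1))) - southPole n‖ ^ 2))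
          (hG.comp (by fun_prop)))]
  refine lintegral_congr fun x => ?_
  rw [← lintegral_const_mul' _ _ ENNReal.ofReal_ne_top, lintegral_sphereMeasure_eq_stereoPoint hn
    (f := fun v => ENNReal.ofReal ((2 / (1 + ‖x‖ ^ 2)) ^ n) * G (‖stereoPoint x - v‖ ^ 2,
      ‖southPole n - stereoPoint x‖ ^ 2, ‖v - southPole n‖ ^ 2))
      (Measurable.const_mul (hG.comp (by fun_prop)) _)]
  refine lintegral_congr fun y => ?_
  simp only [norm_stereoPoint_sub_sq, norm_southPole_sub_stereoPoint_sq,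
    norm_sub_rev _ (southPole n)]
  ring

/-- The integral over the pair is independent of the first point, which contributes only the total
area. -/
theorem lintegral_sphereMeasure₃ {n : ℕ} (hn : 1 ≤ n) {G : ℝ × ℝ × ℝ → ENNReal}
    (hG : Measurable G) :
    ∫⁻ p, G (dist p.2.1 p.2.2 ^ 2, dist p.1 p.2.1 ^ 2, dist p.2.2 p.1 ^ 2)
        ∂sphereMeasure₃ (n + 1) =
      ENNReal.ofReal (sphereArea (n + 1)) *
      ∫⁻ x : EuclideanSpace ℝ (Fin n), ∫⁻ y : EuclideanSpace ℝ (Fin n),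
        ENNReal.ofReal ((2 / (1 + ‖x‖ ^ 2)) ^ n) * (ENNReal.ofReal ((2 / (1 + ‖y‖ ^ 2)) ^ n) *
          G (4 * ‖x - y‖ ^ 2 / ((1 + ‖x‖ ^ 2) * (1 + ‖y‖ ^ 2)), 4 / (1 + ‖x‖ ^ 2),
            4 / (1 + ‖y‖ ^ 2))) := by
  rw [sphereMeasure₃, lintegral_prod _ (by exact (hG.comp (by fun_prop)).aemeasurable)]
  have h : ∀ p : USphere (n + 1), ∫⁻ q : USphere (n + 1) × USphere (n + 1),
      G (dist q.1 q.2 ^ 2, dist p q.1 ^ 2, dist q.2 p ^ 2)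
        ∂(sphereMeasure (n + 1)).prod (sphereMeasure (n + 1)) =
      ∫⁻ x : EuclideanSpace ℝ (Fin n), ∫⁻ y : EuclideanSpace ℝ (Fin n),
        ENNReal.ofReal ((2 / (1 + ‖x‖ ^ 2)) ^ n) * (ENNReal.ofReal ((2 / (1 + ‖y‖ ^ 2)) ^ n) *
          G (4 * ‖x - y‖ ^ 2 / ((1 + ‖x‖ ^ 2) * (1 + ‖y‖ ^ 2)), 4 / (1 + ‖x‖ ^ 2),
            4 / (1 + ‖y‖ ^ 2))) := by
    intro p
    rw [lintegral_prod _ (by exact (hG.comp (by fun_prop)).aemeasurable),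
      ← lintegral_sphereMeasure_pair hn hG (p := p) (by simp)]
    simp only [Subtype.dist_eq, dist_eq_norm]
  simp only [h]
  rw [lintegral_const, sphereMeasure_univ (by omega), mul_comm]

/-- Substitute `x = z + y` and complete the square in `y`: the weights `α`, `β` combine to `αβ / (α
+ β)`. -/
theorem lintegral_exp_neg_mul_norm_sq_sub {n : ℕ} {α β : ℝ} (hα : 0 < α) (hβ : 0 < β)
    {h : ℝ → ENNReal} (hh : Measurable h) :
    ∫⁻ x : EuclideanSpace ℝ (Fin n), ∫⁻ y : EuclideanSpace ℝ (Fin n),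
        ENNReal.ofReal (exp (-(α * ‖x‖ ^ 2) - β * ‖y‖ ^ 2)) * h (‖x - y‖ ^ 2) =
      ENNReal.ofReal ((π / (α + β)) ^ ((n : ℝ) / 2)) * ∫⁻ z : EuclideanSpace ℝ (Fin n),
        ENNReal.ofReal (exp (-(α * β / (α + β) * ‖z‖ ^ 2))) * h (‖z‖ ^ 2) := by
  rw [lintegral_lintegral_swap (by fun_prop)]
  have h1 : ∀ y : EuclideanSpace ℝ (Fin n), ∫⁻ x : EuclideanSpace ℝ (Fin n),
      ENNReal.ofReal (exp (-(α * ‖x‖ ^ 2) - β * ‖y‖ ^ 2)) * h (‖x - y‖ ^ 2) =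
      ∫⁻ z : EuclideanSpace ℝ (Fin n), ENNReal.ofReal (exp (-(α * ‖z‖ ^ 2))) * h (‖z‖ ^ 2) *
        ENNReal.ofReal (exp (-(α + β) * ‖y‖ ^ 2 + inner ℝ ((-2 * α) • z) y)) := by
    intro y
    rw [← lintegral_add_right_eq_self _ y]
    refine lintegral_congr fun z => ?_
    rw [mul_right_comm, ← ENNReal.ofReal_mul (by positivity), ← Real.exp_add, add_sub_cancel_right,
      norm_add_sq_real, real_inner_smul_left]
    ring_nf
  simp only [h1]
  rw [lintegral_lintegral_swap (by fun_prop), ← lintegral_const_mul' _ _ ENNReal.ofReal_ne_top]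
  refine lintegral_congr fun z => ?_
  rw [lintegral_const_mul _ (by fun_prop), lintegral_exp_neg_mul_norm_sq_add_inner (by positivity),
    ← mul_assoc (ENNReal.ofReal ((π / (α + β)) ^ ((n : ℝ) / 2))),
    ← ENNReal.ofReal_mul (by positivity), mul_right_comm, ← ENNReal.ofReal_mul (by positivity),
    mul_left_comm, ← Real.exp_add, norm_smul, Real.norm_eq_abs, mul_pow, sq_abs]
  congr 4
  field_simp
  ring

theorem lintegral_log_norm_sq {n : ℕ} (hn : 1 ≤ n) {g : ℝ → ENNReal} (hg : Measurable g) :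
    ∫⁻ z : EuclideanSpace ℝ (Fin n), g (log (‖z‖ ^ 2)) =
      ENNReal.ofReal (sphereArea n / 2) * ∫⁻ v, ENNReal.ofReal (exp (n / 2 * v)) * g v := by
  have : Nonempty (Fin n) := ⟨⟨0, hn⟩⟩
  rw [lintegral_polar volume (by fun_prop)]
  have h : ∀ p : USphere n, ∫⁻ r in Set.Ioi (0 : ℝ), ENNReal.ofReal
      (r ^ (Module.finrank ℝ (EuclideanSpace ℝ (Fin n)) - 1)) *
        g (log (‖r • (p : EuclideanSpace ℝ (Fin n))‖ ^ 2)) =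
      ENNReal.ofReal (1 / 2) * ∫⁻ v, ENNReal.ofReal (exp (n / 2 * v)) * g v := by
    intro p
    rw [lintegral_Ioi_zero_eq, lintegral_comp_smul_of_pos (f := fun v =>
      ENNReal.ofReal (exp (n / 2 * v)) * g v) volume (by fun_prop) (two_pos : (0 : ℝ) < 2), ← mul_assoc, ← ENNReal.ofReal_mul (by positivity)]
    simp only [Module.finrank_self, pow_one, smul_eq_mul]
    rw [show (1 / 2 * 2 : ℝ) = 1 by norm_num, ENNReal.ofReal_one, one_mul]
    refine lintegral_congr fun y => ?_
    have hp : ‖(p : EuclideanSpace ℝ (Fin n))‖ = 1 := by simp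
    rw [norm_smul, hp, mul_one, Real.norm_of_nonneg (exp_pos y).le, Real.log_pow, Real.log_exp,
      finrank_euclideanSpace, Fintype.card_fin, ← mul_assoc, ← ENNReal.ofReal_mul (by positivity),
      ← Real.exp_nat_mul, ← Real.exp_add]
    congr 3
    · push_cast [hn]
      ring
  have hd := sphereMeasure_univ hn
  rw [sphereMeasure] at hd
  simp only [h]
  rw [lintegral_const, hd, mul_right_comm, ← ENNReal.ofReal_mul (by positivity)]
  congr 2
  ring

/-- Under the Gaussian weight the squared distance is a multiple of a Gamma variable of parameter
`n/2`; the shift in `h` is the logarithm of its scale. -/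
theorem lintegral_exp_neg_exp_mul_norm_sq_sub {n : ℕ} (hn : 1 ≤ n) (t t' : ℝ) {h : ℝ → ENNReal}
    (hh : Measurable h) :
    ∫⁻ x : EuclideanSpace ℝ (Fin n), ∫⁻ y : EuclideanSpace ℝ (Fin n),
        ENNReal.ofReal (exp (-(exp t * ‖x‖ ^ 2) - exp t' * ‖y‖ ^ 2)) * h (log (‖x - y‖ ^ 2)) =
      ENNReal.ofReal (π ^ ((n : ℝ) / 2) * (sphereArea n / 2) * exp (-(n / 2 * (t + t')))) *
        ∫⁻ v, h (v + log (exp t + exp t') - t - t') ∂logGammaMeasure (n / 2) := by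
  have hA := sphereArea_pos hn
  rw [lintegral_exp_neg_mul_norm_sq_sub (exp_pos t) (exp_pos t') (h := fun r => h (log r))
    (by fun_prop)]
  have hL : exp (log (exp t + exp t')) = exp t + exp t' := Real.exp_log (by positivity)
  set L := log (exp t + exp t')
  have h1 : ∀ z : EuclideanSpace ℝ (Fin n), z ≠ 0 → ENNReal.ofReal (exp (-(exp t * exp t' /
      (exp t + exp t') * ‖z‖ ^ 2))) * h (log (‖z‖ ^ 2)) =
      ENNReal.ofReal (exp (-(exp (t + t' - L + log (‖z‖ ^ 2))))) * h (log (‖z‖ ^ 2)) := by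
    intro z hz
    have hz' : 0 < ‖z‖ ^ 2 := by positivity
    rw [Real.exp_add (t + t' - L), Real.exp_sub, Real.exp_add t, hL, Real.exp_log hz']
  rw [lintegral_congr_ae ((ae_ne_zero_euclidean hn).mono h1), lintegral_log_norm_sq hn
    (g := fun v => ENNReal.ofReal (exp (-(exp (t + t' - L + v)))) * h v) (by fun_prop), ← mul_assoc, ← ENNReal.ofReal_mul (by positivity), lintegral_logGammaMeasure _
    (by fun_prop), ← lintegral_add_right_eq_self _ (L - t - t'),
    ← lintegral_const_mul' _ _ ENNReal.ofReal_ne_top,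
    ← lintegral_const_mul' _ _ ENNReal.ofReal_ne_top]
  refine lintegral_congr fun v => ?_
  rw [← mul_assoc, ← mul_assoc, ← mul_assoc, ← ENNReal.ofReal_mul (by positivity),
    ← ENNReal.ofReal_mul (by positivity), ← ENNReal.ofReal_mul (by positivity)]
  congr 2
  · rw [← hL, Real.div_rpow pi_pos.le (exp_pos _).le, ← Real.exp_mul, div_eq_mul_inv,
      ← Real.exp_neg]
    have e1 : ∀ a b c e f : ℝ, a * exp b * c * exp e * exp f = a * c * exp (b + e + f) :=
      fun a b c e f => by rw [Real.exp_add, Real.exp_add]; ring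
    have e2 : ∀ a c e f : ℝ, a * c * exp e * exp f = a * c * exp (e + f) :=
      fun a c e f => by rw [Real.exp_add]; ring
    rw [e1, e2]
    congr 2
    ring_nf
  · ring

/-- The parameter `n` of `τ`, `τ'` is chosen so that the scaling factors `(1 + ‖x‖²)^n` cancel the
stereographic weights. What remains is Gaussian in `x`, `y`, and its normalization `e^{-n(t+t')/2}`
lowers the parameters from `n` to `n/2`. -/
theorem lintegral_stereo_logGammaMeasure {n : ℕ} (hn : 1 ≤ n) {f : ℝ × ℝ × ℝ → ENNReal}
    (hf : Measurable f) :
    ∫⁻ x : EuclideanSpace ℝ (Fin n), ∫⁻ y : EuclideanSpace ℝ (Fin n),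
        ENNReal.ofReal ((2 / (1 + ‖x‖ ^ 2)) ^ n) * (ENNReal.ofReal ((2 / (1 + ‖y‖ ^ 2)) ^ n) *
          ∫⁻ τ, ∫⁻ τ', f (log (‖x - y‖ ^ 2), τ - log (1 + ‖x‖ ^ 2), τ' - log (1 + ‖y‖ ^ 2))
            ∂logGammaMeasure n ∂logGammaMeasure n) =
      ENNReal.ofReal (4 ^ n * (π ^ ((n : ℝ) / 2) * (sphereArea n / 2))) *
        ∫⁻ t, ∫⁻ t', ∫⁻ v, f (v + log (exp t + exp t') - t - t', t, t') ∂logGammaMeasure (n / 2)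
          ∂logGammaMeasure (n / 2) ∂logGammaMeasure (n / 2) := by
  have hA := sphereArea_pos hn
  have hw : ∀ X : ℝ, 0 < X → ENNReal.ofReal ((2 / X) ^ n) * ENNReal.ofReal (X ^ (n : ℝ)) =
      ENNReal.ofReal (2 ^ n) := by
    intro X hX
    rw [← ENNReal.ofReal_mul (by positivity), Real.rpow_natCast, div_pow,
      div_mul_cancel₀ _ (by positivity)]
  have h1 : ∀ x y : EuclideanSpace ℝ (Fin n),
      ENNReal.ofReal ((2 / (1 + ‖x‖ ^ 2)) ^ n) * (ENNReal.ofReal ((2 / (1 + ‖y‖ ^ 2)) ^ n) *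
          ∫⁻ τ, ∫⁻ τ', f (log (‖x - y‖ ^ 2), τ - log (1 + ‖x‖ ^ 2), τ' - log (1 + ‖y‖ ^ 2))
            ∂logGammaMeasure n ∂logGammaMeasure n) =
      ENNReal.ofReal (4 ^ n) * ∫⁻ q : ℝ × ℝ, ENNReal.ofReal (exp (n * q.1 - exp q.1) *
        exp (n * q.2 - exp q.2)) * (ENNReal.ofReal (exp (-(exp q.1 * ‖x‖ ^ 2) -
          exp q.2 * ‖y‖ ^ 2)) * f (log (‖x - y‖ ^ 2), q.1, q.2)) := by
    intro x y
    have hx : 0 < 1 + ‖x‖ ^ 2 := by positivity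
    have hy : 0 < 1 + ‖y‖ ^ 2 := by positivity
    rw [lintegral_logGammaMeasure_sub_log n hx (g := fun τ => ∫⁻ τ', f (log (‖x - y‖ ^ 2), τ,
      τ' - log (1 + ‖y‖ ^ 2)) ∂logGammaMeasure n) (Measurable.lintegral_prod_right' (f :=
        fun q : ℝ × ℝ => f (log (‖x - y‖ ^ 2), q.1, q.2 - log (1 + ‖y‖ ^ 2)))
          (hf.comp (by fun_prop)))]
    have h2 : ∀ τ, ∫⁻ τ', f (log (‖x - y‖ ^ 2), τ, τ' - log (1 + ‖y‖ ^ 2)) ∂logGammaMeasure n =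
        ENNReal.ofReal ((1 + ‖y‖ ^ 2) ^ (n : ℝ)) * ∫⁻ t', ENNReal.ofReal
          (exp (n * t' - (1 + ‖y‖ ^ 2) * exp t')) * f (log (‖x - y‖ ^ 2), τ, t') := fun τ =>
      lintegral_logGammaMeasure_sub_log n hy (g := fun τ' => f (log (‖x - y‖ ^ 2), τ, τ'))
        (hf.comp (by fun_prop))
    simp only [h2, mul_left_comm _ (ENNReal.ofReal ((1 + ‖y‖ ^ 2) ^ (n : ℝ)))]
    rw [lintegral_const_mul' (ENNReal.ofReal ((1 + ‖y‖ ^ 2) ^ (n : ℝ))) _ ENNReal.ofReal_ne_top,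
      mul_left_comm (ENNReal.ofReal ((1 + ‖x‖ ^ 2) ^ (n : ℝ))), ← mul_assoc (ENNReal.ofReal
      ((2 / (1 + ‖y‖ ^ 2)) ^ n)), hw _ hy, mul_left_comm, ← mul_assoc (ENNReal.ofReal
      ((2 / (1 + ‖x‖ ^ 2)) ^ n)), hw _ hx, ← mul_assoc, ← ENNReal.ofReal_mul (by positivity),
      ← mul_pow, show (2 * 2 : ℝ) = 4 by norm_num, Measure.volume_eq_prod,
      lintegral_prod _ (by exact Measurable.aemeasurable (by fun_prop))]
    congr 1
    refine lintegral_congr fun t => ?_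
    rw [← lintegral_const_mul' _ _ ENNReal.ofReal_ne_top]
    refine lintegral_congr fun t' => ?_
    rw [← mul_assoc, ← mul_assoc, ← ENNReal.ofReal_mul (by positivity),
      ← ENNReal.ofReal_mul (by positivity), ← Real.exp_add, ← Real.exp_add, ← Real.exp_add]
    congr 3
    ring
  simp only [h1]
  have hm : Measurable fun p : (EuclideanSpace ℝ (Fin n) × EuclideanSpace ℝ (Fin n)) × ℝ × ℝ =>
      ENNReal.ofReal (exp (n * p.2.1 - exp p.2.1) * exp (n * p.2.2 - exp p.2.2)) *
        (ENNReal.ofReal (exp (-(exp p.2.1 * ‖p.1.1‖ ^ 2) - exp p.2.2 * ‖p.1.2‖ ^ 2)) *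
          f (log (‖p.1.1 - p.1.2‖ ^ 2), p.2.1, p.2.2)) := by fun_prop
  have hswap : ∫⁻ x : EuclideanSpace ℝ (Fin n), ∫⁻ y : EuclideanSpace ℝ (Fin n), ∫⁻ q : ℝ × ℝ,
      ENNReal.ofReal (exp (n * q.1 - exp q.1) * exp (n * q.2 - exp q.2)) *
        (ENNReal.ofReal (exp (-(exp q.1 * ‖x‖ ^ 2) - exp q.2 * ‖y‖ ^ 2)) *
          f (log (‖x - y‖ ^ 2), q.1, q.2)) =
      ∫⁻ q : ℝ × ℝ, ∫⁻ x : EuclideanSpace ℝ (Fin n), ∫⁻ y : EuclideanSpace ℝ (Fin n),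
      ENNReal.ofReal (exp (n * q.1 - exp q.1) * exp (n * q.2 - exp q.2)) *
        (ENNReal.ofReal (exp (-(exp q.1 * ‖x‖ ^ 2) - exp q.2 * ‖y‖ ^ 2)) *
          f (log (‖x - y‖ ^ 2), q.1, q.2)) := by
    have e1 := lintegral_prod (μ := (volume : Measure (EuclideanSpace ℝ (Fin n))))
      (ν := (volume : Measure (EuclideanSpace ℝ (Fin n)))) _
      (Measurable.lintegral_prod_right' (ν := (volume : Measure (ℝ × ℝ))) hm).aemeasurable
    refine e1.symm.trans ((lintegral_lintegral_swap hm.aemeasurable).trans ?_)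
    refine lintegral_congr fun q => ?_
    exact lintegral_prod _ (Measurable.aemeasurable (by fun_prop))
  calc _ = ENNReal.ofReal (4 ^ n) * ∫⁻ q : ℝ × ℝ, ∫⁻ x : EuclideanSpace ℝ (Fin n),
        ∫⁻ y : EuclideanSpace ℝ (Fin n),
        ENNReal.ofReal (exp (n * q.1 - exp q.1) * exp (n * q.2 - exp q.2)) *
        (ENNReal.ofReal (exp (-(exp q.1 * ‖x‖ ^ 2) - exp q.2 * ‖y‖ ^ 2)) *
          f (log (‖x - y‖ ^ 2), q.1, q.2)) := by
        rw [← hswap, ← lintegral_const_mul' _ _ ENNReal.ofReal_ne_top]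
        refine lintegral_congr fun x => ?_
        rw [← lintegral_const_mul' _ _ ENNReal.ofReal_ne_top]
    _ = ENNReal.ofReal (4 ^ n) * ∫⁻ q : ℝ × ℝ,
        ENNReal.ofReal (exp (n * q.1 - exp q.1) * exp (n * q.2 - exp q.2)) *
        (ENNReal.ofReal (π ^ ((n : ℝ) / 2) * (sphereArea n / 2) * exp (-(n / 2 * (q.1 + q.2)))) *
          ∫⁻ v, f (v + log (exp q.1 + exp q.2) - q.1 - q.2, q.1, q.2)
            ∂logGammaMeasure (n / 2)) := by
        congr 1
        refine lintegral_congr fun q => ?_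
        simp only [lintegral_const_mul' _ _ ENNReal.ofReal_ne_top]
        rw [lintegral_exp_neg_exp_mul_norm_sq_sub hn q.1 q.2 (h := fun u => f (u, q.1, q.2))
          (hf.comp (by fun_prop))]
    _ = _ := by
        have hm2 : Measurable fun q : ℝ × ℝ =>
            ∫⁻ v, f (v + log (exp q.1 + exp q.2) - q.1 - q.2, q.1, q.2)
              ∂logGammaMeasure (n / 2) :=
          Measurable.lintegral_prod_right' (f := fun p : (ℝ × ℝ) × ℝ =>
            f (p.2 + log (exp p.1.1 + exp p.1.2) - p.1.1 - p.1.2, p.1.1, p.1.2))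
            (hf.comp (by fun_prop))
        rw [ENNReal.ofReal_mul (by positivity), mul_assoc, Measure.volume_eq_prod,
          lintegral_prod _ (by exact Measurable.aemeasurable (by fun_prop)),
          lintegral_logGammaMeasure _ (Measurable.lintegral_prod_right' hm2),
          ← lintegral_const_mul' (ENNReal.ofReal (π ^ ((n : ℝ) / 2) * (sphereArea n / 2))) _
            ENNReal.ofReal_ne_top]
        congr 1
        refine lintegral_congr fun t => ?_
        rw [lintegral_logGammaMeasure _ (by exact hm2.comp (by fun_prop)),
          ← lintegral_const_mul' _ _ ENNReal.ofReal_ne_top,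
          ← lintegral_const_mul' _ _ ENNReal.ofReal_ne_top]
        refine lintegral_congr fun t' => ?_
        simp only
        rw [← mul_assoc, ← mul_assoc, ← mul_assoc, ← ENNReal.ofReal_mul (by positivity),
          ← ENNReal.ofReal_mul (by positivity), ← ENNReal.ofReal_mul (by positivity)]
        congr 2
        have e1 : ∀ a b c e : ℝ, exp a * exp b * (c * exp e) = c * exp (a + b + e) :=
          fun a b c e => by rw [Real.exp_add, Real.exp_add]; ring
        have e2 : ∀ a b c : ℝ, c * exp a * exp b = c * exp (a + b) :=
          fun a b c => by rw [Real.exp_add]; ring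
        rw [e1, e2]
        congr 2
        ring

/-- With `t' = t + δ` and `δ` fixed, the map exchanges the first two coordinates up to translations
by `± log (1 + e^δ)`, hence preserves Lebesgue measure. -/
theorem lintegral_swap_log_exp_add {F : ℝ × ℝ × ℝ → ENNReal} (hF : Measurable F) :
    ∫⁻ p : ℝ × ℝ × ℝ, F (log (exp p.2.1 + exp p.2.2), p.2.1 + p.1 - log (exp p.2.1 + exp p.2.2),
      p.2.2 + p.1 - log (exp p.2.1 + exp p.2.2)) = ∫⁻ p, F p := by
  set l : ℝ → ℝ := fun δ => log (1 + exp δ) with hl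
  have hlm : Measurable l := by fun_prop
  have hL : ∀ t δ : ℝ, log (exp t + exp (t + δ)) = t + l δ := by
    intro t δ
    rw [Real.exp_add, show exp t + exp t * exp δ = exp t * (1 + exp δ) by ring,
      Real.log_mul (exp_pos _).ne' (by positivity), Real.log_exp]
  have key : ∀ G : ℝ × ℝ × ℝ → ENNReal, Measurable G →
      ∫⁻ p, G p = ∫⁻ δ, ∫⁻ s, ∫⁻ t, G (s, t, t + δ) := by
    intro G hG
    have e : ∀ s, ∫⁻ q : ℝ × ℝ, G (s, q) = ∫⁻ δ, ∫⁻ t, G (s, t, t + δ) := by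
      intro s
      rw [Measure.volume_eq_prod, lintegral_prod _ (by exact (hG.comp (by fun_prop)).aemeasurable)]
      refine Eq.trans ?_ (lintegral_lintegral_swap (f := fun t δ => G (s, t, t + δ))
        (by exact (hG.comp (by fun_prop)).aemeasurable))
      refine lintegral_congr fun t => ?_
      exact (lintegral_add_left_eq_self (μ := volume) (fun t' => G (s, t, t')) t).symm
    rw [Measure.volume_eq_prod, lintegral_prod _ hG.aemeasurable]
    simp only [e]
    exact lintegral_lintegral_swap (Measurable.lintegral_prod_right' (f := fun p : (ℝ × ℝ) × ℝ =>
      G (p.1.1, p.2, p.2 + p.1.2)) (hG.comp (by fun_prop))).aemeasurable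
  rw [key (fun p : ℝ × ℝ × ℝ => F (log (exp p.2.1 + exp p.2.2), p.2.1 + p.1 -
    log (exp p.2.1 + exp p.2.2), p.2.2 + p.1 - log (exp p.2.1 + exp p.2.2)))
    (hF.comp (by fun_prop)), key _ hF]
  refine lintegral_congr fun δ => ?_
  simp only [hL]
  rw [← lintegral_add_right_eq_self _ (l δ)]
  have e : ∀ s, ∫⁻ t, F (t + l δ, t + (s + l δ) - (t + l δ), t + δ + (s + l δ) - (t + l δ)) =
      ∫⁻ t, F (t, s, s + δ) := by
    intro s
    rw [← lintegral_add_right_eq_self (fun t => F (t, s, s + δ)) (l δ)]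
    refine lintegral_congr fun t => ?_
    congr 2
    congr 1 <;> ring
  simp only [e]
  exact lintegral_lintegral_swap (by exact (hF.comp (by fun_prop)).aemeasurable)

/-- The exponent `2ks - e^s + k(t + t') - e^t - e^{t'}` is invariant under this involution. In
probabilistic terms, the sum of two independent Gamma variables is a Gamma variable of doubled
parameter, independent of their ratio. -/
theorem lintegral_logGammaMeasure_swap (k : ℝ) {F : ℝ × ℝ × ℝ → ENNReal} (hF : Measurable F) :
    ∫⁻ p, F (log (exp p.2.1 + exp p.2.2), p.2.1 + p.1 - log (exp p.2.1 + exp p.2.2),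
        p.2.2 + p.1 - log (exp p.2.1 + exp p.2.2))
        ∂(logGammaMeasure (2 * k)).prod ((logGammaMeasure k).prod (logGammaMeasure k)) =
      ∫⁻ p, F p ∂(logGammaMeasure (2 * k)).prod ((logGammaMeasure k).prod (logGammaMeasure k)) := by
  rw [lintegral_logGammaMeasure_prod _ _ _ (by exact hF.comp (by fun_prop)),
    lintegral_logGammaMeasure_prod _ _ _ hF, ← lintegral_swap_log_exp_add
      (F := fun p => ENNReal.ofReal (exp ((2 * k * p.1 - exp p.1) + ((k * p.2.1 - exp p.2.1) +
        (k * p.2.2 - exp p.2.2)))) * F p) (by fun_prop)]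
  refine lintegral_congr fun p => ?_
  simp only
  have hL : exp (log (exp p.2.1 + exp p.2.2)) = exp p.2.1 + exp p.2.2 :=
    Real.exp_log (by positivity)
  congr 3
  rw [Real.exp_sub, Real.exp_sub, Real.exp_add, Real.exp_add, hL]
  field_simp
  ring

/-- The law of the logarithms of the sides of a random spherical triangle, mixed with three
independent Gamma variables. -/
theorem lintegral_triangle_eq {n : ℕ} (hn : 1 ≤ n) {f : ℝ × ℝ × ℝ × ℝ → ENNReal}
    (hf : Measurable f) :
    ∫⁻ p, f (log (dist p.1.2.1 p.1.2.2 ^ 2 / 4) - log (dist p.1.1 p.1.2.1 ^ 2 / 4) -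
          log (dist p.1.2.2 p.1.1 ^ 2 / 4), p.2.2.1 + log (dist p.1.1 p.1.2.1 ^ 2 / 4),
          p.2.2.2 + log (dist p.1.2.2 p.1.1 ^ 2 / 4), p.2.1)
        ∂(sphereMeasure₃ (n + 1)).prod
          ((logGammaMeasure n).prod ((logGammaMeasure n).prod (logGammaMeasure n))) =
      ENNReal.ofReal (sphereArea (n + 1) * (4 ^ n * (π ^ ((n : ℝ) / 2) * (sphereArea n / 2)))) *
      ∫⁻ q, f (q.1 - q.2.2.1 - q.2.2.2 - q.2.1 + 2 * log (exp q.2.2.1 + exp q.2.2.2),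
          q.2.2.1 + q.2.1 - log (exp q.2.2.1 + exp q.2.2.2),
          q.2.2.2 + q.2.1 - log (exp q.2.2.1 + exp q.2.2.2), log (exp q.2.2.1 + exp q.2.2.2))
        ∂(logGammaMeasure (n / 2)).prod ((logGammaMeasure n).prod
          ((logGammaMeasure (n / 2)).prod (logGammaMeasure (n / 2)))) := by
  have : SFinite (sphereMeasure₃ (n + 1)) := by unfold sphereMeasure₃; infer_instance
  have hA := sphereArea_pos (d := n + 1) (by omega)
  set C := ENNReal.ofReal (4 ^ n * (π ^ ((n : ℝ) / 2) * (sphereArea n / 2))) with hC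
  -- The third auxiliary variable `s` is inert here; it serves only for the exchange in `hv`.
  have hs : ∀ s, ∫⁻ p : USphere (n + 1) × USphere (n + 1) × USphere (n + 1), (∫⁻ τ, ∫⁻ τ',
      f (log (dist p.2.1 p.2.2 ^ 2 / 4) - log (dist p.1 p.2.1 ^ 2 / 4) -
          log (dist p.2.2 p.1 ^ 2 / 4), τ + log (dist p.1 p.2.1 ^ 2 / 4),
          τ' + log (dist p.2.2 p.1 ^ 2 / 4), s) ∂logGammaMeasure n ∂logGammaMeasure n)
          ∂sphereMeasure₃ (n + 1) = ENNReal.ofReal (sphereArea (n + 1)) *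
      (C * ∫⁻ t, ∫⁻ t', ∫⁻ v, f (v + log (exp t + exp t') - t - t', t, t', s)
          ∂logGammaMeasure (n / 2) ∂logGammaMeasure (n / 2) ∂logGammaMeasure (n / 2)) := by
    intro s
    rw [lintegral_sphereMeasure₃ hn (G := fun g => ∫⁻ τ, ∫⁻ τ',
      f (log (g.1 / 4) - log (g.2.1 / 4) - log (g.2.2 / 4), τ + log (g.2.1 / 4),
        τ' + log (g.2.2 / 4), s) ∂logGammaMeasure n ∂logGammaMeasure n) (by
      refine Measurable.lintegral_prod_right' (f := fun p : (ℝ × ℝ × ℝ) × ℝ => ∫⁻ τ',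
        f (log (p.1.1 / 4) - log (p.1.2.1 / 4) - log (p.1.2.2 / 4), p.2 + log (p.1.2.1 / 4),
          τ' + log (p.1.2.2 / 4), s) ∂logGammaMeasure n) ?_
      exact Measurable.lintegral_prod_right' (f := fun p : ((ℝ × ℝ × ℝ) × ℝ) × ℝ =>
        f (log (p.1.1.1 / 4) - log (p.1.1.2.1 / 4) - log (p.1.1.2.2 / 4),
          p.1.2 + log (p.1.1.2.1 / 4), p.2 + log (p.1.1.2.2 / 4), s)) (hf.comp (by fun_prop))),
      ← lintegral_stereo_logGammaMeasure hn (f := fun g => f (g.1, g.2.1, g.2.2, s))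
        (hf.comp (by fun_prop))]
    congr 1
    refine lintegral_congr fun x => lintegral_congr_ae ?_
    have : Nonempty (Fin n) := ⟨⟨0, hn⟩⟩
    have hne : ∀ᵐ y : EuclideanSpace ℝ (Fin n), y ≠ x := by simp [ae_iff]
    filter_upwards [hne] with y hy
    have hxy : 0 < ‖x - y‖ := norm_pos_iff.2 (sub_ne_zero.2 hy.symm)
    have hx : 0 < 1 + ‖x‖ ^ 2 := by positivity
    have hy : 0 < 1 + ‖y‖ ^ 2 := by positivity
    have e : ∀ X : ℝ, log (4 / X / 4) = -log X := by
      intro X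
      rw [← Real.log_inv]
      congr 1
      ring
    have e' : log (4 * ‖x - y‖ ^ 2 / ((1 + ‖x‖ ^ 2) * (1 + ‖y‖ ^ 2)) / 4) =
        log (‖x - y‖ ^ 2) - log (1 + ‖x‖ ^ 2) - log (1 + ‖y‖ ^ 2) := by
      rw [show 4 * ‖x - y‖ ^ 2 / ((1 + ‖x‖ ^ 2) * (1 + ‖y‖ ^ 2)) / 4 =
        ‖x - y‖ ^ 2 / (1 + ‖x‖ ^ 2) / (1 + ‖y‖ ^ 2) by field_simp,
        Real.log_div (by positivity) hy.ne', Real.log_div (by positivity) hx.ne']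
    simp only [e, e']
    congr 2
    refine lintegral_congr fun τ => lintegral_congr fun τ' => ?_
    congr 2
    ring
  calc _ = ∫⁻ s, ∫⁻ p : USphere (n + 1) × USphere (n + 1) × USphere (n + 1), (∫⁻ τ, ∫⁻ τ',
      f (log (dist p.2.1 p.2.2 ^ 2 / 4) - log (dist p.1 p.2.1 ^ 2 / 4) -
          log (dist p.2.2 p.1 ^ 2 / 4), τ + log (dist p.1 p.2.1 ^ 2 / 4),
          τ' + log (dist p.2.2 p.1 ^ 2 / 4), s) ∂logGammaMeasure n ∂logGammaMeasure n)
          ∂sphereMeasure₃ (n + 1) ∂logGammaMeasure n := by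
        refine Eq.trans ?_ (lintegral_lintegral_swap (Measurable.aemeasurable ?_)).symm
        · rw [lintegral_prod _ (by exact (hf.comp (by fun_prop)).aemeasurable)]
          refine lintegral_congr fun p => ?_
          rw [lintegral_prod _ (by exact (hf.comp (by fun_prop)).aemeasurable)]
          refine lintegral_congr fun s => ?_
          rw [lintegral_prod _ (by exact (hf.comp (by fun_prop)).aemeasurable)]
        · refine Measurable.lintegral_prod_right' (ν := logGammaMeasure n) (f := fun r :
            (ℝ × (USphere (n + 1) × USphere (n + 1) × USphere (n + 1))) × ℝ => ∫⁻ τ',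
              f (log (dist r.1.2.2.1 r.1.2.2.2 ^ 2 / 4) - log (dist r.1.2.1 r.1.2.2.1 ^ 2 / 4) -
                log (dist r.1.2.2.2 r.1.2.1 ^ 2 / 4), r.2 + log (dist r.1.2.1 r.1.2.2.1 ^ 2 / 4),
                τ' + log (dist r.1.2.2.2 r.1.2.1 ^ 2 / 4), r.1.1) ∂logGammaMeasure n) ?_
          exact Measurable.lintegral_prod_right' (f := fun r : ((ℝ × (USphere (n + 1) ×
            USphere (n + 1) × USphere (n + 1))) × ℝ) × ℝ =>
              f (log (dist r.1.1.2.2.1 r.1.1.2.2.2 ^ 2 / 4) -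
                log (dist r.1.1.2.1 r.1.1.2.2.1 ^ 2 / 4) -
                log (dist r.1.1.2.2.2 r.1.1.2.1 ^ 2 / 4),
                r.1.2 + log (dist r.1.1.2.1 r.1.1.2.2.1 ^ 2 / 4),
                r.2 + log (dist r.1.1.2.2.2 r.1.1.2.1 ^ 2 / 4), r.1.1.1)) (hf.comp (by fun_prop))
    _ = ENNReal.ofReal (sphereArea (n + 1)) * (C * ∫⁻ s, ∫⁻ t, ∫⁻ t', ∫⁻ v,
          f (v + log (exp t + exp t') - t - t', t, t', s)
          ∂logGammaMeasure (n / 2) ∂logGammaMeasure (n / 2) ∂logGammaMeasure (n / 2)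
          ∂logGammaMeasure n) := by
        simp only [hs]
        rw [lintegral_const_mul' _ _ ENNReal.ofReal_ne_top,
          lintegral_const_mul' _ _ ENNReal.ofReal_ne_top]
    _ = _ := by
        rw [ENNReal.ofReal_mul hA.le, mul_assoc]
        congr 2
        rw [lintegral_prod _ (by exact (hf.comp (by fun_prop)).aemeasurable)]
        -- The exchange puts `log (e^t + e^{t'})` into the fourth slot, where a suitable exponential
        -- test function cancels its other occurrences.
        have hv : ∀ v, ∫⁻ p : ℝ × ℝ × ℝ, f (v - p.2.1 - p.2.2 - p.1 +
              2 * log (exp p.2.1 + exp p.2.2), p.2.1 + p.1 - log (exp p.2.1 + exp p.2.2),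
              p.2.2 + p.1 - log (exp p.2.1 + exp p.2.2), log (exp p.2.1 + exp p.2.2))
            ∂(logGammaMeasure n).prod ((logGammaMeasure (n / 2)).prod (logGammaMeasure (n / 2))) =
            ∫⁻ p : ℝ × ℝ × ℝ, f (v + log (exp p.2.1 + exp p.2.2) - p.2.1 - p.2.2, p.2.1, p.2.2, p.1)
            ∂(logGammaMeasure n).prod
              ((logGammaMeasure (n / 2)).prod (logGammaMeasure (n / 2))) := by
          intro v
          have h2 := lintegral_logGammaMeasure_swap (n / 2) (F := fun p : ℝ × ℝ × ℝ =>
            f (v + log (exp p.2.1 + exp p.2.2) - p.2.1 - p.2.2, p.2.1, p.2.2, p.1))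
            (hf.comp (by fun_prop))
          rw [mul_div_cancel₀ _ (two_ne_zero' ℝ)] at h2
          rw [← h2]
          refine lintegral_congr fun p => ?_
          have hL : exp (log (exp p.2.1 + exp p.2.2)) = exp p.2.1 + exp p.2.2 :=
            Real.exp_log (by positivity)
          have hs' : log (exp (p.2.1 + p.1 - log (exp p.2.1 + exp p.2.2)) +
              exp (p.2.2 + p.1 - log (exp p.2.1 + exp p.2.2))) = p.1 := by
            rw [Real.exp_sub, Real.exp_sub, Real.exp_add, Real.exp_add, hL, ← add_div, ← add_mul,
              mul_div_cancel_left₀ _ (by positivity), Real.log_exp]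
          simp only [hs']
          congr 2
          ring
        simp only [hv]
        rw [lintegral_lintegral_swap (f := fun (v : ℝ) (p : ℝ × ℝ × ℝ) =>
            f (v + log (exp p.2.1 + exp p.2.2) - p.2.1 - p.2.2, p.2.1, p.2.2, p.1))
            (by exact (hf.comp (by fun_prop)).aemeasurable),
          lintegral_prod _ (by
            exact (Measurable.lintegral_prod_right' (f := fun r : (ℝ × ℝ × ℝ) × ℝ =>
              f (r.2 + log (exp r.1.2.1 + exp r.1.2.2) - r.1.2.1 - r.1.2.2, r.1.2.1, r.1.2.2, r.1.1))
              (hf.comp (by fun_prop))).aemeasurable)]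
        refine lintegral_congr fun s => ?_
        rw [lintegral_prod _ (by
            exact (Measurable.lintegral_prod_right' (f := fun r : (ℝ × ℝ) × ℝ =>
              f (r.2 + log (exp r.1.1 + exp r.1.2) - r.1.1 - r.1.2, r.1.1, r.1.2, s))
              (hf.comp (by fun_prop))).aemeasurable)]

instance (d : ℕ) : IsFiniteMeasure (sphereMeasure₃ d) := by
  unfold sphereMeasure₃
  infer_instance

theorem ae_ne_sphereMeasure {n : ℕ} (hn : 1 ≤ n) (p : USphere (n + 1)) :
    ∀ᵐ q ∂sphereMeasure (n + 1), q ≠ p := by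
  simpa [ae_iff] using sphereMeasure_singleton hn p

theorem ae_ne_sphereMeasure₃ {n : ℕ} (hn : 1 ≤ n) :
    ∀ᵐ p ∂sphereMeasure₃ (n + 1), p.1 ≠ p.2.1 ∧ p.2.1 ≠ p.2.2 ∧ p.2.2 ≠ p.1 := by
  have hm : MeasurableSet {p : USphere (n + 1) × USphere (n + 1) × USphere (n + 1) |
      p.1 ≠ p.2.1 ∧ p.2.1 ≠ p.2.2 ∧ p.2.2 ≠ p.1} :=
    (measurableSet_eq_fun measurable_fst (by fun_prop)).compl.inter
      ((measurableSet_eq_fun (by fun_prop) (by fun_prop)).compl.inter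
        (measurableSet_eq_fun (by fun_prop) (by fun_prop)).compl)
  rw [sphereMeasure₃, Measure.ae_prod_iff_ae_ae hm]
  refine Filter.Eventually.of_forall fun p => ?_
  have hm' : MeasurableSet {q : USphere (n + 1) × USphere (n + 1) |
      p ≠ q.1 ∧ q.1 ≠ q.2 ∧ q.2 ≠ p} := hm.preimage (by fun_prop : Measurable fun q => (p, q))
  rw [Measure.ae_prod_iff_ae_ae hm']
  filter_upwards [ae_ne_sphereMeasure hn p] with q hq
  filter_upwards [ae_ne_sphereMeasure hn p, ae_ne_sphereMeasure hn q] with r hr hr'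
  exact ⟨hq.symm, hr'.symm, hr⟩

/-- The hypotheses on the exponents are the convergence conditions of the four Gamma integrals on
the log-Gamma side of `lintegral_triangle_eq`. The three auxiliary variables on the sphere side give
the denominators. -/
theorem integrable_triangleFun {n : ℕ} (hn : 1 ≤ n) {a₁ a₂ a₃ : ℂ}
    (h₁ : -((n : ℝ) / 2) < a₁.re) (h₂ : -((n : ℝ) / 2) < a₂.re) (h₃ : -((n : ℝ) / 2) < a₃.re)
    (h : -(n : ℝ) < (a₁ + a₂ + a₃).re) :
    Integrable (triangleFun (n + 1) a₁ a₂ a₃) (sphereMeasure₃ (n + 1)) ∧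
    ∫ p, triangleFun (n + 1) a₁ a₂ a₃ p ∂sphereMeasure₃ (n + 1) =
      (2 : ℂ) ^ (2 * (n : ℂ) - 1 + 2 * (a₁ + a₂ + a₃)) * (π : ℂ) ^ ((n : ℂ) / 2) *
        (sphereArea n : ℂ) * (sphereArea (n + 1) : ℂ) *
      (Complex.Gamma (a₁ + a₂ + a₃ + n) * (Complex.Gamma (n / 2 + a₁) *
        Complex.Gamma (n / 2 + a₂) * Complex.Gamma (n / 2 + a₃)) /
        (Complex.Gamma (n + a₂ + a₃) * Complex.Gamma (n + a₃ + a₁) *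
          Complex.Gamma (n + a₁ + a₂))) := by
  have hA := sphereArea_pos (d := n + 1) (by omega)
  have hA' := sphereArea_pos hn
  have hre : ∀ (z : ℂ) (r : ℝ), (z + (r : ℂ)).re = z.re + r := fun z r => by simp
  set a := a₁ + a₂ + a₃ with ha
  have r₁ : 0 < (a₂ + a₃ + ((n : ℝ) : ℂ)).re := by rw [hre, Complex.add_re]; linarith
  have r₂ : 0 < (a₁ + a₃ + ((n : ℝ) : ℂ)).re := by rw [hre, Complex.add_re]; linarith
  have r₃ : 0 < (a₁ + a₂ + ((n : ℝ) : ℂ)).re := by rw [hre, Complex.add_re]; linarith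
  obtain ⟨i₁, e₁⟩ := integrable_cexp_logGammaMeasure (k := (n : ℝ) / 2) (b := a₁)
    (by rw [hre]; linarith)
  obtain ⟨iw, ew⟩ := integrable_cexp_logGammaMeasure_prod (k₁ := n) (k₂ := (n : ℝ) / 2)
    (k₃ := (n : ℝ) / 2) (b₁ := a) (b₂ := a₃) (b₃ := a₂) (by rw [hre]; linarith)
    (by rw [hre]; linarith) (by rw [hre]; linarith)
  obtain ⟨iτ, eτ⟩ := integrable_cexp_logGammaMeasure_prod r₁ r₂ r₃
  -- On the sphere side these coefficients leave `a₁`, `a₃`, `a₂` on the three logarithms of chords.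
  -- On the other side `log (e^t + e^{t'})` gets the coefficient `2a₁ - (a₁+a₃) - (a₁+a₂) + (a₂+a₃)
  -- = 0`, so the exponential factors.
  set g : ℝ × ℝ × ℝ × ℝ → ℂ := fun x => Complex.exp (a₁ * x.1 + (a₁ + a₃) * x.2.1 +
    (a₁ + a₂) * x.2.2.1 + (a₂ + a₃) * x.2.2.2) with hg
  have hgm : Measurable g := by fun_prop
  have hψ : ∀ q : ℝ × ℝ × ℝ × ℝ, Complex.exp (a₁ * q.1) * (Complex.exp (a * q.2.1) *
      (Complex.exp (a₃ * q.2.2.1) * Complex.exp (a₂ * q.2.2.2))) =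
      g (q.1 - q.2.2.1 - q.2.2.2 - q.2.1 + 2 * log (exp q.2.2.1 + exp q.2.2.2),
          q.2.2.1 + q.2.1 - log (exp q.2.2.1 + exp q.2.2.2),
          q.2.2.2 + q.2.1 - log (exp q.2.2.1 + exp q.2.2.2),
          log (exp q.2.2.1 + exp q.2.2.2)) := by
    intro q
    simp only [hg, ← Complex.exp_add]
    congr 1
    rw [ha]
    push_cast
    ring
  obtain ⟨iφ, eφ⟩ := integrable_comp_of_lintegral_eq (g := g) (by fun_prop) (by fun_prop)
    ENNReal.ofReal_ne_top (fun f hf => lintegral_triangle_eq hn hf) hgm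
    ((i₁.mul_prod iw).congr (Filter.Eventually.of_forall hψ))
  set F : USphere (n + 1) × USphere (n + 1) × USphere (n + 1) → ℂ := fun p =>
    Complex.exp (a₁ * (log (dist p.2.1 p.2.2 ^ 2 / 4) : ℝ) +
      a₃ * (log (dist p.1 p.2.1 ^ 2 / 4) : ℝ) + a₂ * (log (dist p.2.2 p.1 ^ 2 / 4) : ℝ)) with hF
  -- The factor `2^{2a}` undoes the division by 4 inside each logarithm.
  have hFs : (fun p => (2 : ℂ) ^ (2 * a) * F p) =ᵐ[sphereMeasure₃ (n + 1)]
      triangleFun (n + 1) a₁ a₂ a₃ := by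
    filter_upwards [ae_ne_sphereMeasure₃ hn] with p ⟨h₁₂, h₂₃, h₃₁⟩
    have d₁₂ := dist_pos.2 h₁₂
    have d₂₃ := dist_pos.2 h₂₃
    have d₃₁ := dist_pos.2 h₃₁
    have h4 : log 4 = 2 * log 2 := by
      rw [show (4 : ℝ) = 2 ^ 2 by norm_num, Real.log_pow]
      norm_num
    have h2 : (2 : ℂ) ^ (2 * a) = ((2 : ℝ) : ℂ) ^ (2 * a) := by norm_cast
    simp only [triangleFun]
    rw [ofReal_cpow_eq_cexp (pow_pos d₁₂ 2), ofReal_cpow_eq_cexp (pow_pos d₂₃ 2),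
      ofReal_cpow_eq_cexp (pow_pos d₃₁ 2), h2, ofReal_cpow_eq_cexp two_pos, hF]
    simp only [← Complex.exp_add]
    rw [Real.log_div (pow_pos d₁₂ 2).ne' four_ne_zero, Real.log_div (pow_pos d₂₃ 2).ne'
      four_ne_zero, Real.log_div (pow_pos d₃₁ 2).ne' four_ne_zero, h4]
    congr 1
    rw [ha]
    push_cast
    ring
  have hφ : ∀ p : (USphere (n + 1) × USphere (n + 1) × USphere (n + 1)) × ℝ × ℝ × ℝ,
      g (log (dist p.1.2.1 p.1.2.2 ^ 2 / 4) - log (dist p.1.1 p.1.2.1 ^ 2 / 4) -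
          log (dist p.1.2.2 p.1.1 ^ 2 / 4), p.2.2.1 + log (dist p.1.1 p.1.2.1 ^ 2 / 4),
          p.2.2.2 + log (dist p.1.2.2 p.1.1 ^ 2 / 4), p.2.1) = F p.1 *
        (Complex.exp ((a₂ + a₃) * p.2.1) * (Complex.exp ((a₁ + a₃) * p.2.2.1) *
          Complex.exp ((a₁ + a₂) * p.2.2.2))) := by
    intro p
    simp only [hg, hF, ← Complex.exp_add]
    congr 1
    push_cast
    ring
  simp only [hφ] at iφ eφ
  simp only [← hψ] at eφ
  have hint : Integrable F (sphereMeasure₃ (n + 1)) :=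
    integrable_left_of_mul_prod (measure_prod_ne_zero (logGammaMeasure_ne_zero n)
      (measure_prod_ne_zero (logGammaMeasure_ne_zero n) (logGammaMeasure_ne_zero n)))
      (g := fun x : ℝ × ℝ × ℝ => Complex.exp ((a₂ + a₃) * x.1) *
        (Complex.exp ((a₁ + a₃) * x.2.1) * Complex.exp ((a₁ + a₂) * x.2.2)))
      (fun _ => by simp [Complex.exp_ne_zero]) iφ
  refine ⟨(hint.const_mul _).congr hFs, ?_⟩
  rw [← integral_congr_ae hFs, integral_const_mul]
  rw [integral_prod_mul F (fun x : ℝ × ℝ × ℝ => Complex.exp ((a₂ + a₃) * x.1) *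
      (Complex.exp ((a₁ + a₃) * x.2.1) * Complex.exp ((a₁ + a₂) * x.2.2))), eτ,
    integral_prod_mul (fun x : ℝ => Complex.exp (a₁ * x)) (fun x : ℝ × ℝ × ℝ =>
      Complex.exp (a * x.1) * (Complex.exp (a₃ * x.2.1) * Complex.exp (a₂ * x.2.2))), ew, e₁,
    ENNReal.toReal_ofReal (by positivity)] at eφ
  have g₁ := Complex.Gamma_ne_zero_of_re_pos r₁
  have g₂ := Complex.Gamma_ne_zero_of_re_pos r₂
  have g₃ := Complex.Gamma_ne_zero_of_re_pos r₃
  have hc : ((sphereArea (n + 1) * (4 ^ n * (π ^ ((n : ℝ) / 2) * (sphereArea n / 2))) : ℝ) : ℂ) =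
      (sphereArea (n + 1) : ℂ) * ((2 : ℂ) ^ (2 * (n : ℂ) - 1) * ((π : ℂ) ^ ((n : ℂ) / 2) *
        sphereArea n)) := by
    have h2 : (2 : ℂ) ^ (2 * (n : ℂ) - 1) = 4 ^ n / 2 := by
      rw [Complex.cpow_sub _ _ two_ne_zero, Complex.cpow_one, Complex.cpow_mul_nat, ]
      norm_num
    rw [h2]
    push_cast [Complex.ofReal_cpow pi_pos.le]
    ring
  rw [hc] at eφ
  rw [Complex.cpow_add _ _ two_ne_zero]
  simp only [Complex.ofReal_div, Complex.ofReal_natCast, Complex.ofReal_ofNat] at eφ g₁ g₂ g₃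
  rw [show (n : ℂ) + a₂ + a₃ = a₂ + a₃ + n by ring, show (n : ℂ) + a₃ + a₁ = a₁ + a₃ + n by ring,
    show (n : ℂ) + a₁ + a₂ = a₁ + a₂ + n by ring, add_comm ((n : ℂ) / 2) a₁,
    add_comm ((n : ℂ) / 2) a₂, add_comm ((n : ℂ) / 2) a₃]
  generalize Complex.Gamma (a₂ + a₃ + n) = G₁ at *
  generalize Complex.Gamma (a₁ + a₃ + n) = G₂ at *
  generalize Complex.Gamma (a₁ + a₂ + n) = G₃ at *
  generalize Complex.Gamma (a + n) = G₀ at *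
  generalize Complex.Gamma (a₁ + n / 2) = H₁ at *
  generalize Complex.Gamma (a₂ + n / 2) = H₂ at *
  generalize Complex.Gamma (a₃ + n / 2) = H₃ at *
  generalize (π : ℂ) ^ ((n : ℂ) / 2) = P at *
  generalize (2 : ℂ) ^ (2 * (n : ℂ) - 1) = Q at *
  generalize (2 : ℂ) ^ (2 * a) = R at *
  generalize ∫ p, F p ∂sphereMeasure₃ (n + 1) = I at *
  field_simp
  linear_combination R * eφ

theorem triangularJ_eq {n : ℕ} (hn : 1 ≤ n) {a₁ a₂ a₃ : ℂ}
    (h₁ : -((n : ℝ) / 2) < a₁.re) (h₂ : -((n : ℝ) / 2) < a₂.re) (h₃ : -((n : ℝ) / 2) < a₃.re)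
    (h : -(n : ℝ) < (a₁ + a₂ + a₃).re) :
    triangularJ (n + 1) a₁ a₂ a₃ =
      (2 : ℂ) ^ (2 * (n : ℂ) - 1 + 2 * (a₁ + a₂ + a₃)) * (π : ℂ) ^ ((n : ℂ) / 2) *
        (sphereArea n : ℂ) / (sphereArea (n + 1) : ℂ) ^ 2 *
      (Complex.Gamma (a₁ + a₂ + a₃ + n) * (Complex.Gamma (n / 2 + a₁) *
        Complex.Gamma (n / 2 + a₂) * Complex.Gamma (n / 2 + a₃)) /
        (Complex.Gamma (n + a₂ + a₃) * Complex.Gamma (n + a₃ + a₁) *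
          Complex.Gamma (n + a₁ + a₂))) := by
  have hA := sphereArea_pos (d := n + 1) (by omega)
  have hu : (sphereMeasure₃ (n + 1)).real Set.univ = sphereArea (n + 1) ^ 3 := by
    rw [sphereMeasure₃, ← Set.univ_prod_univ, measureReal_prod_prod, ← Set.univ_prod_univ,
      measureReal_prod_prod, measureReal_def, sphereMeasure_univ (by omega),
      ENNReal.toReal_ofReal hA.le]
    ring
  have hA' : (sphereArea (n + 1) : ℂ) ≠ 0 := by exact_mod_cast hA.ne'
  rw [triangularJ, average_eq, hu, (integrable_triangleFun hn h₁ h₂ h₃ h).2, Complex.real_smul]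
  push_cast
  field_simp

/-! ### Moments of a coordinate on the sphere. -/

theorem lintegral_pow_two_mul_mul_exp_neg_sq (j : ℕ) :
    ∫⁻ t : ℝ, ENNReal.ofReal (t ^ (2 * j) * exp (-t ^ 2)) =
      ENNReal.ofReal (Real.Gamma (j + 1 / 2)) := by
  have h := Real.Gamma_pos_of_pos (s := (j : ℝ) + 1 / 2) (by positivity)
  have h1 := integral_rpow_mul_exp_neg_rpow (p := 2) (q := (2 * j : ℕ)) two_pos
    (by have : (0 : ℝ) ≤ (2 * j : ℕ) := by positivity
        linarith)
  have h2 : (((2 * j : ℕ) : ℝ) + 1) / 2 = j + 1 / 2 := by push_cast; ring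
  simp only [rpow_natCast, rpow_ofNat, h2] at h1
  have h3 : ∫ t : ℝ, t ^ (2 * j) * exp (-t ^ 2) = Real.Gamma (j + 1 / 2) := by
    have := integral_comp_abs (f := fun t => t ^ (2 * j) * exp (-t ^ 2))
    simp only [Even.pow_abs (even_two_mul j), sq_abs] at this
    rw [this, h1]
    ring
  rw [← h3, ofReal_integral_eq_lintegral_ofReal (Integrable.of_integral_ne_zero (by rw [h3]; exact h.ne'))]
  exact Filter.Eventually.of_forall fun t =>
    mul_nonneg (Even.pow_nonneg (even_two_mul j) t) (exp_pos _).le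

theorem lintegral_Ioi_pow_mul_exp_neg_sq (k : ℕ) :
    ∫⁻ r in Set.Ioi (0 : ℝ), ENNReal.ofReal (r ^ k * exp (-r ^ 2)) =
      ENNReal.ofReal (Real.Gamma (((k : ℝ) + 1) / 2) / 2) := by
  have h := Real.Gamma_pos_of_pos (s := ((k : ℝ) + 1) / 2) (by positivity)
  have h1 := integral_rpow_mul_exp_neg_rpow (p := 2) (q := (k : ℕ)) two_pos
    (by have : (0 : ℝ) ≤ (k : ℕ) := by positivity
        linarith)
  simp only [rpow_natCast, rpow_ofNat] at h1
  rw [show Real.Gamma (((k : ℝ) + 1) / 2) / 2 = 1 / 2 * Real.Gamma (((k : ℝ) + 1) / 2) by ring, ← h1,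
    ofReal_integral_eq_lintegral_ofReal (Integrable.of_integral_ne_zero (by rw [h1]; positivity))]
  filter_upwards [ae_restrict_mem measurableSet_Ioi] with t (ht : 0 < t)
  positivity

theorem exists_linearIsometryEquiv_apply_eq {E : Type*} [NormedAddCommGroup E]
    [InnerProductSpace ℝ E] {p q : E} (h : ‖p‖ = ‖q‖) : ∃ R : E ≃ₗᵢ[ℝ] E, R p = q :=
  ⟨(ℝ ∙ (p - q))ᗮ.reflection, Submodule.reflection_sub h⟩

/-- Integrate `⟨x, e⟩^{2j} exp (-‖x‖²)` over `ℝ^{n+1}` in two ways: in polar coordinates, and by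
splitting off the coordinate along `e`. -/
theorem lintegral_sphereMeasure_inner_pow {n : ℕ} (j : ℕ) {e : EuclideanSpace ℝ (Fin (n + 1))}
    (he : ‖e‖ = 1) :
    ∫⁻ p, ENNReal.ofReal (inner ℝ (p : EuclideanSpace ℝ (Fin (n + 1))) e ^ (2 * j))
        ∂sphereMeasure (n + 1) =
      ENNReal.ofReal (2 * π ^ ((n : ℝ) / 2) * Real.Gamma (j + 1 / 2) /
        Real.Gamma (j + ((n : ℝ) + 1) / 2)) := by
  obtain ⟨R, hR⟩ := exists_linearIsometryEquiv_apply_eq (p := southPole n) (q := e)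
    (by rw [he, norm_southPole])
  rw [← lintegral_sphereMeasure_isometry (by omega) R
    (f := fun p => ENNReal.ofReal (inner ℝ p e ^ (2 * j))) (by fun_prop)]
  simp only [← hR, R.inner_map_map]
  have hG := Real.Gamma_pos_of_pos (s := (j : ℝ) + ((n : ℝ) + 1) / 2) (by positivity)
  have hG' := Real.Gamma_pos_of_pos (s := (j : ℝ) + 1 / 2) (by positivity)
  have key := lintegral_direction_mul_norm (volume : Measure (EuclideanSpace ℝ (Fin (n + 1))))
    (f := fun p => ENNReal.ofReal (inner ℝ p (southPole n) ^ (2 * j))) (by fun_prop)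
    (g := fun r => ENNReal.ofReal (r ^ (2 * j) * exp (-r ^ 2))) (by fun_prop)
  have h1 : ∫⁻ r in Set.Ioi (0 : ℝ), ENNReal.ofReal (r ^ (Module.finrank ℝ (EuclideanSpace ℝ (Fin (n + 1))) - 1)) *
      ENNReal.ofReal (r ^ (2 * j) * exp (-r ^ 2)) =
      ENNReal.ofReal (Real.Gamma (j + ((n : ℝ) + 1) / 2) / 2) := by
    have := lintegral_Ioi_pow_mul_exp_neg_sq (n + 2 * j)
    rw [show (((n + 2 * j : ℕ) : ℝ) + 1) / 2 = j + ((n : ℝ) + 1) / 2 by push_cast; ring] at this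
    rw [← this]
    refine setLIntegral_congr_fun measurableSet_Ioi fun r (hr : 0 < r) => ?_
    simp only [finrank_euclideanSpace, Fintype.card_fin, Nat.add_sub_cancel]
    rw [← ENNReal.ofReal_mul (by positivity), pow_add, mul_assoc]
  have h2 : ∫⁻ x : EuclideanSpace ℝ (Fin (n + 1)),
      ENNReal.ofReal (inner ℝ (‖x‖⁻¹ • x) (southPole n) ^ (2 * j)) *
        ENNReal.ofReal (‖x‖ ^ (2 * j) * exp (-‖x‖ ^ 2)) =
      ENNReal.ofReal (π ^ ((n : ℝ) / 2) * Real.Gamma (j + 1 / 2)) := by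
    have h3 : ∀ x : EuclideanSpace ℝ (Fin (n + 1)),
        ENNReal.ofReal (inner ℝ (‖x‖⁻¹ • x) (southPole n) ^ (2 * j)) *
          ENNReal.ofReal (‖x‖ ^ (2 * j) * exp (-‖x‖ ^ 2)) =
        ENNReal.ofReal (inner ℝ x (southPole n) ^ (2 * j) * exp (-‖x‖ ^ 2)) := by
      intro x
      rw [← ENNReal.ofReal_mul (Even.pow_nonneg (even_two_mul j) _), ← mul_assoc, ← mul_pow,
        real_inner_smul_left]
      rcases eq_or_ne x 0 with rfl | hx
      · simp
      · rw [mul_right_comm, inv_mul_cancel₀ (norm_ne_zero_iff.2 hx), one_mul]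
    simp only [h3]
    rw [lintegral_euclideanCons (by fun_prop)]
    have h4 : ∀ (x : EuclideanSpace ℝ (Fin n)), ∫⁻ t : ℝ,
        ENNReal.ofReal (inner ℝ (euclideanCons t x) (southPole n) ^ (2 * j) *
          exp (-‖euclideanCons t x‖ ^ 2)) =
        ENNReal.ofReal (exp (-1 * ‖x‖ ^ 2 + inner ℝ (0 : EuclideanSpace ℝ (Fin n)) x)) *
          ENNReal.ofReal (Real.Gamma (j + 1 / 2)) := by
      intro x
      rw [← lintegral_pow_two_mul_mul_exp_neg_sq, ← lintegral_const_mul _ (by fun_prop)]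
      refine lintegral_congr fun t => ?_
      rw [← ENNReal.ofReal_mul (exp_pos _).le, norm_euclideanCons_sq, southPole,
        inner_euclideanCons, inner_zero_right, inner_zero_left, neg_add, exp_add]
      congr 1
      rw [add_zero, add_zero, mul_neg_one, Even.neg_pow (even_two_mul j), neg_one_mul]
      ring
    simp only [h4]
    rw [lintegral_mul_const _ (by fun_prop), lintegral_exp_neg_mul_norm_sq_add_inner one_pos,
      ← ENNReal.ofReal_mul (by positivity)]
    simp
  rw [h1, h2] at key
  have hne : ENNReal.ofReal (Real.Gamma (j + ((n : ℝ) + 1) / 2) / 2) ≠ 0 := by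
    simpa using by positivity
  refine (ENNReal.mul_left_inj hne ENNReal.ofReal_ne_top).1 (key.symm.trans ?_)
  rw [← ENNReal.ofReal_mul (by positivity)]
  congr 1
  field_simp

theorem integral_sphereMeasure_inner_pow_even {n : ℕ} (j : ℕ)
    {e : EuclideanSpace ℝ (Fin (n + 1))} (he : ‖e‖ = 1) :
    ∫ p, inner ℝ (p : EuclideanSpace ℝ (Fin (n + 1))) e ^ (2 * j) ∂sphereMeasure (n + 1) =
      2 * π ^ ((n : ℝ) / 2) * Real.Gamma (j + 1 / 2) / Real.Gamma (j + ((n : ℝ) + 1) / 2) := by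
  have hG := Real.Gamma_pos_of_pos (s := (j : ℝ) + ((n : ℝ) + 1) / 2) (by positivity)
  have hG' := Real.Gamma_pos_of_pos (s := (j : ℝ) + 1 / 2) (by positivity)
  rw [integral_eq_lintegral_of_nonneg_ae
    (Filter.Eventually.of_forall fun p => Even.pow_nonneg (even_two_mul j) _)
    (by fun_prop), lintegral_sphereMeasure_inner_pow j he, ENNReal.toReal_ofReal (by positivity)]

theorem measurePreserving_neg_sphereMeasure {d : ℕ} (hd : 1 ≤ d) :
    MeasurePreserving (fun p : USphere d => -p) (sphereMeasure d) (sphereMeasure d) := by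
  have hm : Measurable fun p : USphere d => -p := continuous_neg.measurable
  refine ⟨hm, Measure.ext fun s hs => ?_⟩
  rw [Measure.map_apply hm hs]
  have he := MeasurableEmbedding.subtype_coe
    (Metric.isClosed_sphere (x := (0 : EuclideanSpace ℝ (Fin d))) (ε := 1)).measurableSet
  have hs' := he.measurableSet_image.2 hs
  have h := lintegral_sphereMeasure_isometry hd (LinearIsometryEquiv.neg ℝ)
    (f := (Subtype.val '' s).indicator (1 : EuclideanSpace ℝ (Fin d) → ENNReal)) (measurable_one.indicator hs')
  have h1 : ∀ p : USphere d, (Subtype.val '' s).indicator (1 : EuclideanSpace ℝ (Fin d) → ENNReal)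
      (p : EuclideanSpace ℝ (Fin d)) = s.indicator 1 p := fun p => by
    by_cases hps : p ∈ s
    · rw [Set.indicator_of_mem (Set.mem_image_of_mem _ hps), Set.indicator_of_mem hps]
      rfl
    · rw [Set.indicator_of_notMem hps, Set.indicator_of_notMem]
      rintro ⟨q, hq, hqp⟩
      exact hps (Subtype.ext hqp ▸ hq)
  have h2 : ∀ p : USphere d, (Subtype.val '' s).indicator (1 : EuclideanSpace ℝ (Fin d) → ENNReal)
      ((LinearIsometryEquiv.neg ℝ : EuclideanSpace ℝ (Fin d) ≃ₗᵢ[ℝ] _) p) =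
      ((fun p : USphere d => -p) ⁻¹' s).indicator 1 p := fun p => by
    rw [show ((LinearIsometryEquiv.neg ℝ : EuclideanSpace ℝ (Fin d) ≃ₗᵢ[ℝ] _) p) = ((-p : USphere d) :
      EuclideanSpace ℝ (Fin d)) by simp, h1]
    rfl
  simp only [h1, h2] at h
  rwa [lintegral_indicator_one hs, lintegral_indicator_one (hm hs)] at h

theorem integral_sphereMeasure_inner_pow_odd {d : ℕ} (hd : 1 ≤ d) (j : ℕ)
    (e : EuclideanSpace ℝ (Fin d)) :
    ∫ p, inner ℝ (p : EuclideanSpace ℝ (Fin d)) e ^ (2 * j + 1) ∂sphereMeasure d = 0 := by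
  have h := (measurePreserving_neg_sphereMeasure hd).integral_comp
    (Homeomorph.neg (USphere d)).measurableEmbedding
    (fun p : USphere d => inner ℝ (p : EuclideanSpace ℝ (Fin d)) e ^ (2 * j + 1))
  have hc : ∀ p : USphere d, ((-p : USphere d) : EuclideanSpace ℝ (Fin d)) = -p := fun p => rfl
  simp only [hc, inner_neg_left, Odd.neg_pow (odd_two_mul_add_one j), integral_neg] at h
  linarith

/-! ### Pochhammer symbols and a quadratic transformation of Gauss' function. -/

theorem ascPochhammer_eval_eq_factorial_mul_multichoose (a : ℂ) (k : ℕ) :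
    (ascPochhammer ℂ k).eval a = k.factorial * Ring.multichoose a k := by
  rw [← nsmul_eq_mul, Ring.factorial_nsmul_multichoose_eq_ascPochhammer,
    Polynomial.ascPochhammer_smeval_eq_eval]

theorem hasSum_one_sub_cpow (a : ℂ) {x : ℂ} (hx : ‖x‖ < 1) :
    HasSum (fun k : ℕ => (ascPochhammer ℂ k).eval a / k.factorial * x ^ k) ((1 - x) ^ (-a)) := by
  have h := (Complex.one_div_one_sub_cpow_hasFPowerSeriesOnBall_zero a).hasSum (y := x)
    (by rw [← ENNReal.ofReal_one, Metric.eball_ofReal]; simpa using hx)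
  simp only [zero_add, one_div, ← Complex.cpow_neg] at h
  refine h.congr_fun fun k => ?_
  simp only [FormalMultilinearSeries.ofScalars_apply_eq, smul_eq_mul]
  rw [ascPochhammer_eval_eq_factorial_mul_multichoose, mul_div_cancel_left₀ _
    (by exact_mod_cast k.factorial_ne_zero), Ring.multichoose_eq]

/-- Chu–Vandermonde for rising factorials, from the falling form at `-a`, `-b`; the signs agree on
an antidiagonal. -/
theorem sum_antidiagonal_multichoose_mul (a b : ℂ) (n : ℕ) :
    ∑ p ∈ Finset.HasAntidiagonal.antidiagonal n, Ring.multichoose a p.1 * Ring.multichoose b p.2 =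
      Ring.multichoose (a + b) n := by
  have h := Ring.add_choose_eq (r := -a) (s := -b) n (Commute.all _ _)
  rw [← neg_add, Ring.choose_neg'] at h
  have h1 : ∀ p ∈ Finset.HasAntidiagonal.antidiagonal n, Ring.choose (-a) p.1 * Ring.choose (-b) p.2 =
      Int.negOnePow n • (Ring.multichoose a p.1 * Ring.multichoose b p.2) := by
    intro p hp
    rw [Ring.choose_neg', Ring.choose_neg', smul_mul_smul_comm, ← Int.negOnePow_add]
    rw [← Finset.HasAntidiagonal.mem_antidiagonal.1 hp]
    push_cast
    rfl
  rw [Finset.sum_congr rfl h1, ← Finset.smul_sum] at h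
  exact ((MulAction.injective _) h).symm

theorem ascPochhammer_eval_add (a : ℂ) (n m : ℕ) :
    (ascPochhammer ℂ (n + m)).eval a =
      (ascPochhammer ℂ n).eval a * (ascPochhammer ℂ m).eval (a + n) := by
  rw [← ascPochhammer_mul, Polynomial.eval_mul, Polynomial.eval_comp]
  simp

theorem ascPochhammer_eval_two_mul (a : ℂ) (k : ℕ) :
    (ascPochhammer ℂ (2 * k)).eval a =
      4 ^ k * ((ascPochhammer ℂ k).eval (a / 2) * (ascPochhammer ℂ k).eval ((a + 1) / 2)) := by
  induction k with
  | zero => simp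
  | succ k ih =>
    rw [show 2 * (k + 1) = 2 * k + 1 + 1 by ring, ascPochhammer_succ_eval, ascPochhammer_succ_eval,
      ascPochhammer_succ_eval, ascPochhammer_succ_eval, ih]
    push_cast
    ring

theorem neg_one_pow_mul_ascPochhammer_eval (a : ℂ) (k : ℕ) :
    (-1) ^ k * (ascPochhammer ℂ k).eval a = (ascPochhammer ℂ k).eval (1 - a - k) := by
  have h := ascPochhammer_eval_neg_eq_descPochhammer ℂ (-a) k
  rw [descPochhammer_eval_eq_ascPochhammer, neg_neg] at h
  rw [h, ← mul_assoc, ← mul_pow, neg_one_mul, neg_neg, one_pow, one_mul]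
  congr 1
  ring

/-- The coefficient identity behind the quadratic transformation. For `n = k + m`, `(a)_{2k+m} =
(a)_n (a+n)_k` and `(-1)^m / Γ(c+k) = (1-c-n)_m / Γ(c+n)`, so the sum is Chu–Vandermonde for `a + n`
and `1 - c - n`. -/
theorem sum_antidiagonal_quadratic {a c : ℂ} (hc : ∀ k : ℕ, c ≠ -k) (n : ℕ) :
    ∑ p ∈ Finset.HasAntidiagonal.antidiagonal n, (ascPochhammer ℂ (2 * p.1 + p.2)).eval a * (-1) ^ p.2 /
        (p.1.factorial * Complex.Gamma (c + p.1) * p.2.factorial) =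
      (ascPochhammer ℂ n).eval a * (ascPochhammer ℂ n).eval (a - c + 1) /
        (n.factorial * Complex.Gamma (c + n)) := by
  have hG : ∀ k : ℕ, Complex.Gamma (c + k) ≠ 0 := fun k => Complex.Gamma_ne_zero fun m h =>
    hc (m + k) (by push_cast; linear_combination h)
  have h := sum_antidiagonal_multichoose_mul (a + n) (1 - c - n) n
  rw [ascPochhammer_eval_eq_factorial_mul_multichoose (a - c + 1),
    show a - c + 1 = a + n + (1 - c - n) by ring, ← h, Finset.mul_sum, Finset.mul_sum,
    Finset.sum_div]
  refine Finset.sum_congr rfl fun p hp => ?_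
  have hp' := Finset.HasAntidiagonal.mem_antidiagonal.1 hp
  have hn : (n : ℂ) = p.1 + p.2 := by rw [← hp']; push_cast; ring
  have hf : ∀ k : ℕ, (k.factorial : ℂ) ≠ 0 := fun k => by exact_mod_cast k.factorial_ne_zero
  have hG2 : Complex.Gamma (c + n) = Complex.Gamma (c + p.1) * (ascPochhammer ℂ p.2).eval (c + p.1) := by
    rw [← Complex.Gamma_add_nat_div_Gamma_eq (c + p.1) (fun k h => hc (k + p.1) (by push_cast; linear_combination h)),
      mul_div_cancel₀ _ (hG _), hn, add_assoc]
  have hP : (ascPochhammer ℂ p.2).eval (c + p.1) ≠ 0 := fun h0 => hG n (by rw [hG2, h0, mul_zero])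
  have h3 := neg_one_pow_mul_ascPochhammer_eval (c + p.1) p.2
  rw [show 1 - (c + p.1) - p.2 = 1 - c - n by rw [hn]; ring, ascPochhammer_eval_eq_factorial_mul_multichoose (1 - c - n)] at h3
  rw [hG2, show 2 * p.1 + p.2 = n + p.1 by omega, ascPochhammer_eval_add,
    ascPochhammer_eval_eq_factorial_mul_multichoose (a + n)]
  have := hf n
  have := hf p.1
  have := hf p.2
  have := hG p.1
  field_simp
  linear_combination ((ascPochhammer ℂ n).eval a * Ring.multichoose (a + n) p.1) * h3

theorem hasFPowerSeriesOnBall_regularizedGaussHGFun (a b c : ℂ) :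
    HasFPowerSeriesOnBall (Complex.regularizedGaussHGFun a b c)
      (Complex.regularizedGaussHGFunSeries a b c) 0 1 :=
  ((Complex.regularizedGaussHGFunSeries a b c).hasFPowerSeriesOnBall
    (zero_lt_one.trans_le (Complex.radius_regularizedGaussHGFunSeries_ge_one a b c))).mono
      zero_lt_one (Complex.radius_regularizedGaussHGFunSeries_ge_one a b c)

theorem hasSum_regularizedGaussHGFun (a b c : ℂ) {z : ℂ} (hz : ‖z‖ < 1) :
    HasSum (fun k : ℕ => (ascPochhammer ℂ k).eval a * (ascPochhammer ℂ k).eval b /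
      (k.factorial * Complex.Gamma (c + k)) * z ^ k) (Complex.regularizedGaussHGFun a b c z) := by
  have h := (hasFPowerSeriesOnBall_regularizedGaussHGFun a b c).hasSum (y := z)
    (by rw [← ENNReal.ofReal_one, Metric.eball_ofReal]; simpa using hz)
  rw [zero_add] at h
  refine h.congr_fun fun k => ?_
  rw [FormalMultilinearSeries.apply_eq_pow_smul_coeff, Complex.coeff_regularizedGaussHGFunSeries,
    smul_eq_mul, mul_comm]

theorem analyticAt_regularizedGaussHGFun (a b c : ℂ) {z : ℂ} (hz : ‖z‖ < 1) :
    AnalyticAt ℂ (Complex.regularizedGaussHGFun a b c) z :=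
  (hasFPowerSeriesOnBall_regularizedGaussHGFun a b c).analyticAt_of_mem
    (by rw [← ENNReal.ofReal_one, Metric.eball_ofReal]; simpa using hz)

/-- The terms of the binomial series, convergent at `1/2`, are bounded. -/
theorem exists_norm_ascPochhammer_eval_le (a : ℂ) :
    ∃ K : ℝ, 0 ≤ K ∧ ∀ k : ℕ, ‖(ascPochhammer ℂ k).eval a‖ ≤ K * (k.factorial * 2 ^ k) := by
  have h := (hasSum_one_sub_cpow a (x := 1 / 2) (by norm_num)).summable.norm.tendsto_atTop_zero
  obtain ⟨K, hK⟩ := h.bddAbove_range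
  refine ⟨K, (norm_nonneg _).trans (hK ⟨0, rfl⟩), fun k => ?_⟩
  have h1 := hK ⟨k, rfl⟩
  have hf : (0 : ℝ) < k.factorial := by exact_mod_cast k.factorial_pos
  simp only [norm_mul, norm_div, norm_pow, Complex.norm_natCast] at h1
  norm_num at h1
  rw [div_mul_eq_mul_div, div_le_iff₀ hf] at h1
  calc ‖(ascPochhammer ℂ k).eval a‖
      = ‖(ascPochhammer ℂ k).eval a‖ * (1 / 2) ^ k * 2 ^ k := by
        rw [mul_assoc, ← mul_pow]; norm_num
    _ ≤ K * k.factorial * 2 ^ k := by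
        gcongr
    _ = _ := by ring

/-- Likewise for the regularized Gauss series with parameters `1, 1; c` at `1/2`. -/
theorem exists_factorial_div_norm_Gamma_le (c : ℂ) :
    ∃ K : ℝ, 0 ≤ K ∧ ∀ k : ℕ, k.factorial / ‖Complex.Gamma (c + k)‖ ≤ K * 2 ^ k := by
  have h := (hasSum_regularizedGaussHGFun 1 1 c (z := 1 / 2) (by norm_num)).summable.norm.tendsto_atTop_zero
  obtain ⟨K, hK⟩ := h.bddAbove_range
  refine ⟨K, (norm_nonneg _).trans (hK ⟨0, rfl⟩), fun k => ?_⟩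
  have h1 := hK ⟨k, rfl⟩
  have hf : (0 : ℝ) < k.factorial := by exact_mod_cast k.factorial_pos
  simp only [ascPochhammer_eval_one, norm_mul, norm_div, norm_pow, Complex.norm_natCast] at h1
  rw [mul_div_mul_left _ _ hf.ne'] at h1
  calc (k.factorial : ℝ) / ‖Complex.Gamma (c + k)‖
      = k.factorial / ‖Complex.Gamma (c + k)‖ * (1 / 2) ^ k * 2 ^ k := by
        rw [mul_assoc, ← mul_pow]; norm_num
    _ ≤ _ := by
        gcongr
        simpa using h1

theorem factorial_two_mul_add_le (k m : ℕ) :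
    (2 * k + m).factorial ≤ 16 ^ k * 2 ^ m * (k.factorial * k.factorial * m.factorial) := by
  have h1 := Nat.add_choose_mul_factorial_mul_factorial (2 * k) m
  have h2 := Nat.add_choose_mul_factorial_mul_factorial k k
  rw [← two_mul] at h2
  have h3 := Nat.choose_le_two_pow (2 * k + m) m
  have h4 := Nat.choose_le_two_pow (2 * k) k
  rw [← h1, ← h2]
  calc _ ≤ 2 ^ (2 * k + m) * (2 ^ (2 * k) * k.factorial * k.factorial) * m.factorial := by gcongr
    _ = _ := by
      rw [pow_add, pow_mul, show (2 : ℕ) ^ 2 = 4 by norm_num, show (16 : ℕ) = 4 * 4 by norm_num, mul_pow]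
      ring

/-- The crude bounds give geometric ratios `128‖z‖` and `4‖z‖`, both below 1 here. The size of the
disc is irrelevant, as only the germ at 0 is used. -/
theorem summable_quadratic (a c : ℂ) {z : ℂ} (hz : ‖z‖ < 1 / 200) :
    Summable fun p : ℕ × ℕ => (ascPochhammer ℂ (2 * p.1 + p.2)).eval a * (-1) ^ p.2 /
        (p.1.factorial * Complex.Gamma (c + p.1) * p.2.factorial) * z ^ (p.1 + p.2) := by
  obtain ⟨K, hK0, hK⟩ := exists_norm_ascPochhammer_eval_le a
  obtain ⟨K', hK0', hK'⟩ := exists_factorial_div_norm_Gamma_le c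
  have h1 : Summable fun k : ℕ => (128 * ‖z‖) ^ k :=
    summable_geometric_of_lt_one (by positivity) (by linarith)
  have h2 : Summable fun k : ℕ => (4 * ‖z‖) ^ k :=
    summable_geometric_of_lt_one (by positivity) (by linarith)
  have h3 := (h1.mul_of_nonneg h2 (fun k => by positivity) (fun k => by positivity)).mul_left (K * K')
  refine Summable.of_norm_bounded h3 fun p => ?_
  obtain ⟨k, m⟩ := p
  have hfk : (0 : ℝ) < k.factorial := by exact_mod_cast k.factorial_pos
  have hfm : (0 : ℝ) < m.factorial := by exact_mod_cast m.factorial_pos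
  have h4 : ((2 * k + m).factorial : ℝ) ≤ 16 ^ k * 2 ^ m * (k.factorial * k.factorial * m.factorial) := by
    exact_mod_cast factorial_two_mul_add_le k m
  simp only [norm_mul, norm_div, norm_pow, Complex.norm_natCast, norm_neg, norm_one, one_pow, mul_one]
  calc ‖(ascPochhammer ℂ (2 * k + m)).eval a‖ /
        (k.factorial * ‖Complex.Gamma (c + k)‖ * m.factorial) * ‖z‖ ^ (k + m)
      ≤ (K * ((16 ^ k * 2 ^ m * (k.factorial * k.factorial * m.factorial)) * 2 ^ (2 * k + m))) /
        (k.factorial * ‖Complex.Gamma (c + k)‖ * m.factorial) * ‖z‖ ^ (k + m) := by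
        gcongr
        exact (hK _).trans (by gcongr)
    _ = K * (k.factorial / ‖Complex.Gamma (c + k)‖) * (16 ^ k * 2 ^ m * 2 ^ (2 * k + m) * ‖z‖ ^ (k + m)) := by
        field_simp
    _ ≤ K * (K' * 2 ^ k) * (16 ^ k * 2 ^ m * 2 ^ (2 * k + m) * ‖z‖ ^ (k + m)) := by
        gcongr
        exact hK' k
    _ = _ := by
        rw [pow_add, pow_add, pow_mul, mul_pow, mul_pow, show (128 : ℝ) = 2 * 16 * 2 ^ 2 by norm_num,
          show (4 : ℝ) = 2 * 2 by norm_num, mul_pow, mul_pow, mul_pow]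
        ring

/-- One absolutely convergent double series is summed twice. Antidiagonals give the left side. For
fixed `k` the sum over `m` is the binomial series of `(1+z)^{-a-2k}`, which gives the right side. -/
theorem regularizedGaussHGFun_quadratic_of_small {a c : ℂ} (hc : ∀ k : ℕ, c ≠ -k) {z : ℂ}
    (hz : ‖z‖ < 1 / 200) :
    Complex.regularizedGaussHGFun a (a - c + 1) c z = (1 + z) ^ (-a) *
      Complex.regularizedGaussHGFun (a / 2) ((a + 1) / 2) c (4 * z / (1 + z) ^ 2) := by
  have hs := (summable_quadratic a c hz).hasSum
  have h1z : (199 / 200 : ℝ) ≤ ‖1 + z‖ := by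
    have := norm_sub_le_norm_add (1 : ℂ) z
    rw [norm_one] at this
    linarith
  have hz0 : 1 + z ≠ 0 := fun h => by rw [h] at h1z; norm_num at h1z
  have hw : ‖4 * z / (1 + z) ^ 2‖ < 1 := by
    rw [norm_div, norm_mul, norm_pow, div_lt_one (by positivity)]
    have : ‖(4 : ℂ)‖ = 4 := by norm_num
    rw [this]
    nlinarith
  have hA := (Finset.HasAntidiagonal.sigmaAntidiagonalEquivProd (A := ℕ)).hasSum_iff.2 hs
  have hA' := hA.sigma (fun n => hasSum_fintype _)
  have hB := hs.prod_fiberwise (g := fun k : ℕ => (1 + z) ^ (-a) *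
    ((ascPochhammer ℂ k).eval (a / 2) * (ascPochhammer ℂ k).eval ((a + 1) / 2) /
      (k.factorial * Complex.Gamma (c + k)) * (4 * z / (1 + z) ^ 2) ^ k)) (fun k => ?_)
  · have h1 := hB.unique ((hasSum_regularizedGaussHGFun _ _ _ hw).mul_left _)
    rw [← h1]
    refine (hasSum_regularizedGaussHGFun _ _ _ (by linarith)).unique (hA'.congr_fun fun n => ?_)
    rw [← sum_antidiagonal_quadratic hc, Finset.sum_mul, ← Finset.sum_coe_sort]
    refine Finset.sum_congr rfl fun p _ => ?_
    have := Finset.HasAntidiagonal.mem_antidiagonal.1 p.2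
    simp [Finset.HasAntidiagonal.sigmaAntidiagonalEquivProd, this]
  · have h := (hasSum_one_sub_cpow (a + 2 * k) (x := -z) (by rw [norm_neg]; linarith)).mul_left
      ((ascPochhammer ℂ (2 * k)).eval a / (k.factorial * Complex.Gamma (c + k)) * z ^ k)
    have e : (1 + z) ^ (-a) * ((ascPochhammer ℂ k).eval (a / 2) * (ascPochhammer ℂ k).eval ((a + 1) / 2) /
        (k.factorial * Complex.Gamma (c + k)) * (4 * z / (1 + z) ^ 2) ^ k) =
        (ascPochhammer ℂ (2 * k)).eval a / (k.factorial * Complex.Gamma (c + k)) * z ^ k *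
          (1 - -z) ^ (-(a + 2 * k)) := by
      rw [sub_neg_eq_add, neg_add, Complex.cpow_add _ _ hz0, Complex.cpow_neg (1 + z) (2 * k),
        show (2 * (k : ℂ)) = ((2 * k : ℕ) : ℂ) by push_cast; rfl, Complex.cpow_natCast,
        ascPochhammer_eval_two_mul, pow_mul, div_pow, mul_pow, div_eq_mul_inv _ (((1 + z) ^ 2) ^ k)]
      ring
    rw [e]
    refine h.congr_fun fun m => ?_
    simp only
    rw [ascPochhammer_eval_add, neg_pow z, pow_add]
    push_cast
    ring

/-- Identity theorem along the connected set `[0, 1)`: both sides are analytic at its points,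
because `4t / (1+t)² < 1` there, and they agree near 0. -/
theorem regularizedGaussHGFun_quadratic {a c : ℂ} (hc : ∀ k : ℕ, c ≠ -k) {x : ℝ}
    (hx0 : 0 ≤ x) (hx1 : x < 1) :
    Complex.regularizedGaussHGFun a (a - c + 1) c x = (1 + x : ℂ) ^ (-a) *
      Complex.regularizedGaussHGFun (a / 2) ((a + 1) / 2) c (4 * x / (1 + x) ^ 2) := by
  refine AnalyticOnNhd.eqOn_of_preconnected_of_eventuallyEq (𝕜 := ℂ)
    (f := Complex.regularizedGaussHGFun a (a - c + 1) c)
    (g := fun z => (1 + z : ℂ) ^ (-a) *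
      Complex.regularizedGaussHGFun (a / 2) ((a + 1) / 2) c (4 * z / (1 + z) ^ 2))
    (U := Complex.ofReal '' Set.Ico 0 1) (z₀ := ((0 : ℝ) : ℂ)) ?_ ?_ ?_ ?_ ?_ ⟨x, ⟨hx0, hx1⟩, rfl⟩
  · rintro _ ⟨t, ⟨ht0, ht1⟩, rfl⟩
    exact analyticAt_regularizedGaussHGFun _ _ _ (by rwa [Complex.norm_real, norm_of_nonneg ht0])
  · rintro _ ⟨t, ⟨ht0, ht1⟩, rfl⟩
    have h0 : (1 + (t : ℂ)) ≠ 0 := by norm_cast; linarith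
    refine AnalyticAt.mul (AnalyticAt.cpow (by fun_prop) (by fun_prop) ?_)
      (AnalyticAt.fun_comp (analyticAt_regularizedGaussHGFun _ _ _ ?_) ?_)
    · left
      simp only [Complex.add_re, Complex.one_re, Complex.ofReal_re]
      linarith
    · rw [show 4 * (t : ℂ) / (1 + t) ^ 2 = ((4 * t / (1 + t) ^ 2 : ℝ) : ℂ) by push_cast; rfl,
        Complex.norm_real, norm_of_nonneg (by positivity), div_lt_one (by positivity)]
      nlinarith [mul_pos (sub_pos.2 ht1) (sub_pos.2 ht1)]
    · exact AnalyticAt.div (by fun_prop) (by fun_prop) (pow_ne_zero _ h0)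
  · exact isPreconnected_Ico.image _ Complex.continuous_ofReal.continuousOn
  · exact ⟨0, by simp, rfl⟩
  · filter_upwards [Metric.ball_mem_nhds ((0 : ℝ) : ℂ) (ε := 1 / 200) (by norm_num)] with z hz
    exact regularizedGaussHGFun_quadratic_of_small hc (by simpa using hz)

/-! ### Legendre functions as integrals over the sphere. -/

theorem Gamma_nat_add_half_mul (j : ℕ) :
    Real.Gamma (j + 1 / 2) * (4 ^ j * j.factorial) = (2 * j).factorial * √π := by
  induction j with
  | zero => simpa using Real.Gamma_one_half_eq
  | succ j ih =>
    rw [show ((j + 1 : ℕ) : ℝ) + 1 / 2 = ((j : ℝ) + 1 / 2) + 1 by push_cast; ring,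
      Real.Gamma_add_one (by positivity), show 2 * (j + 1) = 2 * j + 1 + 1 by ring,
      Nat.factorial_succ, Nat.factorial_succ, Nat.factorial_succ]
    push_cast
    linear_combination (2 * (j : ℝ) + 1) * (2 * j + 1 + 1) * ih

/-- The binomial series is integrated term by term. Odd moments vanish, and duplication formulas
turn the even terms into those of Gauss' series in `q²`. -/
theorem integral_sphereMeasure_one_sub_cpow {n : ℕ} (S : ℂ) {q : ℝ} (hq0 : 0 ≤ q) (hq1 : q < 1)
    {e : EuclideanSpace ℝ (Fin (n + 1))} (he : ‖e‖ = 1) :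
    ∫ p, ((1 - q * inner ℝ (p : EuclideanSpace ℝ (Fin (n + 1))) e : ℝ) : ℂ) ^ (-S)
        ∂sphereMeasure (n + 1) =
      2 * ((π ^ (((n : ℝ) + 1) / 2) : ℝ) : ℂ) * Complex.regularizedGaussHGFun (S / 2) ((S + 1) / 2)
        (((n : ℂ) + 1) / 2) ((q ^ 2 : ℝ) : ℂ) := by
  have ht : ∀ p : USphere (n + 1), |inner ℝ (p : EuclideanSpace ℝ (Fin (n + 1))) e| ≤ 1 := by
    intro p
    have := abs_real_inner_le_norm (p : EuclideanSpace ℝ (Fin (n + 1))) e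
    rwa [he, norm_eq_of_mem_sphere, one_mul] at this
  have hqt : ∀ p : USphere (n + 1), |q * inner ℝ (p : EuclideanSpace ℝ (Fin (n + 1))) e| ≤ q := by
    intro p
    rw [abs_mul, abs_of_nonneg hq0]
    exact mul_le_of_le_one_right hq0 (ht p)
  set F : ℕ → USphere (n + 1) → ℂ := fun k p => (ascPochhammer ℂ k).eval S / k.factorial *
    ((q * inner ℝ (p : EuclideanSpace ℝ (Fin (n + 1))) e : ℝ) : ℂ) ^ k with hF
  have hFn : ∀ k p, ‖F k p‖ ≤ ‖(ascPochhammer ℂ k).eval S / k.factorial * (q : ℂ) ^ k‖ := by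
    intro k p
    simp only [hF, norm_mul, norm_pow, Complex.norm_real]
    gcongr
    rw [Real.norm_eq_abs, Real.norm_eq_abs, abs_of_nonneg hq0, ← abs_of_nonneg hq0, ← abs_mul,
      abs_of_nonneg hq0]
    exact hqt p
  have hFi : ∀ k, Integrable (F k) (sphereMeasure (n + 1)) := fun k =>
    Integrable.of_bound (by fun_prop) _ (Filter.Eventually.of_forall (hFn k))
  have hsum := (hasSum_one_sub_cpow S (x := q)
    (by rwa [Complex.norm_real, norm_of_nonneg hq0])).summable.norm
  have hFs : Summable fun k => ∫ p, ‖F k p‖ ∂sphereMeasure (n + 1) := by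
    refine Summable.of_nonneg_of_le (fun k => integral_nonneg fun p => norm_nonneg _) (fun k => ?_)
      (hsum.mul_right ((sphereMeasure (n + 1)).real Set.univ))
    refine (integral_mono (hFi k).norm (integrable_const _) (hFn k)).trans ?_
    rw [integral_const, smul_eq_mul, mul_comm]
  have key := hasSum_integral_of_summable_integral_norm hFi hFs
  have h1 : ∀ p : USphere (n + 1), ∑' k, F k p =
      ((1 - q * inner ℝ (p : EuclideanSpace ℝ (Fin (n + 1))) e : ℝ) : ℂ) ^ (-S) := by
    intro p
    rw [(hasSum_one_sub_cpow S (x := ((q * inner ℝ (p : EuclideanSpace ℝ (Fin (n + 1))) e : ℝ) : ℂ))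
      (by rw [Complex.norm_real]; exact (hqt p).trans_lt hq1)).tsum_eq]
    push_cast
    rfl
  simp only [h1] at key
  have h2 : ∀ k, ∫ p, F k p ∂sphereMeasure (n + 1) = (ascPochhammer ℂ k).eval S / k.factorial *
      (q ^ k * ((∫ p, inner ℝ (p : EuclideanSpace ℝ (Fin (n + 1))) e ^ k ∂sphereMeasure (n + 1) : ℝ) : ℂ)) := by
    intro k
    rw [hF, ← integral_complex_ofReal, ← integral_const_mul, ← integral_const_mul]
    refine integral_congr_ae (Filter.Eventually.of_forall fun p => ?_)
    simp only
    push_cast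
    ring
  simp only [h2] at key
  rw [← (mul_right_injective₀ (two_ne_zero' ℕ)).hasSum_iff] at key
  · have hq2 : ‖((q ^ 2 : ℝ) : ℂ)‖ < 1 := by
      rw [Complex.norm_real, norm_of_nonneg (by positivity)]
      exact pow_lt_one₀ hq0 hq1 two_ne_zero
    refine key.unique (((hasSum_regularizedGaussHGFun _ _ _ hq2).mul_left _).congr_fun fun j => ?_)
    simp only [Function.comp]
    rw [integral_sphereMeasure_inner_pow_even j he, ascPochhammer_eval_two_mul]
    have h3 := congrArg (Complex.ofReal) (Gamma_nat_add_half_mul j)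
    have h4 : π ^ (((n : ℝ) + 1) / 2) = π ^ ((n : ℝ) / 2) * √π := by
      rw [Real.sqrt_eq_rpow, ← rpow_add pi_pos]
      congr 1
      ring
    have h5 : ((Real.Gamma (j + ((n : ℝ) + 1) / 2) : ℝ) : ℂ) =
        Complex.Gamma (((n : ℂ) + 1) / 2 + j) := by
      rw [← Complex.Gamma_ofReal]
      congr 1
      push_cast
      ring
    have h6 : Complex.Gamma (((n : ℂ) + 1) / 2 + j) ≠ 0 := by
      rw [← h5]
      exact_mod_cast (Real.Gamma_pos_of_pos (by positivity)).ne'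
    have hfj : (j.factorial : ℂ) ≠ 0 := by exact_mod_cast j.factorial_ne_zero
    have hf2j : ((2 * j).factorial : ℂ) ≠ 0 := by exact_mod_cast (2 * j).factorial_ne_zero
    rw [h4]
    push_cast at h3 ⊢
    rw [h5]
    rw [← pow_mul]
    generalize Complex.Gamma (((n : ℂ) + 1) / 2 + j) = X at h6 ⊢
    generalize ((Real.Gamma ((j : ℝ) + 1 / 2) : ℝ) : ℂ) = Y at h3 ⊢
    field_simp
    linear_combination ((Polynomial.eval (S / 2) (ascPochhammer ℂ j)) * (Polynomial.eval ((S + 1) / 2) (ascPochhammer ℂ j)) * (q : ℂ) ^ (2 * j) * ((π ^ ((n : ℝ) / 2) : ℝ) : ℂ)) * h3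
  · intro k hk
    obtain ⟨j, hj | hj⟩ := Nat.even_or_odd' k
    · exact absurd ⟨j, hj.symm⟩ hk
    · rw [hj, integral_sphereMeasure_inner_pow_odd (by omega)]
      simp

/-- The base is `u (1 - q ⟨p, e⟩)` with `q = √(u²-1) / u`, and `z = (u-1)/(u+1)` satisfies `4z /
(1+z)² = q²`. The quadratic transformation therefore leads to the function in `legendreP`; the rest
compares elementary powers. -/
theorem integral_sphereMeasure_eq_legendreP {n : ℕ} (ν : ℂ) {u : ℝ} (hu : 1 < u)
    {e : EuclideanSpace ℝ (Fin (n + 1))} (he : ‖e‖ = 1) :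
    ∫ p, ((u - √(u ^ 2 - 1) * inner ℝ (p : EuclideanSpace ℝ (Fin (n + 1))) e : ℝ) : ℂ) ^
        (ν - (((n + 1 : ℕ) : ℂ) - 2) / 2) ∂sphereMeasure (n + 1) =
      (2 * (π : ℂ)) ^ (((n + 1 : ℕ) : ℂ) / 2) *
        ((((u ^ 2 - 1) ^ (-((((n + 1 : ℕ) : ℝ) - 2) / 4)) : ℝ) : ℂ) *
          legendreP (-((((n + 1 : ℕ) : ℂ) - 2) / 2)) ν u) := by
  have hu0 : 0 < u := by linarith
  have hv : 0 < u ^ 2 - 1 := by nlinarith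
  set S : ℂ := -(ν - (((n + 1 : ℕ) : ℂ) - 2) / 2) with hS
  set q := √(u ^ 2 - 1) / u with hq
  have hq2 : q ^ 2 = (u ^ 2 - 1) / u ^ 2 := by rw [hq, div_pow, Real.sq_sqrt hv.le]
  have hq1 : q < 1 := by
    refine lt_of_pow_lt_pow_left₀ 2 zero_le_one ?_
    rw [hq2, one_pow, div_lt_one (by positivity)]
    linarith
  have hz0 : 0 ≤ (u - 1) / (u + 1) := div_nonneg (by linarith) (by linarith)
  have hz1 : (u - 1) / (u + 1) < 1 := by rw [div_lt_one (by linarith)]; linarith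
  have hc : ∀ k : ℕ, ((n : ℂ) + 1) / 2 ≠ -k := by
    intro k hk
    have : ((n : ℝ) + 1) / 2 = -k := by
      apply Complex.ofReal_injective
      push_cast
      exact hk
    have h1 : (0 : ℝ) ≤ k := k.cast_nonneg
    have h2 : (0 : ℝ) ≤ n := n.cast_nonneg
    linarith
  have h1 : ∀ p : USphere (n + 1),
      ((u - √(u ^ 2 - 1) * inner ℝ (p : EuclideanSpace ℝ (Fin (n + 1))) e : ℝ) : ℂ) ^ (-S) =
      (u : ℂ) ^ (-S) * ((1 - q * inner ℝ (p : EuclideanSpace ℝ (Fin (n + 1))) e : ℝ) : ℂ) ^ (-S) := by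
    intro p
    have h := abs_real_inner_le_norm (p : EuclideanSpace ℝ (Fin (n + 1))) e
    rw [he, norm_eq_of_mem_sphere, one_mul] at h
    have h2 : 0 ≤ 1 - q * inner ℝ (p : EuclideanSpace ℝ (Fin (n + 1))) e := by
      have h3 : q * inner ℝ (p : EuclideanSpace ℝ (Fin (n + 1))) e ≤ q * 1 :=
        mul_le_mul_of_nonneg_left ((le_abs_self _).trans h) (by positivity)
      linarith
    rw [← Complex.mul_cpow_ofReal_nonneg hu0.le h2, ← Complex.ofReal_mul]
    congr 2
    rw [hq]
    field_simp
  rw [show ν - (((n + 1 : ℕ) : ℂ) - 2) / 2 = -S by rw [hS, neg_neg]]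
  simp only [h1]
  rw [integral_const_mul, integral_sphereMeasure_one_sub_cpow S (by positivity) hq1 he]
  have h2 := regularizedGaussHGFun_quadratic (a := S) hc hz0 hz1
  rw [show (4 * (((u - 1) / (u + 1) : ℝ) : ℂ) / (1 + (((u - 1) / (u + 1) : ℝ) : ℂ)) ^ 2) =
    ((q ^ 2 : ℝ) : ℂ) by
      rw [hq2]
      norm_cast
      have : u + 1 ≠ 0 := by positivity
      rw [show 1 + (u - 1) / (u + 1) = 2 * u / (u + 1) by field_simp; ring]
      field_simp
      ring] at h2
  set G := Complex.regularizedGaussHGFun (S / 2) ((S + 1) / 2) (((n : ℂ) + 1) / 2) ((q ^ 2 : ℝ) : ℂ)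
    with hG
  rw [legendreP,
    show -(-((((n + 1 : ℕ) : ℂ) - 2) / 2)) - ν = S by rw [hS]; ring,
    show 1 - -((((n + 1 : ℕ) : ℂ) - 2) / 2) = ((n : ℂ) + 1) / 2 by push_cast; ring,
    show -ν = S - ((n : ℂ) + 1) / 2 + 1 by rw [hS]; push_cast; ring,
    Complex.regularizedGaussHGFun_symm (S - ((n : ℂ) + 1) / 2 + 1), h2]
  have h3 : (2 : ℂ) = Complex.exp ((log 2 : ℝ)) := by
    rw [← Complex.ofReal_exp, exp_log two_pos]; simp
  have hup : 0 < u + 1 := by linarith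
  have hum : 0 < u - 1 := by linarith
  have key : (u : ℂ) ^ (-S) * (2 * ((π ^ (((n : ℝ) + 1) / 2) : ℝ) : ℂ)) =
      (2 * (π : ℂ)) ^ (((n + 1 : ℕ) : ℂ) / 2) *
        ((((u ^ 2 - 1) ^ (-((((n + 1 : ℕ) : ℝ) - 2) / 4)) : ℝ) : ℂ) *
          ((((u + 1) / (u - 1) : ℝ) : ℂ) ^ (-((((n + 1 : ℕ) : ℂ) - 2) / 2) / 2) *
            (((u + 1) / 2 : ℝ) : ℂ) ^ ν * (1 + (((u - 1) / (u + 1) : ℝ) : ℂ)) ^ (-S))) := by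
    rw [show (2 * (π : ℂ)) = ((2 * π : ℝ) : ℂ) by push_cast; rfl,
      show (1 + (((u - 1) / (u + 1) : ℝ) : ℂ)) = ((2 * u / (u + 1) : ℝ) : ℂ) by
        push_cast
        have : (u : ℂ) + 1 ≠ 0 := by exact_mod_cast hup.ne'
        field_simp
        ring,
      ofReal_cpow_eq_cexp hu0, ofReal_cpow_eq_cexp (by positivity),
      ofReal_cpow_eq_cexp (by positivity), ofReal_cpow_eq_cexp (by positivity),
      ofReal_cpow_eq_cexp (by positivity), rpow_def_of_pos pi_pos, rpow_def_of_pos hv,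
      show u ^ 2 - 1 = (u + 1) * (u - 1) by ring,
      Real.log_mul hup.ne' hum.ne', Real.log_div hup.ne' hum.ne', Real.log_div hup.ne' two_ne_zero,
      Real.log_div (by positivity) hup.ne', Real.log_mul two_ne_zero hu0.ne',
      Real.log_mul two_ne_zero pi_pos.ne', Complex.ofReal_exp, Complex.ofReal_exp]
    nth_rw 1 [h3]
    simp only [← Complex.exp_add]
    congr 1
    rw [hS]
    push_cast
    ring
  linear_combination G * key

/-! ### Fubini on the hyperboloid times three spheres. -/

/-- The point `(1, n)` of the forward light-cone. -/
noncomputable def conePoint {d : ℕ} (p : USphere d) : Minkowski d := (1, (p : EuclideanSpace ℝ (Fin d)))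

theorem conePoint_mem_forwardCone {d : ℕ} (p : USphere d) : conePoint p ∈ forwardCone d := by
  refine ⟨?_, zero_lt_one⟩
  rw [lorentz, conePoint, real_inner_self_eq_norm_sq, norm_eq_of_mem_sphere]
  norm_num

theorem lorentz_conePoint {d : ℕ} (p q : USphere d) :
    lorentz (conePoint p) (conePoint q) = dist p q ^ 2 / 2 := by
  rw [lorentz, conePoint, conePoint, Subtype.dist_eq, dist_eq_norm, norm_sub_sq_real,
    norm_eq_of_mem_sphere, norm_eq_of_mem_sphere]
  ring

@[fun_prop]
theorem measurable_conePoint {d : ℕ} : Measurable (conePoint (d := d)) := by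
  unfold conePoint
  fun_prop

theorem lorentz_conePoint_ne_zero {d : ℕ} {p q : USphere d} (h : p ≠ q) :
    lorentz (conePoint p) (conePoint q) ≠ 0 := by
  rw [lorentz_conePoint]
  have := dist_pos.2 h
  positivity

theorem lorentz_conePoint_cpow {d : ℕ} {p q : USphere d} (h : p ≠ q) (a : ℂ) :
    (lorentz (conePoint p) (conePoint q) : ℂ) ^ a = 2 ^ (-a) * ((dist p q ^ 2 : ℝ) : ℂ) ^ a := by
  have := dist_pos.2 h
  rw [lorentz_conePoint, show (2 : ℂ) = ((2 : ℝ) : ℂ) by simp, ofReal_cpow_eq_cexp (by positivity),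
    ofReal_cpow_eq_cexp two_pos, ofReal_cpow_eq_cexp (by positivity), ← Complex.exp_add,
    Real.log_div (by positivity) two_ne_zero]
  congr 1
  push_cast
  ring

/-- On the rays `(1, n)` the Lorentz product is half the squared chord; the halves give the power of
2. -/
theorem IsStarTriangleConst.integral_conePoint {d : ℕ} {a₁ a₂ a₃ c : ℂ}
    (hc : IsStarTriangleConst d a₁ a₂ a₃ c) {p : USphere d × USphere d × USphere d}
    (hp : p.1 ≠ p.2.1 ∧ p.2.1 ≠ p.2.2 ∧ p.2.2 ≠ p.1) :
    Integrable (starFun a₁ a₂ a₃ (conePoint p.1) (conePoint p.2.1) (conePoint p.2.2))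
      (hyperboloidMeasure d) ∧
    ∫ y, starFun a₁ a₂ a₃ (conePoint p.1) (conePoint p.2.1) (conePoint p.2.2) y
      ∂hyperboloidMeasure d = c * 2 ^ (-(a₁ + a₂ + a₃)) * triangleFun d a₁ a₂ a₃ p := by
  have h := hc _ (conePoint_mem_forwardCone p.1) _ (conePoint_mem_forwardCone p.2.1) _
    (conePoint_mem_forwardCone p.2.2) (lorentz_conePoint_ne_zero hp.1)
    (lorentz_conePoint_ne_zero hp.2.1) (lorentz_conePoint_ne_zero hp.2.2)
  refine ⟨h.1, h.2.trans ?_⟩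
  rw [lorentz_conePoint_cpow hp.1, lorentz_conePoint_cpow hp.2.1, lorentz_conePoint_cpow hp.2.2,
    triangleFun, show -(a₁ + a₂ + a₃) = -a₁ + -a₂ + -a₃ by ring,
    Complex.cpow_add _ _ two_ne_zero, Complex.cpow_add _ _ two_ne_zero]
  ring

theorem ofReal_norm_cpow {x : ℝ} (hx : 0 < x) (a : ℂ) :
    ((‖(x : ℂ) ^ a‖ : ℝ) : ℂ) = (x : ℂ) ^ (a.re : ℂ) := by
  rw [Complex.norm_cpow_eq_rpow_re_of_pos hx, Complex.ofReal_cpow hx.le]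

theorem ae_ofReal_norm_starFun {d : ℕ} (hd : 1 ≤ d) (a₁ a₂ a₃ : ℂ) {ξ₁ ξ₂ ξ₃ : Minkowski d}
    (h₁ : ξ₁ ∈ forwardCone d) (h₂ : ξ₂ ∈ forwardCone d) (h₃ : ξ₃ ∈ forwardCone d) :
    ∀ᵐ y ∂hyperboloidMeasure d, ((‖starFun a₁ a₂ a₃ ξ₁ ξ₂ ξ₃ y‖ : ℝ) : ℂ) =
      starFun (a₁.re : ℂ) (a₂.re : ℂ) (a₃.re : ℂ) ξ₁ ξ₂ ξ₃ y := by
  filter_upwards [ae_lorentz_pos hd h₁, ae_lorentz_pos hd h₂, ae_lorentz_pos hd h₃] with y h1 h2 h3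
  rw [starFun, starFun, norm_mul, norm_mul, Complex.ofReal_mul, Complex.ofReal_mul,
    ofReal_norm_cpow h1, ofReal_norm_cpow h2, ofReal_norm_cpow h3]
  simp only [Complex.add_re, Complex.ofReal_add]

/-- As `y·ξ > 0` almost everywhere, the norm of the integrand is the star integrand with the real
parts of the exponents. The relation with constant `c'` reduces integrability to that of the real
triangle function. -/
theorem integrable_starFun_prod {n : ℕ} (hn : 1 ≤ n) {a₁ a₂ a₃ c c' : ℂ}
    (hc : IsStarTriangleConst (n + 1) a₁ a₂ a₃ c)
    (hc' : IsStarTriangleConst (n + 1) a₁.re a₂.re a₃.re c')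
    (ht : Integrable (triangleFun (n + 1) a₁.re a₂.re a₃.re) (sphereMeasure₃ (n + 1))) :
    Integrable (fun q : Minkowski (n + 1) × USphere (n + 1) × USphere (n + 1) × USphere (n + 1) =>
      starFun a₁ a₂ a₃ (conePoint q.2.1) (conePoint q.2.2.1) (conePoint q.2.2.2) q.1)
      ((hyperboloidMeasure (n + 1)).prod (sphereMeasure₃ (n + 1))) := by
  have hm : Measurable (fun q : Minkowski (n + 1) × USphere (n + 1) × USphere (n + 1) × USphere (n + 1) =>
      starFun a₁ a₂ a₃ (conePoint q.2.1) (conePoint q.2.2.1) (conePoint q.2.2.2) q.1) := by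
    unfold starFun
    fun_prop
  rw [integrable_prod_iff' hm.aestronglyMeasurable]
  constructor
  · filter_upwards [ae_ne_sphereMeasure₃ hn] with p hp
    exact (hc.integral_conePoint hp).1
  · refine ((ht.const_mul (c' * 2 ^ (-((a₁.re : ℂ) + a₂.re + a₃.re)))).re).congr ?_
    filter_upwards [ae_ne_sphereMeasure₃ hn] with p hp
    rw [← (hc'.integral_conePoint hp).2, ← integral_congr_ae (ae_ofReal_norm_starFun (by omega) a₁ a₂ a₃
      (conePoint_mem_forwardCone p.1) (conePoint_mem_forwardCone p.2.1)
      (conePoint_mem_forwardCone p.2.2)), integral_complex_ofReal]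
    simp

theorem integral_starFun_sphereMeasure₃ {d : ℕ} (a₁ a₂ a₃ : ℂ) (y : Minkowski d) :
    ∫ p, starFun a₁ a₂ a₃ (conePoint p.1) (conePoint p.2.1) (conePoint p.2.2) y ∂sphereMeasure₃ d =
      (∫ p, (lorentz y (conePoint p) : ℂ) ^ (a₂ + a₃) ∂sphereMeasure d) *
        ((∫ p, (lorentz y (conePoint p) : ℂ) ^ (a₃ + a₁) ∂sphereMeasure d) *
          ∫ p, (lorentz y (conePoint p) : ℂ) ^ (a₁ + a₂) ∂sphereMeasure d) := by
  rw [sphereMeasure₃, ← integral_prod_mul, ← integral_prod_mul]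
  refine integral_congr_ae (Filter.Eventually.of_forall fun p => ?_)
  simp only [starFun, mul_assoc]

theorem lorentz_hyperboloidPoint_conePoint {d : ℕ} (u : ℝ) (m p : USphere d) :
    lorentz (hyperboloidPoint d (u, m)) (conePoint p) =
      u - √(u ^ 2 - 1) * inner ℝ (p : EuclideanSpace ℝ (Fin d)) (m : EuclideanSpace ℝ (Fin d)) := by
  rw [lorentz, hyperboloidPoint, conePoint, real_inner_smul_left, real_inner_comm]
  ring

theorem integral_hyperboloidMeasure_of_radial {d : ℕ} (hd : 1 ≤ d) {H : Minkowski d → ℂ}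
    {K : ℝ → ℂ} (hH : Integrable H (hyperboloidMeasure d))
    (hHK : ∀ u : ℝ, 1 < u → ∀ m, H (hyperboloidPoint d (u, m)) = K u) :
    IntegrableOn (fun u : ℝ => (((u ^ 2 - 1) ^ (((d : ℝ) - 2) / 2) : ℝ) : ℂ) * K u) (Set.Ioi 1) ∧
    ∫ y, H y ∂hyperboloidMeasure d = (sphereArea d : ℂ) *
      ∫ u in Set.Ioi (1 : ℝ), (((u ^ 2 - 1) ^ (((d : ℝ) - 2) / 2) : ℝ) : ℂ) * K u := by
  have hdm : Measurable fun u : ℝ => ENNReal.ofReal ((u ^ 2 - 1) ^ (((d : ℝ) - 2) / 2)) := by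
    fun_prop
  have hlt : ∀ᵐ u ∂volume.restrict (Set.Ioi (1 : ℝ)),
      ENNReal.ofReal ((u ^ 2 - 1) ^ (((d : ℝ) - 2) / 2)) < ⊤ :=
    Filter.Eventually.of_forall fun _ => ENNReal.ofReal_lt_top
  have hHm := hH.aestronglyMeasurable
  rw [hyperboloidMeasure] at hH hHm ⊢
  have hgt := (withDensity_absolutelyContinuous (volume.restrict (Set.Ioi (1 : ℝ)))
    (fun u => ENNReal.ofReal ((u ^ 2 - 1) ^ (((d : ℝ) - 2) / 2)))).ae_le
      (ae_restrict_mem measurableSet_Ioi)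
  have hKL : ∀ u ∈ Set.Ioi (1 : ℝ),
      (ENNReal.ofReal ((u ^ 2 - 1) ^ (((d : ℝ) - 2) / 2))).toReal • K u =
        (((u ^ 2 - 1) ^ (((d : ℝ) - 2) / 2) : ℝ) : ℂ) * K u := by
    intro u (hu : 1 < u)
    have hv : 0 < u ^ 2 - 1 := by nlinarith
    rw [ENNReal.toReal_ofReal (by positivity), Complex.real_smul]
  have hint : ∀ f : ℝ → ℂ, ∫ u, f u ∂(volume.restrict (Set.Ioi (1 : ℝ))).withDensity
      (fun u => ENNReal.ofReal ((u ^ 2 - 1) ^ (((d : ℝ) - 2) / 2))) =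
      ∫ u in Set.Ioi (1 : ℝ), (ENNReal.ofReal ((u ^ 2 - 1) ^ (((d : ℝ) - 2) / 2))).toReal • f u :=
    fun f => integral_withDensity_eq_integral_toReal_smul hdm hlt f
  have hint' := integrable_withDensity_iff_integrable_smul' (g := K) hdm hlt
  have hs : SFinite ((volume.restrict (Set.Ioi (1 : ℝ))).withDensity
    (fun u => ENNReal.ofReal ((u ^ 2 - 1) ^ (((d : ℝ) - 2) / 2)))) := inferInstance
  generalize (volume.restrict (Set.Ioi (1 : ℝ))).withDensity
    (fun u => ENNReal.ofReal ((u ^ 2 - 1) ^ (((d : ℝ) - 2) / 2))) = ρ at hH hHm hgt hint hint' hs ⊢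
  have hpm := (measurable_hyperboloidPoint d).aemeasurable (μ := ρ.prod (sphereMeasure d))
  have hcomp : (fun q => H (hyperboloidPoint d q)) =ᵐ[ρ.prod (sphereMeasure d)] fun q => K q.1 := by
    filter_upwards [Measure.quasiMeasurePreserving_fst.ae hgt] with q hq
    exact hHK q.1 hq q.2
  have hK : Integrable K ρ := by
    have h := ((integrable_map_measure hHm hpm).1 hH).congr hcomp
    have hne : sphereMeasure d ≠ 0 := fun h0 => by
      have := sphereMeasure_univ hd
      rw [h0] at this
      exact (ENNReal.ofReal_pos.2 (sphereArea_pos hd)).ne (by simpa using this)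
    have := ae_neBot.2 hne
    obtain ⟨m, hm⟩ := h.prod_left_ae.exists
    exact hm
  refine ⟨(integrableOn_congr_fun hKL measurableSet_Ioi).1 (hint'.1 hK), ?_⟩
  rw [integral_map hpm hHm, integral_congr_ae hcomp, integral_fun_fst, measureReal_def,
    sphereMeasure_univ hd, ENNReal.toReal_ofReal (sphereArea_pos hd).le, Complex.real_smul, hint,
    setIntegral_congr_fun measurableSet_Ioi hKL]

/-- Integrated over the three rays first, the star integrand is a product of three Legendre
functions; integrated over `y` first, it is a multiple of the triangle function. -/
theorem integral_legendreTriple {n : ℕ} (hn : 1 ≤ n) (κ ν l : ℝ) {a₁ a₂ a₃ c c' : ℂ}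
    (h₁ : a₂ + a₃ = -1 / 2 + Complex.I * κ - (((n + 1 : ℕ) : ℂ) - 2) / 2)
    (h₂ : a₃ + a₁ = -1 / 2 + Complex.I * ν - (((n + 1 : ℕ) : ℂ) - 2) / 2)
    (h₃ : a₁ + a₂ = -1 / 2 + Complex.I * l - (((n + 1 : ℕ) : ℂ) - 2) / 2)
    (hc : IsStarTriangleConst (n + 1) a₁ a₂ a₃ c)
    (hc' : IsStarTriangleConst (n + 1) a₁.re a₂.re a₃.re c')
    (ht : Integrable (triangleFun (n + 1) a₁.re a₂.re a₃.re) (sphereMeasure₃ (n + 1))) :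
    IntegrableOn (legendreTriple (n + 1) κ ν l) (Set.Ioi (1 : ℝ)) ∧
    (sphereArea (n + 1) : ℂ) * (((2 * (π : ℂ)) ^ (((n + 1 : ℕ) : ℂ) / 2)) ^ 3 * hIntegral (n + 1) κ ν l) =
      c * 2 ^ (-(a₁ + a₂ + a₃)) * ∫ p, triangleFun (n + 1) a₁ a₂ a₃ p ∂sphereMeasure₃ (n + 1) := by
  have hI := integrable_starFun_prod hn hc hc' ht
  have hswap : ∫ y, ∫ p, starFun a₁ a₂ a₃ (conePoint p.1) (conePoint p.2.1) (conePoint p.2.2) y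
      ∂sphereMeasure₃ (n + 1) ∂hyperboloidMeasure (n + 1) = ∫ p, ∫ y, starFun a₁ a₂ a₃
        (conePoint p.1) (conePoint p.2.1) (conePoint p.2.2) y ∂hyperboloidMeasure (n + 1)
          ∂sphereMeasure₃ (n + 1) :=
    (integral_prod _ hI).symm.trans (integral_prod_symm _ hI)
  have hR : ∫ p, ∫ y, starFun a₁ a₂ a₃ (conePoint p.1) (conePoint p.2.1) (conePoint p.2.2) y
      ∂hyperboloidMeasure (n + 1) ∂sphereMeasure₃ (n + 1) =
      c * 2 ^ (-(a₁ + a₂ + a₃)) * ∫ p, triangleFun (n + 1) a₁ a₂ a₃ p ∂sphereMeasure₃ (n + 1) := by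
    rw [← integral_const_mul]
    refine integral_congr_ae ?_
    filter_upwards [ae_ne_sphereMeasure₃ hn] with p hp
    exact (hc.integral_conePoint hp).2
  rw [hR] at hswap
  -- The spherical integrals do not depend on the direction `m`, so the south pole serves as
  -- reference.
  have hrad := integral_hyperboloidMeasure_of_radial (d := n + 1) (by omega) hI.integral_prod_left
    (K := fun u => (∫ p, ((u - √(u ^ 2 - 1) * inner ℝ (p : EuclideanSpace ℝ (Fin (n + 1))) (southPole n) : ℝ) : ℂ) ^ (a₂ + a₃) ∂sphereMeasure (n + 1)) *
      ((∫ p, ((u - √(u ^ 2 - 1) * inner ℝ (p : EuclideanSpace ℝ (Fin (n + 1))) (southPole n) : ℝ) : ℂ) ^ (a₃ + a₁) ∂sphereMeasure (n + 1)) *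
      ∫ p, ((u - √(u ^ 2 - 1) * inner ℝ (p : EuclideanSpace ℝ (Fin (n + 1))) (southPole n) : ℝ) : ℂ) ^ (a₁ + a₂) ∂sphereMeasure (n + 1)))
    (fun u hu m => by
      simp only [integral_starFun_sphereMeasure₃, h₁, h₂, h₃, lorentz_hyperboloidPoint_conePoint,
        integral_sphereMeasure_eq_legendreP _ hu (norm_eq_of_mem_sphere m),
        integral_sphereMeasure_eq_legendreP _ hu (norm_southPole n)])
  have hKL : ∀ u ∈ Set.Ioi (1 : ℝ), (((u ^ 2 - 1) ^ ((((n + 1 : ℕ) : ℝ) - 2) / 2) : ℝ) : ℂ) *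
     ((∫ p, ((u - √(u ^ 2 - 1) * inner ℝ (p : EuclideanSpace ℝ (Fin (n + 1))) (southPole n) : ℝ) : ℂ) ^ (a₂ + a₃) ∂sphereMeasure (n + 1)) *
      ((∫ p, ((u - √(u ^ 2 - 1) * inner ℝ (p : EuclideanSpace ℝ (Fin (n + 1))) (southPole n) : ℝ) : ℂ) ^ (a₃ + a₁) ∂sphereMeasure (n + 1)) *
      ∫ p, ((u - √(u ^ 2 - 1) * inner ℝ (p : EuclideanSpace ℝ (Fin (n + 1))) (southPole n) : ℝ) : ℂ) ^ (a₁ + a₂) ∂sphereMeasure (n + 1))) =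
      ((2 * (π : ℂ)) ^ (((n + 1 : ℕ) : ℂ) / 2)) ^ 3 * legendreTriple (n + 1) κ ν l u := by
    intro u (hu : 1 < u)
    have hv : 0 < u ^ 2 - 1 := by nlinarith
    rw [h₁, h₂, h₃, integral_sphereMeasure_eq_legendreP _ hu (norm_southPole n),
      integral_sphereMeasure_eq_legendreP _ hu (norm_southPole n),
      integral_sphereMeasure_eq_legendreP _ hu (norm_southPole n), legendreTriple]
    -- The density cancels two of the three prefactors `(u²-1)^{-(d-2)/4}`; the third is the one in
    -- `legendreTriple`.
    have h := congrArg Complex.ofReal (show (u ^ 2 - 1) ^ ((((n + 1 : ℕ) : ℝ) - 2) / 2) *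
        ((u ^ 2 - 1) ^ (-((((n + 1 : ℕ) : ℝ) - 2) / 4)) *
          (u ^ 2 - 1) ^ (-((((n + 1 : ℕ) : ℝ) - 2) / 4))) = 1 by
      rw [← rpow_add hv, ← rpow_add hv]
      ring_nf
      exact rpow_zero _)
    rw [Complex.ofReal_mul, Complex.ofReal_mul, Complex.ofReal_one] at h
    generalize legendreP (-((((n + 1 : ℕ) : ℂ) - 2) / 2)) (-1 / 2 + Complex.I * κ) u = A
    generalize legendreP (-((((n + 1 : ℕ) : ℂ) - 2) / 2)) (-1 / 2 + Complex.I * ν) u = B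
    generalize legendreP (-((((n + 1 : ℕ) : ℂ) - 2) / 2)) (-1 / 2 + Complex.I * l) u = C
    generalize (((u ^ 2 - 1) ^ (-((((n + 1 : ℕ) : ℝ) - 2) / 4)) : ℝ) : ℂ) = X at h ⊢
    generalize (((u ^ 2 - 1) ^ ((((n + 1 : ℕ) : ℝ) - 2) / 2) : ℝ) : ℂ) = Y at h ⊢
    linear_combination (((2 * (π : ℂ)) ^ (((n + 1 : ℕ) : ℂ) / 2)) ^ 3 * A * B * C * X) * h
  rw [hswap, setIntegral_congr_fun measurableSet_Ioi hKL, integral_const_mul] at hrad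
  have hpi : ((2 * (π : ℂ)) ^ (((n + 1 : ℕ) : ℂ) / 2)) ^ 3 ≠ 0 := by
    refine pow_ne_zero _ fun h => ?_
    rw [Complex.cpow_eq_zero_iff] at h
    exact absurd h.1 (by simp [pi_ne_zero])
  exact ⟨(integrable_const_mul_iff (IsUnit.mk0 _ hpi) _).1
    ((integrableOn_congr_fun hKL measurableSet_Ioi).1 hrad.1), hrad.2.symm⟩

/-! ### Gamma factors and the closed form of `h_d`. -/

/-- The constant of the star-triangle relation. -/
noncomputable def starTriangleConst (d : ℕ) (a₁ a₂ a₃ : ℂ) : ℂ :=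
  (2 : ℂ) ^ (-(a₁ + a₂ + a₃) - 1) * (π : ℂ) ^ (((d : ℂ) - 1) / 2) *
    Complex.Gamma (-(a₁ + a₂ + a₃) - ((d : ℂ) - 1) / 2) *
    (Complex.Gamma (-a₁) * Complex.Gamma (-a₂) * Complex.Gamma (-a₃) /
      (Complex.Gamma (-a₂ - a₃) * Complex.Gamma (-a₃ - a₁) * Complex.Gamma (-a₁ - a₂)))

/-- The closed form of the integral of a product of three Legendre functions. -/
noncomputable def legendreTripleValue (d : ℕ) (κ ν l : ℝ) : ℂ :=
  (2 : ℂ) ^ ((d : ℂ) / 2) / ((4 * (π : ℂ)) ^ ((3 : ℂ) / 2) * Complex.Gamma (((d : ℂ) - 1) / 2)) *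
    ((quarterGamma d (κ + ν + l) * quarterGamma d (κ + ν - l) *
      quarterGamma d (κ - ν + l) * quarterGamma d (κ - ν - l) *
      quarterGamma d (-κ + ν + l) * quarterGamma d (-κ + ν - l) *
      quarterGamma d (-κ - ν + l) * quarterGamma d (-κ - ν - l)) /
      (halfGammaPair d κ * halfGammaPair d ν * halfGammaPair d l))

theorem legendreTripleValue_neg (d : ℕ) (κ ν l : ℝ) :
    legendreTripleValue d (-κ) (-ν) (-l) = legendreTripleValue d κ ν l := by
  have hH : ∀ t, halfGammaPair d (-t) = halfGammaPair d t := fun t => by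
    rw [halfGammaPair, halfGammaPair, mul_comm]
    push_cast
    congr 2 <;> ring
  rw [legendreTripleValue, legendreTripleValue, hH, hH, hH,
    show -κ + -ν + -l = -κ - ν - l by ring, show -κ + -ν - -l = -κ - ν + l by ring,
    show -κ - -ν + -l = -κ + ν - l by ring, show -κ - -ν - -l = -κ + ν + l by ring,
    show - -κ + -ν + -l = κ - ν - l by ring, show - -κ + -ν - -l = κ - ν + l by ring,
    show - -κ - -ν + -l = κ + ν - l by ring, show - -κ - -ν - -l = κ + ν + l by ring]
  ring

theorem sphereArea_mul_Gamma {n : ℕ} (hn : 1 ≤ n) :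
    (sphereArea n : ℂ) * Complex.Gamma ((n : ℂ) / 2) = 2 * (π : ℂ) ^ ((n : ℂ) / 2) := by
  have hn' : (0 : ℝ) < n := by exact_mod_cast hn
  have hG := Real.Gamma_pos_of_pos (s := (n : ℝ) / 2) (by positivity)
  have h : sphereArea n * Real.Gamma ((n : ℝ) / 2) = 2 * π ^ ((n : ℝ) / 2) := by
    rw [sphereArea]
    field_simp
  have h' := congrArg Complex.ofReal h
  rw [Complex.ofReal_mul, Complex.ofReal_mul, Complex.ofReal_cpow pi_pos.le, ← Complex.Gamma_ofReal] at h'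
  push_cast at h'
  exact h'

/-- The powers of 2 depending on `a` cancel, and `Γ(n/2)` removes the area of the `(n-1)`-sphere. -/
theorem legendreTriple_const_identity {n : ℕ} (hn : 1 ≤ n) (a : ℂ) :
    (2 : ℂ) ^ (-a) * ((2 : ℂ) ^ (-a - 1) * (π : ℂ) ^ ((n : ℂ) / 2)) *
      ((2 : ℂ) ^ (2 * (n : ℂ) - 1 + 2 * a) * (π : ℂ) ^ ((n : ℂ) / 2) * (sphereArea n : ℂ)) *
        ((4 * (π : ℂ)) ^ ((3 : ℂ) / 2) * Complex.Gamma ((n : ℂ) / 2)) =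
      (2 : ℂ) ^ (((n : ℂ) + 1) / 2) * (2 * (π : ℂ)) ^ (3 * ((n : ℂ) + 1) / 2) := by
  have h := sphereArea_mul_Gamma hn
  have e : (2 : ℂ) ^ (-a) * ((2 : ℂ) ^ (-a - 1) * (π : ℂ) ^ ((n : ℂ) / 2)) *
      ((2 : ℂ) ^ (2 * (n : ℂ) - 1 + 2 * a) * (π : ℂ) ^ ((n : ℂ) / 2)) *
        ((4 * (π : ℂ)) ^ ((3 : ℂ) / 2) * (2 * (π : ℂ) ^ ((n : ℂ) / 2))) =
      (2 : ℂ) ^ (((n : ℂ) + 1) / 2) * (2 * (π : ℂ)) ^ (3 * ((n : ℂ) + 1) / 2) := by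
    have h2 : ∀ x : ℂ, (2 : ℂ) ^ x = Complex.exp (x * (Real.log 2 : ℝ)) := fun x => by
      rw [← ofReal_cpow_eq_cexp two_pos]; simp
    have h2' : (2 : ℂ) = Complex.exp ((Real.log 2 : ℝ)) := by
      rw [← Complex.ofReal_exp, exp_log two_pos]; simp
    have h4 : Real.log 4 = 2 * Real.log 2 := by
      rw [show (4 : ℝ) = 2 ^ 2 by norm_num, Real.log_pow]; norm_num
    have h2π : ∀ x : ℂ, (2 * (π : ℂ)) ^ x = Complex.exp (x * ((Real.log 2 + Real.log π : ℝ))) := fun x => by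
      rw [← Real.log_mul two_ne_zero pi_pos.ne', ← ofReal_cpow_eq_cexp (by positivity)]; simp
    have h4π : ∀ x : ℂ, (4 * (π : ℂ)) ^ x = Complex.exp (x * ((2 * Real.log 2 + Real.log π : ℝ))) := fun x => by
      rw [← h4, ← Real.log_mul four_ne_zero pi_pos.ne', ← ofReal_cpow_eq_cexp (by positivity)]; simp
    rw [h2, h2, h2, h2, h2π, h4π, ofReal_cpow_eq_cexp pi_pos]
    nth_rw 1 [show (2 : ℂ) * Complex.exp ((n : ℂ) / 2 * (Real.log π : ℝ)) =
      Complex.exp ((Real.log 2 : ℝ)) * Complex.exp ((n : ℂ) / 2 * (Real.log π : ℝ)) by rw [← h2']]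
    simp only [← Complex.exp_add]
    congr 1
    push_cast
    ring
  rw [← e, ← h]
  ring

theorem Gamma_eq_quarterGamma {n : ℕ} {z : ℂ} (t : ℝ) (h : z = (n : ℂ) / 4 + Complex.I * t / 2) :
    Complex.Gamma z = quarterGamma (n + 1) t := by
  rw [quarterGamma, h]
  push_cast
  rw [add_sub_cancel_right]

theorem Gamma_mul_Gamma_eq_halfGammaPair {n : ℕ} {z w : ℂ} (t : ℝ)
    (hz : z = (n : ℂ) / 2 + Complex.I * t) (hw : w = (n : ℂ) / 2 - Complex.I * t) :
    Complex.Gamma z * Complex.Gamma w = halfGammaPair (n + 1) t := by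
  rw [halfGammaPair, hz, hw]
  push_cast
  rw [add_sub_cancel_right]

theorem halfGammaPair_ne_zero {n : ℕ} (hn : 1 ≤ n) (t : ℝ) : halfGammaPair (n + 1) t ≠ 0 := by
  have hn' : (0 : ℝ) < n := by exact_mod_cast hn
  rw [halfGammaPair]
  push_cast
  rw [add_sub_cancel_right]
  refine mul_ne_zero ?_ ?_ <;>
  · refine Complex.Gamma_ne_zero_of_re_pos ?_
    simpa using hn'

/-- The arguments `-a - n/2`, `-aⱼ` from the star constant and `a + n`, `n/2 + aⱼ` from the triangle
integral run through the eight sign choices; the denominators pair off into `halfGammaPair`. -/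
theorem starTriangleConst_mul_triangularJ {n : ℕ} (hn : 1 ≤ n) (κ ν l : ℝ) {a₁ a₂ a₃ : ℂ}
    (h₁ : a₁ = -(n : ℂ) / 4 - Complex.I * ((ν : ℂ) + l - κ) / 2)
    (h₂ : a₂ = -(n : ℂ) / 4 - Complex.I * ((l : ℂ) + κ - ν) / 2)
    (h₃ : a₃ = -(n : ℂ) / 4 - Complex.I * ((κ : ℂ) + ν - l) / 2) :
    (2 : ℂ) ^ (-(a₁ + a₂ + a₃)) * (sphereArea (n + 1) : ℂ) ^ 2 *
      starTriangleConst (n + 1) a₁ a₂ a₃ * triangularJ (n + 1) a₁ a₂ a₃ =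
      (2 * (π : ℂ)) ^ (3 * ((n + 1 : ℕ) : ℂ) / 2) * legendreTripleValue (n + 1) κ ν l := by
  have hn' : (1 : ℝ) ≤ n := by exact_mod_cast hn
  have r₁ : a₁.re = -(n : ℝ) / 4 := by rw [h₁]; simp
  have r₂ : a₂.re = -(n : ℝ) / 4 := by rw [h₂]; simp
  have r₃ : a₃.re = -(n : ℝ) / 4 := by rw [h₃]; simp
  have hc := legendreTriple_const_identity hn (a₁ + a₂ + a₃)
  have hA : (sphereArea (n + 1) : ℂ) ≠ 0 := by
    exact_mod_cast (sphereArea_pos (d := n + 1) (by omega)).ne'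
  have hG : Complex.Gamma ((n : ℂ) / 2) ≠ 0 := by
    refine Complex.Gamma_ne_zero_of_re_pos ?_
    simp
    positivity
  have h4 : (4 * (π : ℂ)) ^ ((3 : ℂ) / 2) ≠ 0 := fun h => by
    rw [Complex.cpow_eq_zero_iff] at h
    exact absurd h.1 (by simp [pi_ne_zero])
  have hd : ((n + 1 : ℕ) : ℂ) - 1 = n := by push_cast; ring
  have e₁ : Complex.Gamma (-a₂ - a₃) * Complex.Gamma (n + a₂ + a₃) = halfGammaPair (n + 1) κ :=
    Gamma_mul_Gamma_eq_halfGammaPair κ (by rw [h₂, h₃]; ring) (by rw [h₂, h₃]; ring)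
  have e₂ : Complex.Gamma (-a₃ - a₁) * Complex.Gamma (n + a₃ + a₁) = halfGammaPair (n + 1) ν :=
    Gamma_mul_Gamma_eq_halfGammaPair ν (by rw [h₃, h₁]; ring) (by rw [h₃, h₁]; ring)
  have e₃ : Complex.Gamma (-a₁ - a₂) * Complex.Gamma (n + a₁ + a₂) = halfGammaPair (n + 1) l :=
    Gamma_mul_Gamma_eq_halfGammaPair l (by rw [h₁, h₂]; ring) (by rw [h₁, h₂]; ring)
  have n₁ := halfGammaPair_ne_zero hn κ
  have n₂ := halfGammaPair_ne_zero hn ν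
  have n₃ := halfGammaPair_ne_zero hn l
  rw [triangularJ_eq hn (by rw [r₁]; linarith) (by rw [r₂]; linarith) (by rw [r₃]; linarith)
    (by rw [Complex.add_re, Complex.add_re, r₁, r₂, r₃]; linarith), starTriangleConst,
    legendreTripleValue, hd,
    Gamma_eq_quarterGamma (n := n) (z := -(a₁ + a₂ + a₃) - (n : ℂ) / 2) (κ + ν + l)
      (by rw [h₁, h₂, h₃]; push_cast; ring),
    Gamma_eq_quarterGamma (n := n) (z := a₁ + a₂ + a₃ + n) (-κ - ν - l)
      (by rw [h₁, h₂, h₃]; push_cast; ring),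
    Gamma_eq_quarterGamma (n := n) (z := -a₁) (-κ + ν + l) (by rw [h₁]; push_cast; ring),
    Gamma_eq_quarterGamma (n := n) (z := -a₂) (κ - ν + l) (by rw [h₂]; push_cast; ring),
    Gamma_eq_quarterGamma (n := n) (z := -a₃) (κ + ν - l) (by rw [h₃]; push_cast; ring),
    Gamma_eq_quarterGamma (n := n) (z := (n : ℂ) / 2 + a₁) (κ - ν - l) (by rw [h₁]; push_cast; ring),
    Gamma_eq_quarterGamma (n := n) (z := (n : ℂ) / 2 + a₂) (-κ + ν - l) (by rw [h₂]; push_cast; ring),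
    Gamma_eq_quarterGamma (n := n) (z := (n : ℂ) / 2 + a₃) (-κ - ν + l) (by rw [h₃]; push_cast; ring),
    show ((n + 1 : ℕ) : ℂ) = (n : ℂ) + 1 by push_cast; rfl]
  rw [← e₁] at n₁ ⊢
  rw [← e₂] at n₂ ⊢
  rw [← e₃] at n₃ ⊢
  have := left_ne_zero_of_mul n₁
  have := left_ne_zero_of_mul n₂
  have := left_ne_zero_of_mul n₃
  have := right_ne_zero_of_mul n₁
  have := right_ne_zero_of_mul n₂
  have := right_ne_zero_of_mul n₃
  generalize Complex.Gamma ((n : ℂ) / 2) = G at *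
  generalize (4 * (π : ℂ)) ^ ((3 : ℂ) / 2) = X₁ at *
  generalize (2 : ℂ) ^ (((n : ℂ) + 1) / 2) = X₂ at *
  generalize (2 * (π : ℂ)) ^ (3 * ((n : ℂ) + 1) / 2) = X₃ at *
  generalize (π : ℂ) ^ ((n : ℂ) / 2) = X₄ at *
  generalize (2 : ℂ) ^ (2 * (n : ℂ) - 1 + 2 * (a₁ + a₂ + a₃)) = X₅ at *
  generalize (2 : ℂ) ^ (-(a₁ + a₂ + a₃) - 1) = X₆ at *
  generalize (2 : ℂ) ^ (-(a₁ + a₂ + a₃)) = X₇ at *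
  generalize Complex.Gamma (-a₂ - a₃) = G₁ at *
  generalize Complex.Gamma (-a₃ - a₁) = G₂ at *
  generalize Complex.Gamma (-a₁ - a₂) = G₃ at *
  generalize Complex.Gamma (n + a₂ + a₃) = G₄ at *
  generalize Complex.Gamma (n + a₃ + a₁) = G₅ at *
  generalize Complex.Gamma (n + a₁ + a₂) = G₆ at *
  field_simp
  linear_combination (quarterGamma (n + 1) (κ + ν + l) * quarterGamma (n + 1) (κ + ν - l) *
    quarterGamma (n + 1) (κ - ν + l) * quarterGamma (n + 1) (κ - ν - l) *
    quarterGamma (n + 1) (-κ + ν + l) * quarterGamma (n + 1) (-κ + ν - l) *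
    quarterGamma (n + 1) (-κ - ν + l) * quarterGamma (n + 1) (-κ - ν - l)) * hc

theorem isStarTriangleConst_starTriangleConst {n : ℕ} (hn : 1 ≤ n) {a₁ a₂ a₃ : ℂ}
    (r₁ : a₁.re = -(n : ℝ) / 4) (r₂ : a₂.re = -(n : ℝ) / 4) (r₃ : a₃.re = -(n : ℝ) / 4) :
    IsStarTriangleConst (n + 1) a₁ a₂ a₃ (starTriangleConst (n + 1) a₁ a₂ a₃) := by
  have hn' : (1 : ℝ) ≤ n := by exact_mod_cast hn
  refine isStarTriangleConst (by omega) (by rw [r₁]; linarith) (by rw [r₂]; linarith)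
    (by rw [r₃]; linarith) ?_
  rw [Complex.add_re, Complex.add_re, r₁, r₂, r₃]
  push_cast
  linarith

/-- `integral_legendreTriple` needs `a₂ + a₃ = -n/2 + iκ`, whereas the exponents at `(κ, ν, l)` give
`-n/2 - iκ`. They are therefore taken at `(-κ, -ν, -l)`, which is harmless because the closed form
is even. -/
theorem hIntegral_eq_legendreTripleValue {n : ℕ} (hn : 1 ≤ n) (κ ν l : ℝ) :
    IntegrableOn (legendreTriple (n + 1) κ ν l) (Set.Ioi (1 : ℝ)) ∧
    hIntegral (n + 1) κ ν l = legendreTripleValue (n + 1) κ ν l := by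
  have hn' : (1 : ℝ) ≤ n := by exact_mod_cast hn
  obtain ⟨a₁, h₁⟩ : ∃ a₁ : ℂ, a₁ = -(n : ℂ) / 4 - Complex.I * (((-ν : ℝ) : ℂ) + (-l : ℝ) - (-κ : ℝ)) / 2 := ⟨_, rfl⟩
  obtain ⟨a₂, h₂⟩ : ∃ a₂ : ℂ, a₂ = -(n : ℂ) / 4 - Complex.I * (((-l : ℝ) : ℂ) + (-κ : ℝ) - (-ν : ℝ)) / 2 := ⟨_, rfl⟩
  obtain ⟨a₃, h₃⟩ : ∃ a₃ : ℂ, a₃ = -(n : ℂ) / 4 - Complex.I * (((-κ : ℝ) : ℂ) + (-ν : ℝ) - (-l : ℝ)) / 2 := ⟨_, rfl⟩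
  have r₁ : a₁.re = -(n : ℝ) / 4 := by rw [h₁]; simp
  have r₂ : a₂.re = -(n : ℝ) / 4 := by rw [h₂]; simp
  have r₃ : a₃.re = -(n : ℝ) / 4 := by rw [h₃]; simp
  have hA : (sphereArea (n + 1) : ℂ) ≠ 0 := by
    exact_mod_cast (sphereArea_pos (d := n + 1) (by omega)).ne'
  have hpi : (2 * (π : ℂ)) ^ (3 * ((n + 1 : ℕ) : ℂ) / 2) ≠ 0 := fun h => by
    rw [Complex.cpow_eq_zero_iff] at h
    exact absurd h.1 (by simp [pi_ne_zero])
  have hT := integrable_triangleFun hn (a₁ := a₁) (a₂ := a₂) (a₃ := a₃) (by rw [r₁]; linarith)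
    (by rw [r₂]; linarith) (by rw [r₃]; linarith)
    (by rw [Complex.add_re, Complex.add_re, r₁, r₂, r₃]; linarith)
  have hJ := triangularJ_eq hn (a₁ := a₁) (a₂ := a₂) (a₃ := a₃) (by rw [r₁]; linarith)
    (by rw [r₂]; linarith) (by rw [r₃]; linarith)
    (by rw [Complex.add_re, Complex.add_re, r₁, r₂, r₃]; linarith)
  have hTJ : ∫ p, triangleFun (n + 1) a₁ a₂ a₃ p ∂sphereMeasure₃ (n + 1) =
      (sphereArea (n + 1) : ℂ) ^ 3 * triangularJ (n + 1) a₁ a₂ a₃ := by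
    rw [hT.2, hJ]
    field_simp
  have hL := integral_legendreTriple hn κ ν l (a₁ := a₁) (a₂ := a₂) (a₃ := a₃)
    (by rw [h₂, h₃]; push_cast; ring) (by rw [h₃, h₁]; push_cast; ring)
    (by rw [h₁, h₂]; push_cast; ring)
    (isStarTriangleConst_starTriangleConst hn r₁ r₂ r₃)
    (isStarTriangleConst_starTriangleConst hn (by simpa using r₁) (by simpa using r₂) (by simpa using r₃))
    (integrable_triangleFun hn (by rw [Complex.ofReal_re, r₁]; linarith)
      (by rw [Complex.ofReal_re, r₂]; linarith) (by rw [Complex.ofReal_re, r₃]; linarith)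
      (by simp only [Complex.add_re, Complex.ofReal_re, r₁, r₂, r₃]; linarith)).1
  refine ⟨hL.1, mul_left_cancel₀ hpi (mul_left_cancel₀ hA ?_)⟩
  have hS := starTriangleConst_mul_triangularJ hn (-κ) (-ν) (-l) h₁ h₂ h₃
  rw [legendreTripleValue_neg] at hS
  have h2 := hL.2
  rw [hTJ, ← Complex.cpow_nat_mul, show ((3 : ℕ) : ℂ) * (((n + 1 : ℕ) : ℂ) / 2) =
    3 * ((n + 1 : ℕ) : ℂ) / 2 by push_cast; ring] at h2
  rw [h2, ← hS]
  ring

/-! ### The theorem. -/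

theorem mainTheorem3 (d : ℕ) (hd : 2 ≤ d) :
    -- evaluation of the triangular invariant `J`, on its whole domain of convergence
    (∀ a₁ a₂ a₃ : ℂ,
      -((d : ℝ) - 1) / 2 < a₁.re → -((d : ℝ) - 1) / 2 < a₂.re → -((d : ℝ) - 1) / 2 < a₃.re →
      -((d : ℝ) - 1) < (a₁ + a₂ + a₃).re →
        Integrable (triangleFun d a₁ a₂ a₃) (sphereMeasure₃ d) ∧
        triangularJ d a₁ a₂ a₃ =
          (2 : ℂ) ^ ((3 * (d : ℂ) - 5) / 2 + 2 * (a₁ + a₂ + a₃)) *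
            (2 * (π : ℂ)) ^ (((d : ℂ) - 1) / 2) * (sphereArea (d - 1) : ℂ) / (sphereArea d : ℂ) ^ 2 *
          (Complex.Gamma (a₁ + a₂ + a₃ + (d : ℂ) - 1) *
            (Complex.Gamma (((d : ℂ) - 1) / 2 + a₁) * Complex.Gamma (((d : ℂ) - 1) / 2 + a₂) *
              Complex.Gamma (((d : ℂ) - 1) / 2 + a₃)) /
            (Complex.Gamma ((d : ℂ) - 1 + a₂ + a₃) * Complex.Gamma ((d : ℂ) - 1 + a₃ + a₁) *
              Complex.Gamma ((d : ℂ) - 1 + a₁ + a₂)))) ∧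
    -- evaluation of `h_d` through `c` and `J`
    (∀ κ ν l : ℝ, ∀ a₁ a₂ a₃ a : ℂ,
      a₁ = -((d : ℂ) - 1) / 4 - Complex.I * ((ν : ℂ) + l - κ) / 2 →
      a₂ = -((d : ℂ) - 1) / 4 - Complex.I * ((l : ℂ) + κ - ν) / 2 →
      a₃ = -((d : ℂ) - 1) / 4 - Complex.I * ((κ : ℂ) + ν - l) / 2 →
      a = a₁ + a₂ + a₃ →
        IntegrableOn (legendreTriple d κ ν l) (Set.Ioi (1 : ℝ)) ∧
        (∃ c : ℂ, IsStarTriangleConst d a₁ a₂ a₃ c ∧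
          c = (2 : ℂ) ^ (-a - 1) * (π : ℂ) ^ (((d : ℂ) - 1) / 2) *
              Complex.Gamma (-a - ((d : ℂ) - 1) / 2) *
              (Complex.Gamma (-a₁) * Complex.Gamma (-a₂) * Complex.Gamma (-a₃) /
                (Complex.Gamma (-a₂ - a₃) * Complex.Gamma (-a₃ - a₁) *
                  Complex.Gamma (-a₁ - a₂))) ∧
          hIntegral d κ ν l =
            1 / (2 * (π : ℂ)) ^ (3 * (d : ℂ) / 2) * (2 : ℂ) ^ (-a) * (sphereArea d : ℂ) ^ 2 * c *
              triangularJ d a₁ a₂ a₃) ∧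
        hIntegral d κ ν l =
          (2 : ℂ) ^ ((d : ℂ) / 2) * Complex.Gamma (-a - ((d : ℂ) - 1) / 2) *
              Complex.Gamma (a + (d : ℂ) - 1) /
            ((4 * (π : ℂ)) ^ ((3 : ℂ) / 2) * Complex.Gamma (((d : ℂ) - 1) / 2)) *
            (Complex.Gamma (((d : ℂ) - 1) / 2 + a₁) * Complex.Gamma (-a₁) /
              (Complex.Gamma ((d : ℂ) - 1 + a - a₁) * Complex.Gamma (a₁ - a))) *
            (Complex.Gamma (((d : ℂ) - 1) / 2 + a₂) * Complex.Gamma (-a₂) /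
              (Complex.Gamma ((d : ℂ) - 1 + a - a₂) * Complex.Gamma (a₂ - a))) *
            (Complex.Gamma (((d : ℂ) - 1) / 2 + a₃) * Complex.Gamma (-a₃) /
              (Complex.Gamma ((d : ℂ) - 1 + a - a₃) * Complex.Gamma (a₃ - a))) ∧
        hIntegral d κ ν l =
          (2 : ℂ) ^ ((d : ℂ) / 2) /
            ((4 * (π : ℂ)) ^ ((3 : ℂ) / 2) * Complex.Gamma (((d : ℂ) - 1) / 2)) *
            ((quarterGamma d (κ + ν + l) * quarterGamma d (κ + ν - l) *
              quarterGamma d (κ - ν + l) * quarterGamma d (κ - ν - l) *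
              quarterGamma d (-κ + ν + l) * quarterGamma d (-κ + ν - l) *
              quarterGamma d (-κ - ν + l) * quarterGamma d (-κ - ν - l)) /
              (halfGammaPair d κ * halfGammaPair d ν * halfGammaPair d l))) := by

  obtain ⟨n, rfl⟩ : ∃ n, d = n + 1 := ⟨d - 1, by omega⟩
  have hn : 1 ≤ n := by omega
  have hn' : (1 : ℝ) ≤ n := by exact_mod_cast hn
  have hd1 : ((n + 1 : ℕ) : ℂ) - 1 = n := by push_cast; ring
  have hd2 : ((n + 1 : ℕ) : ℝ) - 1 = n := by push_cast; ring
  refine ⟨?_, ?_⟩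
  · intro a₁ a₂ a₃ h₁ h₂ h₃ h
    rw [hd2] at h₁ h₂ h₃ h
    rw [neg_div] at h₁ h₂ h₃
    refine ⟨(integrable_triangleFun hn h₁ h₂ h₃ h).1, (triangularJ_eq hn h₁ h₂ h₃ h).trans ?_⟩
    -- The stated normalization regroups the powers of 2: `(3d-5)/2 + (d-1)/2 = 2n - 1`.
    have e : (2 : ℂ) ^ ((3 * ((n + 1 : ℕ) : ℂ) - 5) / 2 + 2 * (a₁ + a₂ + a₃)) *
        (2 * (π : ℂ)) ^ ((n : ℂ) / 2) =
        (2 : ℂ) ^ (2 * (n : ℂ) - 1 + 2 * (a₁ + a₂ + a₃)) * (π : ℂ) ^ ((n : ℂ) / 2) := by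
      have h2 := Complex.mul_cpow_ofReal_nonneg (a := 2) (b := π) zero_le_two pi_pos.le ((n : ℂ) / 2)
      rw [Complex.ofReal_ofNat] at h2
      rw [h2, ← mul_assoc, ← Complex.cpow_add _ _ two_ne_zero]
      congr 2
      push_cast
      ring
    rw [hd1, e, add_sub_assoc, hd1, Nat.add_sub_cancel]
  · intro κ ν l a₁ a₂ a₃ a h₁ h₂ h₃ ha
    subst ha
    rw [hd1] at h₁ h₂ h₃
    have r₁ : a₁.re = -(n : ℝ) / 4 := by rw [h₁]; simp
    have r₂ : a₂.re = -(n : ℝ) / 4 := by rw [h₂]; simp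
    have r₃ : a₃.re = -(n : ℝ) / 4 := by rw [h₃]; simp
    obtain ⟨hint, hval⟩ := hIntegral_eq_legendreTripleValue hn κ ν l
    have hpi : (2 * (π : ℂ)) ^ (3 * ((n + 1 : ℕ) : ℂ) / 2) ≠ 0 := fun h => by
      rw [Complex.cpow_eq_zero_iff] at h
      exact absurd h.1 (by simp [pi_ne_zero])
    refine ⟨hint, ⟨starTriangleConst (n + 1) a₁ a₂ a₃,
      isStarTriangleConst_starTriangleConst hn r₁ r₂ r₃, rfl, ?_⟩, ?_, hval⟩
    · have hS := starTriangleConst_mul_triangularJ hn κ ν l h₁ h₂ h₃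
      rw [hval]
      field_simp
      linear_combination -hS
    · have e₁ : Complex.Gamma (a₁ - (a₁ + a₂ + a₃)) * Complex.Gamma (n + (a₁ + a₂ + a₃) - a₁) =
          halfGammaPair (n + 1) κ :=
        Gamma_mul_Gamma_eq_halfGammaPair κ (by rw [h₁, h₂, h₃]; ring) (by rw [h₁, h₂, h₃]; ring)
      have e₂ : Complex.Gamma (a₂ - (a₁ + a₂ + a₃)) * Complex.Gamma (n + (a₁ + a₂ + a₃) - a₂) =
          halfGammaPair (n + 1) ν :=
        Gamma_mul_Gamma_eq_halfGammaPair ν (by rw [h₁, h₂, h₃]; ring) (by rw [h₁, h₂, h₃]; ring)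
      have e₃ : Complex.Gamma (a₃ - (a₁ + a₂ + a₃)) * Complex.Gamma (n + (a₁ + a₂ + a₃) - a₃) =
          halfGammaPair (n + 1) l :=
        Gamma_mul_Gamma_eq_halfGammaPair l (by rw [h₁, h₂, h₃]; ring) (by rw [h₁, h₂, h₃]; ring)
      rw [hval, legendreTripleValue, add_sub_assoc _ ((n + 1 : ℕ) : ℂ), hd1, ← e₁, ← e₂, ← e₃,
        Gamma_eq_quarterGamma (n := n) (z := -(a₁ + a₂ + a₃) - (n : ℂ) / 2) (κ + ν + l)
          (by rw [h₁, h₂, h₃]; push_cast; ring),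
        Gamma_eq_quarterGamma (n := n) (z := a₁ + a₂ + a₃ + n) (-κ - ν - l)
          (by rw [h₁, h₂, h₃]; push_cast; ring),
        Gamma_eq_quarterGamma (n := n) (z := -a₁) (-κ + ν + l) (by rw [h₁]; push_cast; ring),
        Gamma_eq_quarterGamma (n := n) (z := -a₂) (κ - ν + l) (by rw [h₂]; push_cast; ring),
        Gamma_eq_quarterGamma (n := n) (z := -a₃) (κ + ν - l) (by rw [h₃]; push_cast; ring),
        Gamma_eq_quarterGamma (n := n) (z := (n : ℂ) / 2 + a₁) (κ - ν - l)
          (by rw [h₁]; push_cast; ring),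
        Gamma_eq_quarterGamma (n := n) (z := (n : ℂ) / 2 + a₂) (-κ + ν - l)
          (by rw [h₂]; push_cast; ring),
        Gamma_eq_quarterGamma (n := n) (z := (n : ℂ) / 2 + a₃) (-κ - ν + l)
          (by rw [h₃]; push_cast; ring)]
      ring
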